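/- Let $\Phi$ be the standard normal distribution function and $\Lambda(x)=\exp(-e^{-x})$. For $\lambda\in(0,\infty)$ let $$H_\lambda(x,y)=\exp\Bigl(-\Phi\bigl(\lambda+\tfrac{x-y}{2\lambda}\bigr)e^{-y}-\Phi\bigl(\lambda+\tfrac{y-x}{2\lambda}\bigr)e^{-x}\Bigr),\qquad x,y\in\mathbb R,$$ and let $H_0(x,y)=\min(\Lambda(x),\Lambda(y))$, $H_\infty(x,y)=\Lambda(x)\Lambda(y)$. Put $u_n(s)=a_ns+b_n$ with $a_n=(2\ln n)^{-1/2}$ and $b_n=\sqrt{2\ln n}-\frac{\ln(4\pi\ln n)}{2\sqrt{2\ln n}}$. Let $\{(X^{(1)}_{n,k},X^{(2)}_{n,k}):1\le k\le n,\ n\ge1\}$ be a triangular array of jointly Gaussian random variables (jointly over all rows) with mean zero and variance one such that $$\mathrm{corr}(X^{(1)}_{n,k},X^{(2)}_{n,k})=\rho_0(n),\qquad \mathrm{corr}(X^{(i)}_{n,k},X^{(j)}_{n,l})=\rho_{ij}(|k-l|,n)\quad(1\le k\ne l\le n,\ i,j\in\{1,2\}),$$ and, for elements of different rows, $$\mathrm{corr}(X^{(i)}_{m,k},X^{(j)}_{n,l})=\gamma_{ij}(|k-l|+1,m,n)\quad(1\le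 k\le m,\ 1\le l\le n,\ m<n,\ i,j\in\{1,2\}).$$ Assume: 1. $\sigma:=\sup_{1\le k<n,\ i,j}|\rho_{ij}(k,n)|<1$, and for some $\alpha\in(0,\frac{1-\sigma}{1+\sigma})$, with $I_n=\lfloor n^\alpha\rfloor$, $\lim_{n\to\infty}\max_{I_n\le k<n;\ i,j}|\rho_{ij}(k,n)|\ln n=0$; 2. $\lim_{n\to\infty}(1-\rho_0(n))\ln n=\lambda^2$ with $\lambda\in[0,\infty]$; 3. $\theta:=\sup_{1\le t\le n,\ 1\le m<n,\ i,j}|\gamma_{ij}(t,m,n)|<1$, and, for some $\beta\in(0,\frac{1-\theta}{1+\theta})$ and $\epsilon>0$, with $J_n=\lfloor n^\beta\rfloor$, as $n\to\infty$, $$\max_{I_n\le s<n;\ i,j}|\rho_{ij}(s,n)|\ln s\,(\ln\ln s)^{1+\epsilon}=O(1),\qquad \max_{1\le m<n}\ \max_{J_n\le t\le n;\ i,j}|\gamma_{ij}(t,m,n)|\ln t\,(\ln\ln t)^{1+\epsilon}=O(1).$$ Let $M^{(i)}_n=\max_{1\le k\le n}X^{(i)}_{n,k}$ and $m^{(i)}_n=\min_{1\le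 k\le n}X^{(i)}_{n,k}$. Then for all $x,y\in\mathbb R$, almost surely $$\lim_{n\to\infty}\frac1{\ln n}\sum_{k=1}^n\frac1k\mathbf 1\bigl(M^{(1)}_k\le u_k(x),\,M^{(2)}_k\le u_k(y)\bigr)=H_\lambda(x,y).$$ Furthermore, provided that, in the case $\lambda=\infty$, also $(1+\rho_0(n))\ln n\to\infty$, for all $x_1,x_2,y_1,y_2\in\mathbb R$, almost surely $$\lim_{n\to\infty}\frac1{\ln n}\sum_{k=1}^n\frac1k\mathbf 1\bigl(-u_k(y_1)<m^{(1)}_k\le M^{(1)}_k\le u_k(x_1),\,-u_k(y_2)<m^{(2)}_k\le M^{(2)}_k\le u_k(x_2)\bigr)=H_\lambda(x_1,x_2)H_\lambda(y_1,y_2).$$ -/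

import Mathlib

open MeasureTheory ProbabilityTheory Filter Topology
open scoped ENNReal

noncomputable section

namespace HuslerReiss

/-- The standard normal distribution function `Φ`. -/
def stdNormalCDF (x : ℝ) : ℝ := cdf (gaussianReal 0 1) x

/-- The Gumbel distribution function `Λ`. -/
def gumbel (x : ℝ) : ℝ := Real.exp (-Real.exp (-x))

/-- The Hüsler–Reiss distribution function `H_lam`, for a parameter `lam ∈ [0, ∞]`. -/
def hrCDF (lam : ℝ≥0∞) (x y : ℝ) : ℝ :=
  if lam = 0 then min (gumbel x) (gumbel y)
  else if lam = ⊤ then gumbel x * gumbel y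
  else Real.exp
    (-(stdNormalCDF (lam.toReal + (x - y) / (2 * lam.toReal)) * Real.exp (-y))
      - stdNormalCDF (lam.toReal + (y - x) / (2 * lam.toReal)) * Real.exp (-x))

/-- The scale constant `a_n`. -/
def scaleConst (n : ℕ) : ℝ := 1 / √(2 * Real.log n)

/-- The location constant `b_n`. -/
def locConst (n : ℕ) : ℝ :=
  √(2 * Real.log n) - 1 / (2 * √(2 * Real.log n)) * Real.log (4 * Real.pi * Real.log n)

/-- The level `u_n(s) = a_n s + b_n`. -/
def level (n : ℕ) (s : ℝ) : ℝ := scaleConst n * s + locConst n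

/-- The distance `|k - l|` of two positions. -/
def gap (k l : ℕ) : ℕ := ((k : ℤ) - (l : ℤ)).natAbs

/-- The positions `(n, k)`, `1 ≤ k ≤ n`, of a triangular array. -/
def Position : Type := {p : ℕ × ℕ // 1 ≤ p.2 ∧ p.2 ≤ p.1}

section Array

variable {Ω : Type*} [MeasurableSpace Ω]

/-- The correlation coefficient of two real random variables. -/
def corr (P : Measure Ω) (Y Z : Ω → ℝ) : ℝ :=
  cov[Y, Z; P] / (√(Var[Y; P]) * √(Var[Z; P]))

/-- `X n k i` is the component `i` of the vector at position `k` of row `n`; only the entries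
with `1 ≤ k ≤ n` matter. The entries are jointly Gaussian, centred and of variance one; inside
row `n` the two components of a vector have correlation `ρ₀ n`, and entries at different
positions `k`, `l` have correlation `ρ i j |k - l| n`. -/
structure IsStationaryGaussianArray (P : Measure Ω) (X : ℕ → ℕ → Fin 2 → Ω → ℝ)
    (ρ₀ : ℕ → ℝ) (ρ : Fin 2 → Fin 2 → ℕ → ℕ → ℝ) : Prop where
  gaussian : IsGaussianProcess
    (fun (t : Position × Fin 2) (ω : Ω) => X t.1.1.1 t.1.1.2 t.2 ω) P
  mean_zero : ∀ n k, 1 ≤ k → k ≤ n → ∀ i, ∫ ω, X n k i ω ∂P = 0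
  unit_variance : ∀ n k, 1 ≤ k → k ≤ n → ∀ i, Var[X n k i; P] = 1
  corr_same : ∀ n k, 1 ≤ k → k ≤ n → corr P (X n k 0) (X n k 1) = ρ₀ n
  corr_row : ∀ n k l, 1 ≤ k → k ≤ n → 1 ≤ l → l ≤ n → k ≠ l →
    ∀ i j, corr P (X n k i) (X n l j) = ρ i j (gap k l) n

/-- Entries of different rows `m < n` have correlation `γ i j (|k - l| + 1) m n`. -/
def HasCrossRowCorr (P : Measure Ω) (X : ℕ → ℕ → Fin 2 → Ω → ℝ)
    (γ : Fin 2 → Fin 2 → ℕ → ℕ → ℕ → ℝ) : Prop :=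
  ∀ m n k l, m < n → 1 ≤ k → k ≤ m → 1 ≤ l → l ≤ n →
    ∀ i j, corr P (X m k i) (X n l j) = γ i j (gap k l + 1) m n

/-- The row maximum `M_n^{(i)}` (used for `n ≥ 1`). -/
def rowMax (X : ℕ → ℕ → Fin 2 → Ω → ℝ) (n : ℕ) (i : Fin 2) (ω : Ω) : ℝ :=
  sSup ((fun k => X n k i ω) '' Set.Icc 1 n)

/-- The row minimum `m_n^{(i)}` (used for `n ≥ 1`). -/
def rowMin (X : ℕ → ℕ → Fin 2 → Ω → ℝ) (n : ℕ) (i : Fin 2) (ω : Ω) : ℝ :=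
  sInf ((fun k => X n k i ω) '' Set.Icc 1 n)

/-- The event `{M_k^{(1)} ≤ u_k(x), M_k^{(2)} ≤ u_k(y)}`. -/
def maxEvent (X : ℕ → ℕ → Fin 2 → Ω → ℝ) (k : ℕ) (x y : ℝ) : Set Ω :=
  {ω | rowMax X k 0 ω ≤ level k x ∧ rowMax X k 1 ω ≤ level k y}

/-- The event
`{-u_k(y₁) < m_k^{(1)} ≤ M_k^{(1)} ≤ u_k(x₁), -u_k(y₂) < m_k^{(2)} ≤ M_k^{(2)} ≤ u_k(x₂)}`. -/
def maxMinEvent (X : ℕ → ℕ → Fin 2 → Ω → ℝ) (k : ℕ) (x₁ x₂ y₁ y₂ : ℝ) : Set Ω :=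
  {ω | (-level k y₁ < rowMin X k 0 ω ∧ rowMin X k 0 ω ≤ rowMax X k 0 ω ∧
        rowMax X k 0 ω ≤ level k x₁) ∧
       (-level k y₂ < rowMin X k 1 ω ∧ rowMin X k 1 ω ≤ rowMax X k 1 ω ∧
        rowMax X k 1 ω ≤ level k x₂)}

/-- The logarithmic average `(1 / ln n) ∑_{k=1}^n (1 / k) 1_{A_k}(ω)`. -/
def logAverage (A : ℕ → Set Ω) (n : ℕ) (ω : Ω) : ℝ :=
  1 / Real.log n * ∑ k ∈ Finset.Icc 1 n, 1 / (k : ℝ) * (A k).indicator (fun _ => (1 : ℝ)) ω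

end Array

/-- `[n ^ α]`, the integer part. -/
def powFloor (α : ℝ) (n : ℕ) : ℕ := ⌊(n : ℝ) ^ α⌋₊

/-- `σ = sup |ρ_ij(k, n)|` over `1 ≤ k < n`, `n ≥ 2` and `i, j`. -/
def IsRowSup (ρ : Fin 2 → Fin 2 → ℕ → ℕ → ℝ) (σ : ℝ) : Prop :=
  IsLUB {r | ∃ i j k n, 1 ≤ k ∧ k < n ∧ r = |ρ i j k n|} σ

/-- `θ = sup |γ_ij(t, m, n)|` over `1 ≤ t ≤ n`, `1 ≤ m < n` and `i, j`. -/
def IsCrossSup (γ : Fin 2 → Fin 2 → ℕ → ℕ → ℕ → ℝ) (θ : ℝ) : Prop :=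
  IsLUB {r | ∃ i j t m n, 1 ≤ t ∧ t ≤ n ∧ 1 ≤ m ∧ m < n ∧ r = |γ i j t m n|} θ

/-- The Berman condition `max_{[n^α] ≤ k < n; i, j} |ρ_ij(k, n)| ln n → 0`. -/
def BermanCondition (ρ : Fin 2 → Fin 2 → ℕ → ℕ → ℝ) (α : ℝ) : Prop :=
  ∀ δ > 0, ∀ᶠ n : ℕ in atTop, ∀ i j k, powFloor α n ≤ k → k < n →
    |ρ i j k n| * Real.log n ≤ δ

/-- `max_{[n^α] ≤ s < n} |ρ_ij(s, n)| ln s (ln ln s)^{1+ε} = O(1)` as `n → ∞`. -/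
def RowRate (ρ : Fin 2 → Fin 2 → ℕ → ℕ → ℝ) (α ε : ℝ) : Prop :=
  ∃ C : ℝ, ∀ᶠ n : ℕ in atTop, ∀ i j s, powFloor α n ≤ s → s < n →
    |ρ i j s n| * Real.log s * Real.log (Real.log s) ^ (1 + ε) ≤ C

/-- `max_{[n^β] ≤ t ≤ n} |γ_ij(t, m, n)| ln t (ln ln t)^{1+ε} = O(1)` as `n → ∞`,
uniformly in `1 ≤ m < n`. -/
def CrossRate (γ : Fin 2 → Fin 2 → ℕ → ℕ → ℕ → ℝ) (β ε : ℝ) : Prop :=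
  ∃ C : ℝ, ∀ᶠ n : ℕ in atTop, ∀ m, 1 ≤ m → m < n → ∀ i j t, powFloor β n ≤ t → t ≤ n →
    |γ i j t m n| * Real.log t * Real.log (Real.log t) ^ (1 + ε) ≤ C

end HuslerReiss

end

open MeasureTheory ProbabilityTheory Filter Topology
open scoped ENNReal

noncomputable section

namespace HuslerReiss

/-! ### The standard normal density and distribution function -/

/-! Both limits are statements about "row events": all entries of row `n` lie in prescribed windows,
half lines for the maxima and intervals for maxima and minima together. It suffices that the
probabilities of the row events converge and that row events of different rows are nearly
uncorrelated.

Both facts rest on one normal comparison inequality, `abs_measure_windows_sub_prod_le`. A Gaussian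
vector whose coordinates are split into groups is rotated into the vector whose groups are
independent with unchanged laws. Along the rotation only covariances between groups change, so
Gaussian integration by parts bounds the change of a product probability by a sum over pairs from
different groups of `|r| exp(-(w_s² + w_t²) / (2 (1 + |r|)))`, where `w` is the distance of the
window endpoints from the origin. In the sum for rows `m ≤ n`, pairs at distance less than `n^β` are
few and contribute a negative power of `n`; the others contribute a multiple of `q ln n`, where `q`
bounds their correlations (`exists_comparison_sum_bound`).

With the positions of one row as groups, the row event has asymptotically the probability `p_n^n`,
where `p_n` belongs to a single Gaussian pair (`tendsto_measure_rowEvent_sub_pow`). Then `n (1 -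
p_n)` is computed by conditioning on one coordinate: at `u_n(z)` the rescaled density tends to
`exp(-z)`, and the conditional probability of the other coordinate tends to an explicit function of
`z` and `λ` (`tendsto_condProb`, `integral_condLimit`). For intervals, upper and lower exceedances
have the same limit law by symmetry and do not occur together in the limit, because changing the
sign of one coordinate gives an asymptotically independent pair; this is where `(1 + ρ₀) ln n → ∞`
enters.

With two rows as groups, the covariance of the row events is `O((ln ln n)^{-(1+ε)})`
(`exists_abs_measure_inter_rowEvent_sub_le`). The logarithmic averages of the centred indicators
then have summable second moments along `exp(exp(j^δ))` for `1/(1+ε) < δ < 1`, hence tend to zero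
there almost surely. Monotonicity of the partial sums fills the gaps, since the logarithms of
consecutive indices have ratio tending to one (`ae_tendsto_logAverage`). -/

lemma stdPDF_eq (x : ℝ) :
    gaussianPDFReal 0 1 x = (√(2 * Real.pi))⁻¹ * Real.exp (-x ^ 2 / 2) := by
  simp [gaussianPDFReal]

lemma hasDerivAt_stdPDF (x : ℝ) :
    HasDerivAt (gaussianPDFReal 0 1) (-x * gaussianPDFReal 0 1 x) x := by
  have h : HasDerivAt (fun x : ℝ => (√(2 * Real.pi))⁻¹ * Real.exp (-x ^ 2 / 2))
      ((√(2 * Real.pi))⁻¹ * (Real.exp (-x ^ 2 / 2) * (-(2 * x) / 2))) x := by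
    have h2 : HasDerivAt (fun x : ℝ => -x ^ 2 / 2) (-(2 * x) / 2) x := by
      simpa using ((hasDerivAt_pow 2 x).neg.div_const 2)
    exact (h2.exp).const_mul _
  have e : gaussianPDFReal 0 1 = fun x : ℝ => (√(2 * Real.pi))⁻¹ * Real.exp (-x ^ 2 / 2) :=
    funext stdPDF_eq
  rw [e]
  convert h using 1
  ring

lemma continuous_stdPDF : Continuous (gaussianPDFReal 0 1) :=
  continuous_iff_continuousAt.2 fun x => (hasDerivAt_stdPDF x).continuousAt

lemma stdPDF_le_one (x : ℝ) : gaussianPDFReal 0 1 x ≤ 1 := by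
  rw [stdPDF_eq]
  have h1 : (√(2 * Real.pi))⁻¹ ≤ 1 := by
    apply inv_le_one_of_one_le₀
    rw [Real.one_le_sqrt]
    nlinarith [Real.pi_gt_three]
  have h2 : Real.exp (-x ^ 2 / 2) ≤ 1 := by
    rw [Real.exp_le_one_iff]
    nlinarith [sq_nonneg x]
  exact mul_le_one₀ h1 (Real.exp_pos _).le h2

lemma abs_mul_stdPDF_le_one (x : ℝ) : |x * gaussianPDFReal 0 1 x| ≤ 1 := by
  rw [abs_mul, abs_of_nonneg (gaussianPDFReal_nonneg _ _ _), stdPDF_eq]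
  have h1 : (√(2 * Real.pi))⁻¹ ≤ 1 := by
    apply inv_le_one_of_one_le₀
    rw [Real.one_le_sqrt]
    nlinarith [Real.pi_gt_three]
  have h2 : |x| * Real.exp (-x ^ 2 / 2) ≤ 1 := by
    have h3 : |x| ≤ Real.exp (x ^ 2 / 2) := by
      have := Real.add_one_le_exp (x ^ 2 / 2)
      nlinarith [sq_nonneg (|x| - 1), sq_abs x]
    calc |x| * Real.exp (-x ^ 2 / 2) ≤ Real.exp (x ^ 2 / 2) * Real.exp (-x ^ 2 / 2) := by gcongr
      _ = 1 := by rw [← Real.exp_add]; simp; ring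
  calc |x| * ((√(2 * Real.pi))⁻¹ * Real.exp (-x ^ 2 / 2))
      = (√(2 * Real.pi))⁻¹ * (|x| * Real.exp (-x ^ 2 / 2)) := by ring
    _ ≤ 1 := mul_le_one₀ h1 (by positivity) h2

lemma stdNormalCDF_eq_integral (x : ℝ) :
    stdNormalCDF x = ∫ t in Set.Iic x, gaussianPDFReal 0 1 t := by
  rw [stdNormalCDF, cdf_eq_real, Measure.real, gaussianReal_apply_eq_integral 0 one_ne_zero,
    ENNReal.toReal_ofReal (integral_nonneg fun t => gaussianPDFReal_nonneg _ _ _)]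

lemma hasDerivAt_stdNormalCDF (x : ℝ) :
    HasDerivAt stdNormalCDF (gaussianPDFReal 0 1 x) x := by
  have e : stdNormalCDF = fun x => stdNormalCDF 0 + ∫ t in (0 : ℝ)..x, gaussianPDFReal 0 1 t := by
    funext x
    rw [stdNormalCDF_eq_integral, stdNormalCDF_eq_integral,
      ← intervalIntegral.integral_Iic_sub_Iic (integrable_gaussianPDFReal 0 1).integrableOn
        (integrable_gaussianPDFReal 0 1).integrableOn]
    ring
  rw [e]
  refine HasDerivAt.const_add _ ?_
  exact intervalIntegral.integral_hasDerivAt_right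
    ((integrable_gaussianPDFReal 0 1).intervalIntegrable)
    (stronglyMeasurable_gaussianPDFReal 0 1).stronglyMeasurableAtFilter
    continuous_stdPDF.continuousAt

lemma continuous_stdNormalCDF : Continuous stdNormalCDF :=
  continuous_iff_continuousAt.2 fun x => (hasDerivAt_stdNormalCDF x).continuousAt

lemma stdNormalCDF_nonneg (x : ℝ) : 0 ≤ stdNormalCDF x := cdf_nonneg _ _

lemma stdNormalCDF_le_one (x : ℝ) : stdNormalCDF x ≤ 1 := cdf_le_one _ _

lemma stdNormalCDF_mono : Monotone stdNormalCDF := monotone_cdf _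

/-- Gaussian integration by parts on the line. -/
lemma integral_id_mul_stdGaussian {G G' : ℝ → ℝ} (hG : ∀ x, HasDerivAt G (G' x) x)
    (hG' : Continuous G') {C : ℝ} (hC : ∀ x, |G x| ≤ C) (hC' : ∀ x, |G' x| ≤ C) :
    ∫ w, w * G w ∂(gaussianReal 0 1) = ∫ w, G' w ∂(gaussianReal 0 1) := by
  rw [integral_gaussianReal_eq_integral_smul one_ne_zero,
    integral_gaussianReal_eq_integral_smul one_ne_zero]
  have hGc : Continuous G := continuous_iff_continuousAt.2 fun x => (hG x).continuousAt
  have hid : Integrable (fun x : ℝ => x * gaussianPDFReal 0 1 x) := by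
    have h := (memLp_id_gaussianReal (μ := 0) (v := 1) 1).integrable (by simp)
    rw [gaussianReal_of_var_ne_zero _ one_ne_zero] at h
    rw [integrable_withDensity_iff (measurable_gaussianPDF 0 1)
      (Eventually.of_forall fun x => gaussianPDF_lt_top)] at h
    simpa [toReal_gaussianPDF] using h
  have hb : ∀ {F H : ℝ → ℝ}, Integrable F → Continuous H → (∀ x, |H x| ≤ C) →
      Integrable (H * F) := fun hF hH hHC => by
    exact hF.bdd_mul hH.aestronglyMeasurable (Eventually.of_forall hHC)
  -- The density satisfies `φ' = -x φ`, so this is ordinary integration by parts against `φ`;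
  -- integrability of the products removes the boundary terms.
  have key := integral_mul_deriv_eq_deriv_mul_of_integrable (u := G) (u' := G')
    (v := gaussianPDFReal 0 1) (v' := fun x => -x * gaussianPDFReal 0 1 x)
    (fun x _ => hG x) (fun x _ => hasDerivAt_stdPDF x)
    (hb (by simpa using hid.neg) hGc hC) (hb (integrable_gaussianPDFReal 0 1) hG' hC')
    (hb (integrable_gaussianPDFReal 0 1) hGc hC)
  have e1 : ∀ x : ℝ, gaussianPDFReal 0 1 x • (x * G x)
      = -(G x * (-x * gaussianPDFReal 0 1 x)) := fun x => by simp only [smul_eq_mul]; ring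
  have e2 : ∀ x : ℝ, gaussianPDFReal 0 1 x • G' x = G' x * gaussianPDFReal 0 1 x :=
    fun x => by simp only [smul_eq_mul]; ring
  simp_rw [e1, e2]
  rw [integral_neg, key, neg_neg]

/-! ### Bivariate standard Gaussian laws -/

/-- The centred Gaussian law on the plane with unit variances and correlation `r`. -/
def bivGaussian (r : ℝ) : Measure (ℝ × ℝ) :=
  ((gaussianReal 0 1).prod (gaussianReal 0 1)).map
    (fun p => (r * p.1 + √(1 - r ^ 2) * p.2, p.1))

instance (r : ℝ) : IsProbabilityMeasure (bivGaussian r) :=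
  Measure.isProbabilityMeasure_map (by fun_prop)

/-- `(U, V)` is a centred Gaussian pair with unit variances and covariance `r`. -/
structure IsStdPair {Ω : Type*} [MeasurableSpace Ω] (P : Measure Ω) (U V : Ω → ℝ) (r : ℝ) :
    Prop where
  gaussian : HasGaussianLaw (fun ω => (U ω, V ω)) P
  mean_fst : ∫ ω, U ω ∂P = 0
  mean_snd : ∫ ω, V ω ∂P = 0
  var_fst : Var[U; P] = 1
  var_snd : Var[V; P] = 1
  cov_eq : cov[U, V; P] = r

namespace IsStdPair

variable {Ω Ω' : Type*} [MeasurableSpace Ω] [MeasurableSpace Ω'] {P : Measure Ω} {P' : Measure Ω'}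
  {U V : Ω → ℝ} {U' V' : Ω' → ℝ} {r : ℝ}

lemma variance_lin (h : IsStdPair P U V r) (a b : ℝ) :
    Var[fun ω => a * U ω + b * V ω; P] = a ^ 2 + 2 * (a * b * r) + b ^ 2 := by
  have := h.gaussian.isProbabilityMeasure
  rw [variance_fun_add (h.gaussian.fst.memLp_two.const_mul a)
    (h.gaussian.snd.memLp_two.const_mul b), variance_const_mul, variance_const_mul,
    covariance_const_mul_left, covariance_const_mul_right, h.var_fst, h.var_snd, h.cov_eq]
  ring

lemma integral_lin (h : IsStdPair P U V r) (a b : ℝ) :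
    ∫ ω, (a * U ω + b * V ω) ∂P = 0 := by
  rw [integral_add (h.gaussian.fst.integrable.const_mul a) (h.gaussian.snd.integrable.const_mul b),
    integral_const_mul, integral_const_mul, h.mean_fst, h.mean_snd]
  simp

/-- The residual `U - r V` has variance `1 - r²`. -/
lemma sq_le_one (h : IsStdPair P U V r) : r ^ 2 ≤ 1 := by
  have h1 := h.variance_lin 1 (-r)
  have h2 := variance_nonneg (fun ω => 1 * U ω + (-r) * V ω) P
  rw [h1] at h2
  nlinarith

lemma abs_le_one (h : IsStdPair P U V r) : |r| ≤ 1 := by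
  have := h.sq_le_one
  rwa [sq_le_one_iff_abs_le_one] at this

lemma neg_neg (h : IsStdPair P U V r) : IsStdPair P (fun ω => -U ω) (fun ω => -V ω) r where
  gaussian := h.gaussian.map_fun (-ContinuousLinearMap.id ℝ (ℝ × ℝ))
  mean_fst := by rw [integral_neg, h.mean_fst, neg_zero]
  mean_snd := by rw [integral_neg, h.mean_snd, neg_zero]
  var_fst := by rw [variance_fun_neg, h.var_fst]
  var_snd := by rw [variance_fun_neg, h.var_snd]
  cov_eq := by rw [covariance_fun_neg_left, covariance_fun_neg_right, h.cov_eq, _root_.neg_neg]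

lemma neg_right (h : IsStdPair P U V r) : IsStdPair P U (fun ω => -V ω) (-r) where
  gaussian := h.gaussian.map_fun
    ((ContinuousLinearMap.fst ℝ ℝ ℝ).prod (-ContinuousLinearMap.snd ℝ ℝ ℝ))
  mean_fst := h.mean_fst
  mean_snd := by rw [integral_neg, h.mean_snd, neg_zero]
  var_fst := h.var_fst
  var_snd := by rw [variance_fun_neg, h.var_snd]
  cov_eq := by rw [covariance_fun_neg_right, h.cov_eq]

lemma swap (h : IsStdPair P U V r) : IsStdPair P V U r where
  gaussian := h.gaussian.map_fun
    ((ContinuousLinearMap.snd ℝ ℝ ℝ).prod (ContinuousLinearMap.fst ℝ ℝ ℝ))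
  mean_fst := h.mean_snd
  mean_snd := h.mean_fst
  var_fst := h.var_snd
  var_snd := h.var_fst
  cov_eq := by rw [covariance_comm, h.cov_eq]

/-- A Gaussian law is determined by the means and variances of its linear forms, and for standard
pairs these depend on `r` alone. -/
lemma map_eq_map (h : IsStdPair P U V r) (h' : IsStdPair P' U' V' r) :
    P.map (fun ω => (U ω, V ω)) = P'.map (fun ω => (U' ω, V' ω)) := by
  have := h.gaussian.isProbabilityMeasure
  have := h'.gaussian.isProbabilityMeasure
  have := h.gaussian.isGaussian_map
  have := h'.gaussian.isGaussian_map
  apply Measure.ext_of_charFunDual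
  ext L
  rw [h.gaussian.charFunDual_map_eq_fun, h'.gaussian.charFunDual_map_eq_fun]
  obtain ⟨a, b, hL⟩ : ∃ a b : ℝ, ∀ x y : ℝ, L (x, y) = a * x + b * y := by
    refine ⟨L (1, 0), L (0, 1), fun x y => ?_⟩
    have : (x, y) = x • ((1 : ℝ), (0 : ℝ)) + y • ((0 : ℝ), (1 : ℝ)) := by simp
    rw [this, map_add, map_smul, map_smul]
    simp [mul_comm]
  simp only [hL]
  rw [h.variance_lin, h'.variance_lin]
  have e1 := h.integral_lin a b
  have e2 := h'.integral_lin a b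
  rw [e1, e2]

lemma canonical (hr : r ^ 2 ≤ 1) :
    IsStdPair ((gaussianReal 0 1).prod (gaussianReal 0 1))
      (fun p : ℝ × ℝ => r * p.1 + √(1 - r ^ 2) * p.2) (fun p => p.1) r := by
  set μ := (gaussianReal 0 1).prod (gaussianReal 0 1) with hμ
  have m1 : MemLp (fun p : ℝ × ℝ => p.1) 2 μ :=
    (memLp_id_gaussianReal (μ := 0) (v := 1) 2).comp_fst _
  have m2 : MemLp (fun p : ℝ × ℝ => p.2) 2 μ :=
    (memLp_id_gaussianReal (μ := 0) (v := 1) 2).comp_snd _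
  have v1 : Var[fun p : ℝ × ℝ => p.1; μ] = 1 := by
    have := (measurePreserving_fst (μ := gaussianReal 0 1) (ν := gaussianReal 0 1)).variance_fun_comp
      (f := fun x : ℝ => x) (by fun_prop)
    rw [this, variance_fun_id_gaussianReal]; simp
  have v2 : Var[fun p : ℝ × ℝ => p.2; μ] = 1 := by
    have := (measurePreserving_snd (μ := gaussianReal 0 1) (ν := gaussianReal 0 1)).variance_fun_comp
      (f := fun x : ℝ => x) (by fun_prop)
    rw [this, variance_fun_id_gaussianReal]; simp
  have e1 : ∫ p, p.1 ∂μ = 0 := by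
    rw [hμ, integral_fun_fst (fun x : ℝ => x)]; simp
  have e2 : ∫ p, p.2 ∂μ = 0 := by
    rw [hμ, integral_fun_snd (fun x : ℝ => x)]; simp
  have c12 : cov[fun p : ℝ × ℝ => p.1, fun p => p.2; μ] = 0 :=
    covariance_fst_snd_prod (memLp_id_gaussianReal (μ := 0) (v := 1) 2)
      (memLp_id_gaussianReal (μ := 0) (v := 1) 2)
  have hs : √(1 - r ^ 2) ^ 2 = 1 - r ^ 2 := Real.sq_sqrt (by linarith)
  refine ⟨?_, ?_, e1, ?_, v1, ?_⟩
  · have : HasGaussianLaw (id : ℝ × ℝ → ℝ × ℝ) μ := IsGaussian.hasGaussianLaw_id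
    exact this.map_fun ((r • ContinuousLinearMap.fst ℝ ℝ ℝ
      + √(1 - r ^ 2) • ContinuousLinearMap.snd ℝ ℝ ℝ).prod (ContinuousLinearMap.fst ℝ ℝ ℝ))
  · rw [integral_add ((m1.integrable (by simp)).const_mul _) ((m2.integrable (by simp)).const_mul _),
      integral_const_mul, integral_const_mul, e1, e2]
    simp
  · rw [variance_fun_add (m1.const_mul _) (m2.const_mul _), variance_const_mul, variance_const_mul,
      covariance_const_mul_left, covariance_const_mul_right, v1, v2, c12, hs]
    ring
  · have := covariance_add_left (m1.const_mul r) (m2.const_mul (√(1 - r ^ 2))) m1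
    change cov[(fun p : ℝ × ℝ => r * p.1) + (fun p : ℝ × ℝ => √(1 - r ^ 2) * p.2),
      fun p => p.1; μ] = r
    rw [this, covariance_const_mul_left, covariance_const_mul_left, covariance_self (by fun_prop),
      v1, covariance_comm, c12]
    ring

lemma map_eq_bivGaussian (h : IsStdPair P U V r) :
    P.map (fun ω => (U ω, V ω)) = bivGaussian r :=
  h.map_eq_map (canonical h.sq_le_one)

end IsStdPair

/-- The right side is the exponent of the joint density, marginal at `t` plus conditional at `x`. It
equals `(x² - 2rxt + t²) / (2(1 - r²))`, a quadratic form whose smallest eigenvalue is `1 / (2(1 +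
|r|))`. -/
lemma sq_form_lower_bound {r R x t : ℝ} (hr : |r| ≤ R) (hR : R < 1) :
    (x ^ 2 + t ^ 2) / (2 * (1 + R)) ≤ t ^ 2 / 2 + (x - r * t) ^ 2 / (2 * (1 - r ^ 2)) := by
  have hR0 : 0 ≤ R := (abs_nonneg r).trans hr
  have hr1 : |r| < 1 := hr.trans_lt hR
  have hr2 : 0 < 1 - r ^ 2 := by
    have := (sq_lt_one_iff_abs_lt_one r).2 hr1
    linarith
  have e : t ^ 2 / 2 + (x - r * t) ^ 2 / (2 * (1 - r ^ 2))
      = (x ^ 2 - 2 * r * x * t + t ^ 2) / (2 * (1 - r ^ 2)) := by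
    field_simp
    ring
  rw [e]
  have h1 : (x ^ 2 + t ^ 2) / (2 * (1 + R)) ≤ (x ^ 2 + t ^ 2) / (2 * (1 + |r|)) := by
    gcongr
  refine h1.trans ?_
  have h2 : 1 - r ^ 2 = (1 - |r|) * (1 + |r|) := by
    rw [← sq_abs r]; ring
  have h3 : (1 - |r|) * (x ^ 2 + t ^ 2) ≤ x ^ 2 - 2 * r * x * t + t ^ 2 := by
    have h4 : 2 * r * x * t ≤ |r| * (x ^ 2 + t ^ 2) := by
      calc 2 * r * x * t ≤ |2 * r * x * t| := le_abs_self _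
        _ = |r| * (2 * |x| * |t|) := by
          rw [abs_mul, abs_mul, abs_mul]; simp; ring
        _ ≤ |r| * (x ^ 2 + t ^ 2) := by
          gcongr
          nlinarith [sq_nonneg (|x| - |t|), sq_abs x, sq_abs t]
    linarith
  rw [h2, div_le_div_iff₀ (by positivity) (by have := abs_nonneg r; nlinarith)]
  have := abs_nonneg r
  nlinarith [mul_le_mul_of_nonneg_left h3 (by positivity : (0:ℝ) ≤ 2 * (1 + |r|))]

/-- The density of the bivariate Gaussian law is dominated by a product of Gaussian kernels. -/
lemma lintegral_bivGaussian_le {r R : ℝ} (hr : |r| ≤ R) (hR : R < 1) {k₁ k₂ : ℝ → ℝ≥0∞}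
    (h₁ : Measurable k₁) (h₂ : Measurable k₂) :
    ∫⁻ p, k₁ p.1 * k₂ p.2 ∂(bivGaussian r) ≤ ENNReal.ofReal (√(1 - R ^ 2))⁻¹ *
      ((∫⁻ x, k₁ x * ENNReal.ofReal (Real.exp (-(x ^ 2 / (2 * (1 + R)))))) *
       (∫⁻ x, k₂ x * ENNReal.ofReal (Real.exp (-(x ^ 2 / (2 * (1 + R))))))) := by
  have hR0 : 0 ≤ R := (abs_nonneg r).trans hr
  have hR2 : 0 < 1 - R ^ 2 := by nlinarith
  have hrR : 1 - R ^ 2 ≤ 1 - r ^ 2 := by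
    have := sq_le_sq' (by linarith [neg_abs_le r]) ((le_abs_self r).trans hr)
    linarith
  have hr2 : 0 < 1 - r ^ 2 := by linarith
  set s := √(1 - r ^ 2) with hs
  have hs2 : s ^ 2 = 1 - r ^ 2 := Real.sq_sqrt hr2.le
  have hs0 : 0 < s := Real.sqrt_pos.2 hr2
  set v : NNReal := NNReal.mk (s ^ 2) (sq_nonneg s) with hv
  have hv0 : v ≠ 0 := by
    intro h
    have : (v : ℝ) = 0 := by rw [h]; rfl
    simp only [hv, NNReal.coe_mk] at this
    nlinarith [pow_pos hs0 2]
  have hmap : ∀ t : ℝ, (gaussianReal 0 1).map (fun w => r * t + s * w) = gaussianReal (r * t) v := by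
    intro t
    have : (fun w : ℝ => r * t + s * w) = (fun w => r * t + w) ∘ (fun w => s * w) := rfl
    rw [this, ← Measure.map_map (by fun_prop) (by fun_prop), gaussianReal_map_const_mul,
      gaussianReal_map_const_add]
    simp [hv]
  -- The joint density factors into the marginal of the second coordinate and the conditional law
  -- `N(rt, 1 - r²)` of the first; the factors `√(2π)` are simply dropped.
  have hpt : ∀ t x : ℝ, gaussianPDF 0 1 t * gaussianPDF (r * t) v x ≤
      ENNReal.ofReal (√(1 - R ^ 2))⁻¹ * (ENNReal.ofReal (Real.exp (-(x ^ 2 / (2 * (1 + R))))) *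
        ENNReal.ofReal (Real.exp (-(t ^ 2 / (2 * (1 + R)))))) := by
    intro t x
    simp only [gaussianPDF]
    rw [← ENNReal.ofReal_mul (gaussianPDFReal_nonneg _ _ _),
      ← ENNReal.ofReal_mul (Real.exp_pos _).le, ← ENNReal.ofReal_mul (by positivity)]
    apply ENNReal.ofReal_le_ofReal
    rw [stdPDF_eq, gaussianPDFReal]
    have hvr : (v : ℝ) = 1 - r ^ 2 := by simp only [hv, NNReal.coe_mk, hs2]
    rw [hvr]
    have hpi : (1 : ℝ) ≤ √(2 * Real.pi) := by
      rw [Real.one_le_sqrt]; nlinarith [Real.pi_gt_three]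
    have c1 : (√(2 * Real.pi))⁻¹ ≤ 1 := inv_le_one_of_one_le₀ hpi
    have c2 : (√(2 * Real.pi * (1 - r ^ 2)))⁻¹ ≤ (√(1 - R ^ 2))⁻¹ := by
      gcongr
      nlinarith [Real.pi_gt_three]
    calc (√(2 * Real.pi))⁻¹ * Real.exp (-t ^ 2 / 2) * ((√(2 * Real.pi * (1 - r ^ 2)))⁻¹ *
          Real.exp (-(x - r * t) ^ 2 / (2 * (1 - r ^ 2))))
        = (√(2 * Real.pi))⁻¹ * (√(2 * Real.pi * (1 - r ^ 2)))⁻¹ *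
          Real.exp (-(t ^ 2 / 2 + (x - r * t) ^ 2 / (2 * (1 - r ^ 2)))) := by
          rw [neg_add, Real.exp_add]; ring_nf
      _ ≤ 1 * (√(1 - R ^ 2))⁻¹ * Real.exp (-((x ^ 2 + t ^ 2) / (2 * (1 + R)))) := by
          gcongr
          exact sq_form_lower_bound hr hR
      _ = _ := by
          rw [← Real.exp_add, one_mul]
          congr 2
          ring
  rw [bivGaussian, lintegral_map (by fun_prop) (by fun_prop), lintegral_prod _ (by fun_prop)]
  have inner : ∀ t : ℝ, ∫⁻ w, k₁ (r * t + s * w) * k₂ t ∂(gaussianReal 0 1)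
      = ∫⁻ x, gaussianPDF (r * t) v x * (k₁ x * k₂ t) := by
    intro t
    rw [← lintegral_map (f := fun x => k₁ x * k₂ t) (g := fun w => r * t + s * w)
      (by fun_prop) (by fun_prop), hmap t, gaussianReal_of_var_ne_zero _ hv0,
      lintegral_withDensity_eq_lintegral_mul _ (measurable_gaussianPDF _ _) (by fun_prop)]
    rfl
  simp only [← hs, inner]
  have hm : Measurable (Function.uncurry fun (t x : ℝ) =>
      gaussianPDF (r * t) v x * (k₁ x * k₂ t)) := by
    have : Measurable (fun p : ℝ × ℝ => gaussianPDF (r * p.1) v p.2) := by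
      have h := measurable_uncurry_gaussianPDF
      exact h.comp (f := fun p : ℝ × ℝ => (r * p.1, v, p.2)) (by fun_prop)
    exact this.mul ((h₁.comp measurable_snd).mul (h₂.comp measurable_fst))
  rw [gaussianReal_of_var_ne_zero 0 one_ne_zero,
    lintegral_withDensity_eq_lintegral_mul _ (measurable_gaussianPDF _ _) hm.lintegral_prod_right]
  calc ∫⁻ t, gaussianPDF 0 1 t * ∫⁻ x, gaussianPDF (r * t) v x * (k₁ x * k₂ t)
      ≤ ∫⁻ t, ∫⁻ x, ENNReal.ofReal (√(1 - R ^ 2))⁻¹ *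
          ((k₁ x * ENNReal.ofReal (Real.exp (-(x ^ 2 / (2 * (1 + R)))))) *
          (k₂ t * ENNReal.ofReal (Real.exp (-(t ^ 2 / (2 * (1 + R))))))) := by
        refine lintegral_mono fun t => ?_
        dsimp only
        rw [← lintegral_const_mul _ (by fun_prop)]
        refine lintegral_mono fun x => ?_
        calc gaussianPDF 0 1 t * (gaussianPDF (r * t) v x * (k₁ x * k₂ t))
            = (gaussianPDF 0 1 t * gaussianPDF (r * t) v x) * (k₁ x * k₂ t) := by ring
          _ ≤ _ := mul_le_mul_left (hpt t x) _
          _ = _ := by ring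
    _ = _ := by
        have hk₁ : Measurable fun x : ℝ =>
            k₁ x * ENNReal.ofReal (Real.exp (-(x ^ 2 / (2 * (1 + R))))) := by fun_prop
        have hk₂ : Measurable fun x : ℝ =>
            k₂ x * ENNReal.ofReal (Real.exp (-(x ^ 2 / (2 * (1 + R))))) := by fun_prop
        have e : ∀ t : ℝ, ∫⁻ x, ENNReal.ofReal (√(1 - R ^ 2))⁻¹ *
            ((k₁ x * ENNReal.ofReal (Real.exp (-(x ^ 2 / (2 * (1 + R)))))) *
            (k₂ t * ENNReal.ofReal (Real.exp (-(t ^ 2 / (2 * (1 + R))))))) =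
            ENNReal.ofReal (√(1 - R ^ 2))⁻¹ *
            ((∫⁻ x, k₁ x * ENNReal.ofReal (Real.exp (-(x ^ 2 / (2 * (1 + R)))))) *
            (k₂ t * ENNReal.ofReal (Real.exp (-(t ^ 2 / (2 * (1 + R))))))) := fun t => by
          rw [lintegral_const_mul _ (hk₁.mul_const _), lintegral_mul_const _ hk₁]
        simp_rw [e]
        rw [lintegral_const_mul _ (hk₂.const_mul _), lintegral_const_mul _ hk₂]

/-! ### Gaussian integration by parts -/

/-- Gaussian integration by parts for a product of functions of the single coordinates. -/
lemma integral_mul_prod_gaussian {T Ω : Type*} [Fintype T] [DecidableEq T] [MeasurableSpace Ω]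
    {P : Measure Ω} {W : Ω → ℝ} {Z : T → Ω → ℝ}
    (h : HasGaussianLaw (fun ω => (W ω, fun t => Z t ω)) P)
    (hW0 : ∫ ω, W ω ∂P = 0) (hW1 : Var[W; P] = 1) {g g' : T → ℝ → ℝ}
    (hg : ∀ t x, HasDerivAt (g t) (g' t x) x) (hg' : ∀ t, Continuous (g' t)) {C : ℝ}
    (hC : ∀ t x, |g t x| ≤ C) (hC' : ∀ t x, |g' t x| ≤ C) :
    ∫ ω, W ω * ∏ t, g t (Z t ω) ∂P =
      ∑ s, cov[W, Z s; P] * ∫ ω, (∏ t ∈ Finset.univ.erase s, g t (Z t ω)) * g' s (Z s ω) ∂P := by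
  have hP := h.isProbabilityMeasure
  have hZ : ∀ t, HasGaussianLaw (Z t) P := fun t => h.snd.eval t
  set c : T → ℝ := fun s => cov[W, Z s; P] with hc
  -- These residuals are uncorrelated with `W`, hence independent of it as a vector. With the
  -- residuals frozen, the claim is the one-dimensional integration by parts in `W`.
  set R : T → Ω → ℝ := fun s ω => Z s ω - c s * W ω with hR
  have hgc : ∀ t, Continuous (g t) := fun t =>
    continuous_iff_continuousAt.2 fun x => (hg t x).continuousAt
  have hWm : AEMeasurable W P := h.fst.aemeasurable
  have hWR : HasGaussianLaw (fun ω => (fun _ : Unit => W ω, fun s => R s ω)) P :=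
    h.map_fun ((ContinuousLinearMap.pi fun _ : Unit => ContinuousLinearMap.fst ℝ ℝ (T → ℝ)).prod
      (ContinuousLinearMap.pi fun s => (ContinuousLinearMap.proj (R := ℝ) s).comp
        (ContinuousLinearMap.snd ℝ ℝ (T → ℝ)) - c s • ContinuousLinearMap.fst ℝ ℝ (T → ℝ)))
  have hRm : AEMeasurable (fun ω s => R s ω) P := hWR.snd.aemeasurable
  have hind : IndepFun W (fun ω s => R s ω) P := by
    have h0 := HasGaussianLaw.indepFun_of_covariance_eval (X := fun _ : Unit => W) (Y := R) hWR
      (fun _ s => by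
        have := covariance_fun_sub_right (X := W) (Y := Z s) (Z := fun ω => c s * W ω)
          h.fst.memLp_two (hZ s).memLp_two (h.fst.memLp_two.const_mul _)
        rw [hR, this, covariance_const_mul_right, covariance_self hWm, hW1, mul_one]
        exact sub_self _)
    exact h0.comp (φ := fun x : Unit → ℝ => x ()) (ψ := id) (by fun_prop) measurable_id
  have hWlaw : P.map W = gaussianReal 0 1 := by
    rw [h.fst.map_eq_gaussianReal, hW0, hW1]; simp
  set ν := P.map (fun ω s => R s ω) with hν
  have hνp : IsProbabilityMeasure ν := Measure.isProbabilityMeasure_map hRm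
  have hmap : P.map (fun ω => (W ω, fun s => R s ω)) = (gaussianReal 0 1).prod ν := by
    rw [(indepFun_iff_map_prod_eq_prod_map_map hWm hRm).1 hind, hWlaw]
  have hpair : AEMeasurable (fun ω => (W ω, fun s => R s ω)) P := hWm.prodMk hRm
  have transfer : ∀ Ψ : ℝ × (T → ℝ) → ℝ, Measurable Ψ →
      ∫ ω, Ψ (W ω, fun s => R s ω) ∂P = ∫ p, Ψ p ∂((gaussianReal 0 1).prod ν) := fun Ψ hΨ => by
    rw [← hmap, integral_map hpair hΨ.aestronglyMeasurable]
  have hZe : ∀ t ω, Z t ω = R t ω + c t * W ω := fun t ω => by simp [hR]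
  have hC0 : ∀ t : T, 0 ≤ C := fun t => (abs_nonneg _).trans (hC t 0)
  set G : ℝ × (T → ℝ) → ℝ := fun p => ∏ t, g t (p.2 t + c t * p.1) with hG
  set K : T → ℝ × (T → ℝ) → ℝ := fun s p =>
    (∏ t ∈ Finset.univ.erase s, g t (p.2 t + c t * p.1)) * g' s (p.2 s + c s * p.1) with hK
  have hGcont : Continuous G := by
    refine continuous_finsetProd _ fun t _ => (hgc t).comp (by fun_prop)
  have hKcont : ∀ s, Continuous (K s) := fun s =>
    (continuous_finsetProd _ fun t _ => (hgc t).comp (by fun_prop)).mul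
      ((hg' s).comp (by fun_prop))
  have hGb : ∀ p, |G p| ≤ C ^ Fintype.card T := fun p => by
    rw [hG, Finset.abs_prod]
    calc ∏ t, |g t (p.2 t + c t * p.1)| ≤ ∏ _t : T, C :=
          Finset.prod_le_prod (fun _ _ => abs_nonneg _) fun t _ => hC t _
      _ = _ := by simp
  have hKb : ∀ s p, |K s p| ≤ C ^ (Fintype.card T - 1) * C := fun s p => by
    rw [hK, abs_mul, Finset.abs_prod]
    have : ∏ t ∈ Finset.univ.erase s, |g t (p.2 t + c t * p.1)| ≤ C ^ (Fintype.card T - 1) := by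
      calc ∏ t ∈ Finset.univ.erase s, |g t (p.2 t + c t * p.1)|
          ≤ ∏ _t ∈ Finset.univ.erase s, C :=
            Finset.prod_le_prod (fun _ _ => abs_nonneg _) fun t _ => hC t _
        _ = _ := by simp
    exact mul_le_mul this (hC' s _) (abs_nonneg _) (pow_nonneg (hC0 s) _)
  have hKi : ∀ s, Integrable (K s) ((gaussianReal 0 1).prod ν) := fun s =>
    Integrable.of_bound (hKcont s).aestronglyMeasurable _ (Eventually.of_forall (hKb s))
  have hidi : Integrable (fun p : ℝ × (T → ℝ) => p.1) ((gaussianReal 0 1).prod ν) :=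
    ((memLp_id_gaussianReal (μ := 0) (v := 1) 1).integrable (by simp)).comp_fst ν
  have hGi : Integrable (fun p : ℝ × (T → ℝ) => p.1 * G p) ((gaussianReal 0 1).prod ν) :=
    hidi.mul_bdd hGcont.aestronglyMeasurable (Eventually.of_forall hGb)
  have lhs : ∫ ω, W ω * ∏ t, g t (Z t ω) ∂P
      = ∫ p, p.1 * G p ∂((gaussianReal 0 1).prod ν) := by
    rw [← transfer (fun p => p.1 * G p) (measurable_fst.mul hGcont.measurable)]
    simp only [hG, hZe]
  have rhs : ∀ s, ∫ ω, (∏ t ∈ Finset.univ.erase s, g t (Z t ω)) * g' s (Z s ω) ∂P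
      = ∫ p, K s p ∂((gaussianReal 0 1).prod ν) := fun s => by
    rw [← transfer _ (hKcont s).measurable]
    simp only [hK, hZe]
  rw [lhs]
  simp_rw [rhs, ← integral_const_mul]
  rw [← integral_finsetSum _ fun s _ => (hKi s).const_mul _, integral_prod_symm _ hGi,
    integral_prod_symm _ (integrable_finsetSum _ fun s _ => (hKi s).const_mul _)]
  refine integral_congr_ae (Eventually.of_forall fun y => ?_)
  have hder : ∀ x, HasDerivAt (fun x => G (x, y)) (∑ s, c s * K s (x, y)) x := fun x => by
    have := HasDerivAt.fun_finsetProd (u := Finset.univ)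
      (f := fun t x => g t (y t + c t * x)) (f' := fun t => g' t (y t + c t * x) * c t) (x := x)
      (fun t _ => by
        have h1 : HasDerivAt (fun x => y t + c t * x) (c t) x := by
          simpa using ((hasDerivAt_id x).const_mul (c t)).const_add (y t)
        exact (hg t _).comp x h1)
    refine this.congr_deriv ?_
    refine Finset.sum_congr rfl fun s _ => ?_
    simp only [hK, smul_eq_mul]
    ring
  refine integral_id_mul_stdGaussian (C := max (C ^ Fintype.card T)
    (∑ s, |c s| * (C ^ (Fintype.card T - 1) * C))) hder ?_ ?_ ?_
  · exact continuous_finsetSum _ fun s _ => ((hKcont s).comp (by fun_prop)).const_mul _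
  · exact fun x => (hGb _).trans (le_max_left _ _)
  · intro x
    refine le_trans (Finset.abs_sum_le_sum_abs _ _) (le_trans (Finset.sum_le_sum fun s _ => ?_)
      (le_max_right _ _))
    rw [abs_mul]
    exact mul_le_mul_of_nonneg_left (hKb s _) (abs_nonneg _)

/-! ### Interpolation between a Gaussian vector and its decoupled version -/

section Interpolation

/-- The interpolation between the vector itself and the vector whose groups are decoupled. -/
def interp {T ι : Type*} (g : T → ι) (a b : ℝ) (t : T) (ω : Option ι → T → ℝ) : ℝ :=
  a * ω none t + b * ω (some (g t)) t

lemma measurable_interp {T ι : Type*} (g : T → ι) (a b : ℝ) (t : T) : Measurable (interp g a b t) := by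
  unfold interp
  fun_prop

lemma integral_copies {T ι : Type*} [Fintype ι] {μ : Measure (T → ℝ)}
    [IsProbabilityMeasure μ] (o : Option ι) (t : T) :
    ∫ ω, ω o t ∂(Measure.pi fun _ : Option ι => μ) = ∫ x, x t ∂μ :=
  integral_comp_eval (μ := fun _ : Option ι => μ) (i := o) (f := fun x : T → ℝ => x t)
    (measurable_pi_apply t).aestronglyMeasurable

variable {T ι : Type*} [Fintype T] [Fintype ι] (μ : Measure (T → ℝ)) (g : T → ι)

/-- The law of independent copies of a Gaussian vector: one reference copy and one for each
group of coordinates. -/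
abbrev copies (ι : Type*) [Fintype ι] : Measure (Option ι → T → ℝ) :=
  Measure.pi fun _ : Option ι => μ

variable {μ}

lemma isGaussian_copies [IsGaussian μ] : IsGaussian (copies μ ι) := by
  have h : HasGaussianLaw (fun ω : Option ι → T → ℝ => fun o => ω o) (copies μ ι) := by
    refine iIndepFun.hasGaussianLaw (X := fun o (ω : Option ι → T → ℝ) => ω o) (fun o => ?_) ?_
    · have hm := (measurePreserving_eval (fun _ : Option ι => μ) o).map_eq
      refine ⟨?_⟩
      change IsGaussian ((Measure.pi fun _ : Option ι => μ).map (Function.eval o))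
      rw [hm]
      infer_instance
    · exact iIndepFun_pi (X := fun _ (x : T → ℝ) => x) fun _ => aemeasurable_id
  have := h.isGaussian_map
  simpa using this

lemma memLp_copies [IsGaussian μ] (o : Option ι) (t : T) :
    MemLp (fun ω : Option ι → T → ℝ => ω o t) 2 (copies μ ι) := by
  have := isGaussian_copies (μ := μ) (ι := ι)
  have h : HasGaussianLaw (id : (Option ι → T → ℝ) → _) (copies μ ι) :=
    IsGaussian.hasGaussianLaw_id
  exact (h.map_fun ((ContinuousLinearMap.proj (R := ℝ) t).comp
    (ContinuousLinearMap.proj (R := ℝ) (φ := fun _ : Option ι => T → ℝ) o))).memLp_two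

lemma covariance_copies [IsGaussian μ] [DecidableEq ι] (o o' : Option ι) (s t : T) :
    cov[fun ω => ω o s, fun ω => ω o' t; copies μ ι] =
      if o = o' then cov[fun x => x s, fun x => x t; μ] else 0 := by
  split_ifs with h
  · subst h
    have hm := (measurePreserving_eval (fun _ : Option ι => μ) o).map_eq
    have := covariance_map_fun (μ := copies μ ι) (Z := Function.eval o)
      (X := fun x : T → ℝ => x s) (Y := fun x : T → ℝ => x t) (measurable_pi_apply s).aestronglyMeasurable
      (measurable_pi_apply t).aestronglyMeasurable (measurable_pi_apply o).aemeasurable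
    rw [hm] at this
    exact this.symm
  · have hi := (iIndepFun_pi (μ := fun _ : Option ι => μ) (X := fun _ (x : T → ℝ) => x)
      fun _ => aemeasurable_id).indepFun h
    exact (hi.comp (φ := fun x : T → ℝ => x s) (ψ := fun x : T → ℝ => x t) (by fun_prop)
      (by fun_prop)).covariance_eq_zero (memLp_copies o s) (memLp_copies o' t)

lemma integral_interp [IsGaussian μ] (h0 : ∀ t, ∫ x, x t ∂μ = 0) (a b : ℝ) (t : T) :
    ∫ ω, interp g a b t ω ∂(copies μ ι) = 0 := by
  have hi : ∀ o : Option ι, Integrable (fun ω : Option ι → T → ℝ => ω o t) (copies μ ι) :=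
    fun o => (memLp_copies o t).integrable (by simp)
  simp only [interp]
  rw [integral_add ((hi _).const_mul _) ((hi _).const_mul _), integral_const_mul,
    integral_const_mul, integral_copies, integral_copies, h0]
  simp

/-- Two coordinates always share the reference copy, and share a group copy exactly when they lie in
the same group. For coefficients `(cos θ, sin θ)` this keeps covariances inside groups fixed and
multiplies the others by `cos² θ`; paired with the derivative coefficients `(-sin θ, cos θ)`, the
factor inside a group is zero. -/
lemma covariance_interp [IsGaussian μ] [DecidableEq ι] (a b a' b' : ℝ) (s t : T) :
    cov[interp g a b s, interp g a' b' t; copies μ ι] =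
      (a * a' + if g s = g t then b * b' else 0) * cov[fun x => x s, fun x => x t; μ] := by
  have e : ∀ a b t, interp g a b t = (fun ω => a * ω none t) + fun ω => b * ω (some (g t)) t :=
    fun _ _ _ => rfl
  have hm := fun (o : Option ι) (t : T) (a : ℝ) => (memLp_copies (μ := μ) o t).const_mul a
  rw [e a b s, e a' b' t, covariance_add_left (hm _ _ _) (hm _ _ _) ((hm _ _ _).add (hm _ _ _)),
    covariance_add_right (hm _ _ _) (hm _ _ _) (hm _ _ _),
    covariance_add_right (hm _ _ _) (hm _ _ _) (hm _ _ _)]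
  simp only [covariance_const_mul_left, covariance_const_mul_right, covariance_copies,
    Option.some_inj, reduceCtorEq, if_false, if_true]
  split_ifs <;> ring

lemma hasGaussianLaw_interp [IsGaussian μ] (a b a' b' : ℝ) (s : T) :
    HasGaussianLaw (fun ω => (interp g a b s ω, fun t => interp g a' b' t ω)) (copies μ ι) := by
  have := isGaussian_copies (μ := μ) (ι := ι)
  have h : HasGaussianLaw (id : (Option ι → T → ℝ) → _) (copies μ ι) :=
    IsGaussian.hasGaussianLaw_id
  let E : Option ι → T → ((Option ι → T → ℝ) →L[ℝ] ℝ) := fun o t =>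
    (ContinuousLinearMap.proj (R := ℝ) t).comp
      (ContinuousLinearMap.proj (R := ℝ) (φ := fun _ : Option ι => T → ℝ) o)
  exact h.map_fun ((a • E none s + b • E (some (g s)) s).prod
    (ContinuousLinearMap.pi fun t => a' • E none t + b' • E (some (g t)) t))

lemma isStdPair_interp [IsGaussian μ] [DecidableEq ι] (h0 : ∀ t, ∫ x, x t ∂μ = 0)
    (h1 : ∀ t, Var[fun x => x t; μ] = 1) {a b : ℝ} (hab : a ^ 2 + b ^ 2 = 1) (s t : T) :
    IsStdPair (copies μ ι) (interp g a b s) (interp g a b t)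
      ((a * a + if g s = g t then b * b else 0) * cov[fun x => x s, fun x => x t; μ]) := by
  have hv : ∀ t, Var[interp g a b t; copies μ ι] = 1 := fun t => by
    rw [← covariance_self (measurable_interp g a b t).aemeasurable, covariance_interp,
      covariance_self (measurable_pi_apply t).aemeasurable, h1, if_pos rfl]
    linarith
  refine ⟨?_, integral_interp g h0 _ _ _, integral_interp g h0 _ _ _, hv s, hv t,
    covariance_interp g a b a b s t⟩
  exact (hasGaussianLaw_interp g a b a b s).map_fun ((ContinuousLinearMap.fst ℝ ℝ (T → ℝ)).prod
    ((ContinuousLinearMap.proj (R := ℝ) t).comp (ContinuousLinearMap.snd ℝ ℝ (T → ℝ))))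

/-- The derivative of the expected product along the rotation from a Gaussian vector to its
decoupled version. -/
lemma hasDerivAt_integral_interp [IsGaussian μ] [DecidableEq T] {f f' : T → ℝ → ℝ}
    (hf : ∀ t x, HasDerivAt (f t) (f' t x) x) (hf' : ∀ t, Continuous (f' t))
    (hf1 : ∀ t x, |f t x| ≤ 1) {C : ℝ} (hC' : ∀ t x, |f' t x| ≤ C) (θ : ℝ) :
    HasDerivAt (fun θ => ∫ ω, ∏ t, f t (interp g (Real.cos θ) (Real.sin θ) t ω) ∂(copies μ ι))
      (∑ s, ∫ ω, interp g (-Real.sin θ) (Real.cos θ) s ω *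
        ∏ t, Function.update f s (f' s) t (interp g (Real.cos θ) (Real.sin θ) t ω)
          ∂(copies μ ι)) θ := by
  have := isGaussian_copies (μ := μ) (ι := ι)
  have hfc : ∀ t, Continuous (f t) := fun t =>
    continuous_iff_continuousAt.2 fun x => (hf t x).continuousAt
  have hZm : ∀ a b t, Measurable (interp g a b t) := measurable_interp g
  set D : ℝ → T → (Option ι → T → ℝ) → ℝ := fun θ => interp g (-Real.sin θ) (Real.cos θ) with hD
  set Z : ℝ → T → (Option ι → T → ℝ) → ℝ := fun θ => interp g (Real.cos θ) (Real.sin θ) with hZ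
  have hDb : ∀ θ s ω, |D θ s ω| ≤ |ω none s| + |ω (some (g s)) s| := fun θ s ω => by
    simp only [hD, interp]
    refine (abs_add_le _ _).trans ?_
    rw [abs_mul, abs_mul, abs_neg]
    exact add_le_add (mul_le_of_le_one_left (abs_nonneg _) (Real.abs_sin_le_one _))
      (mul_le_of_le_one_left (abs_nonneg _) (Real.abs_cos_le_one _))
  have hprod : ∀ θ s ω, |∏ t ∈ Finset.univ.erase s, f t (Z θ t ω)| ≤ 1 := fun θ s ω => by
    rw [Finset.abs_prod]
    exact Finset.prod_le_one (fun _ _ => abs_nonneg _) fun t _ => hf1 t _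
  -- Keeping the differentiated product as a product with one updated factor gives it the shape to
  -- which `integral_mul_prod_gaussian` applies.
  have hupd : ∀ θ s ω, ∏ t, Function.update f s (f' s) t (Z θ t ω)
      = (∏ t ∈ Finset.univ.erase s, f t (Z θ t ω)) * f' s (Z θ s ω) := fun θ s ω => by
    rw [← Finset.mul_prod_erase Finset.univ _ (Finset.mem_univ s), Function.update_self, mul_comm]
    congr 1
    refine Finset.prod_congr rfl fun t ht => ?_
    rw [Function.update_of_ne (Finset.ne_of_mem_erase ht)]
  have hpm : ∀ θ s, Measurable fun ω => ∏ t, Function.update f s (f' s) t (Z θ t ω) :=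
    fun θ s => by
      simp_rw [hupd]
      exact (Finset.measurable_fun_prod _ fun t _ => (hfc t).measurable.comp (hZm _ _ t)).mul
        ((hf' s).measurable.comp (hZm _ _ s))
  have hbd : ∀ θ s ω, |D θ s ω * ∏ t, Function.update f s (f' s) t (Z θ t ω)|
      ≤ (|ω none s| + |ω (some (g s)) s|) * C := fun θ s ω => by
    rw [hupd, abs_mul, abs_mul]
    have hC0 : 0 ≤ C := (abs_nonneg _).trans (hC' s 0)
    refine mul_le_mul (hDb θ s ω) ?_ (by positivity) (by positivity)
    calc _ ≤ 1 * C := mul_le_mul (hprod θ s ω) (hC' _ _) (abs_nonneg _) zero_le_one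
      _ = C := one_mul C
  have hco : ∀ (o : Option ι) s, Integrable (fun ω : Option ι → T → ℝ => |ω o s|) (copies μ ι) :=
    fun o s => ((memLp_copies o s).integrable (by simp)).abs
  have hbi : ∀ s, Integrable (fun ω : Option ι → T → ℝ => (|ω none s| + |ω (some (g s)) s|) * C)
      (copies μ ι) := fun s => ((hco _ _).add (hco _ _)).mul_const C
  have hint : ∀ θ s, Integrable (fun ω => D θ s ω * ∏ t, Function.update f s (f' s) t (Z θ t ω))
      (copies μ ι) := fun θ s =>
    (hbi s).mono' ((hZm _ _ s).mul (hpm θ s)).aestronglyMeasurable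
      (Eventually.of_forall (hbd θ s))
  have hFm : ∀ θ, Measurable fun ω => ∏ t, f t (Z θ t ω) := fun θ =>
    Finset.measurable_fun_prod _ fun t _ => (hfc t).measurable.comp (hZm _ _ t)
  have key := (hasDerivAt_integral_of_dominated_loc_of_deriv_le (μ := copies μ ι) (𝕜 := ℝ)
    (F := fun θ ω => ∏ t, f t (Z θ t ω)) (x₀ := θ) (s := Set.univ)
    (F' := fun θ ω => ∑ s, D θ s ω * ∏ t, Function.update f s (f' s) t (Z θ t ω))
    (bound := fun ω => ∑ s, (|ω none s| + |ω (some (g s)) s|) * C)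
    Filter.univ_mem (Eventually.of_forall fun θ => (hFm θ).aestronglyMeasurable)
    (Integrable.of_bound (hFm θ).aestronglyMeasurable 1 (Eventually.of_forall fun ω => by
      rw [Real.norm_eq_abs, Finset.abs_prod]
      exact Finset.prod_le_one (fun _ _ => abs_nonneg _) fun t _ => hf1 t _))
    (integrable_finsetSum _ fun s _ => hint θ s).aestronglyMeasurable
    (Eventually.of_forall fun ω θ _ => by
      rw [Real.norm_eq_abs]
      exact (Finset.abs_sum_le_sum_abs _ _).trans (Finset.sum_le_sum fun s _ => hbd θ s ω))
    (integrable_finsetSum _ fun s _ => hbi s)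
    (Eventually.of_forall fun ω θ _ => by
      have := HasDerivAt.fun_finsetProd (u := Finset.univ)
        (f := fun t θ => f t (Z θ t ω)) (f' := fun t => f' t (Z θ t ω) * D θ t ω) (x := θ)
        (fun t _ => by
          have h1 : HasDerivAt (fun θ => Z θ t ω) (D θ t ω) θ :=
            ((Real.hasDerivAt_cos θ).mul_const _).add ((Real.hasDerivAt_sin θ).mul_const _)
          exact (hf t _).comp θ h1)
      refine this.congr_deriv (Finset.sum_congr rfl fun s _ => ?_)
      rw [hupd, smul_eq_mul]
      ring)).2
  rwa [integral_finsetSum _ fun s _ => hint θ s] at key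

/-- The comparison of a Gaussian vector with its decoupled version, for smooth functions. -/
lemma abs_integral_interp_sub_le [IsGaussian μ] [DecidableEq T] [DecidableEq ι]
    (h0 : ∀ t, ∫ x, x t ∂μ = 0) (h1 : ∀ t, Var[fun x => x t; μ] = 1)
    {r : T → T → ℝ} (hr : ∀ s t, cov[fun x => x s, fun x => x t; μ] = r s t)
    (hr1 : ∀ s t, g s ≠ g t → |r s t| < 1)
    {f f' f'' : T → ℝ → ℝ}
    (hf : ∀ t x, HasDerivAt (f t) (f' t x) x) (hf' : ∀ t x, HasDerivAt (f' t) (f'' t x) x)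
    (hf'' : ∀ t, Continuous (f'' t)) (hf1 : ∀ t x, |f t x| ≤ 1) {C : ℝ}
    (hC' : ∀ t x, |f' t x| ≤ C) (hC'' : ∀ t x, |f'' t x| ≤ C) {c : T → T → ℝ}
    (hc0 : ∀ s t, 0 ≤ c s t)
    (hc : ∀ s t, ∫⁻ x, ENNReal.ofReal |f' s x| *
      ENNReal.ofReal (Real.exp (-(x ^ 2 / (2 * (1 + |r s t|))))) ≤ ENNReal.ofReal (c s t)) :
    |(∫ ω, ∏ t, f t (ω none t) ∂(copies μ ι)) -
        ∫ ω, ∏ t, f t (ω (some (g t)) t) ∂(copies μ ι)| ≤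
      ∑ s, ∑ t, (if g s = g t then 0 else |r s t| * ((√(1 - r s t ^ 2))⁻¹ * (c s t * c t s)))
        * (Real.pi / 2) := by
  have := isGaussian_copies (μ := μ) (ι := ι)
  have hsymm : ∀ s t, r s t = r t s := fun s t => by rw [← hr, ← hr, covariance_comm]
  have hf'c : ∀ t, Continuous (f' t) := fun t =>
    continuous_iff_continuousAt.2 fun x => (hf' t x).continuousAt
  have hfc : ∀ t, Continuous (f t) := fun t =>
    continuous_iff_continuousAt.2 fun x => (hf t x).continuousAt
  set Z : ℝ → T → (Option ι → T → ℝ) → ℝ := fun θ => interp g (Real.cos θ) (Real.sin θ) with hZ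
  have hZm : ∀ θ t, Measurable (Z θ t) := fun θ t => measurable_interp g _ _ t
  -- The correlation at angle `θ` is `cos² θ · r s t`, so bounding the density with `|r s t|` gives
  -- an estimate uniform in `θ`.
  have pair : ∀ θ s t, g s ≠ g t → ∫ ω, |f' s (Z θ s ω)| * |f' t (Z θ t ω)| ∂(copies μ ι) ≤
      (√(1 - r s t ^ 2))⁻¹ * (c s t * c t s) := by
    intro θ s t hst
    have hp := isStdPair_interp g h0 h1 (Real.cos_sq_add_sin_sq θ) s t
    rw [if_neg hst, hr, add_zero] at hp
    have hle : |Real.cos θ * Real.cos θ * r s t| ≤ |r s t| := by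
      rw [abs_mul]
      refine mul_le_of_le_one_left (abs_nonneg _) ?_
      rw [abs_mul]
      exact mul_le_one₀ (Real.abs_cos_le_one _) (abs_nonneg _) (Real.abs_cos_le_one _)
    have hb := lintegral_bivGaussian_le hle (hr1 s t hst)
      (k₁ := fun x => ENNReal.ofReal |f' s x|) (k₂ := fun x => ENNReal.ofReal |f' t x|)
      ((hf'c s).abs.measurable.ennreal_ofReal) ((hf'c t).abs.measurable.ennreal_ofReal)
    rw [← hp.map_eq_bivGaussian, lintegral_map' (by
      exact (((hf'c s).abs.measurable.ennreal_ofReal.comp measurable_fst).mul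
        ((hf'c t).abs.measurable.ennreal_ofReal.comp measurable_snd)).aemeasurable)
      hp.gaussian.aemeasurable] at hb
    have hmeas : Measurable fun ω => |f' s (Z θ s ω)| * |f' t (Z θ t ω)| :=
      ((hf'c s).abs.measurable.comp (hZm θ s)).mul ((hf'c t).abs.measurable.comp (hZm θ t))
    rw [integral_eq_lintegral_of_nonneg_ae (Eventually.of_forall fun ω =>
      mul_nonneg (abs_nonneg _) (abs_nonneg _)) hmeas.aestronglyMeasurable]
    refine ENNReal.toReal_le_of_le_ofReal
      (mul_nonneg (by positivity) (mul_nonneg (hc0 _ _) (hc0 _ _))) ?_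
    rw [ENNReal.ofReal_mul (by positivity), ENNReal.ofReal_mul (hc0 _ _)]
    simp_rw [ENNReal.ofReal_mul (abs_nonneg _)]
    refine hb.trans ?_
    rw [sq_abs]
    refine mul_le_mul_right (mul_le_mul' (hc s t) ?_) _
    have := hc t s
    rwa [hsymm t s] at this
  have hdb : ∀ θ, |∑ s, ∫ ω, interp g (-Real.sin θ) (Real.cos θ) s ω *
        ∏ t, Function.update f s (f' s) t (Z θ t ω) ∂(copies μ ι)| ≤
      ∑ s, ∑ t, (if g s = g t then 0 else |r s t| * ((√(1 - r s t ^ 2))⁻¹ * (c s t * c t s))) := by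
    intro θ
    refine (Finset.abs_sum_le_sum_abs _ _).trans (Finset.sum_le_sum fun s _ => ?_)
    have hD1 : Var[interp g (-Real.sin θ) (Real.cos θ) s; copies μ ι] = 1 :=
      (isStdPair_interp g h0 h1 (by nlinarith [Real.cos_sq_add_sin_sq θ]) s s).var_fst
    have hD0 : ∫ ω, interp g (-Real.sin θ) (Real.cos θ) s ω ∂(copies μ ι) = 0 :=
      integral_interp g h0 _ _ s
    rw [integral_mul_prod_gaussian (hasGaussianLaw_interp g _ _ _ _ s) hD0 hD1
      (g := Function.update f s (f' s)) (g' := Function.update f' s (f'' s)) (C := max 1 C)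
      (fun t x => by
        by_cases h : t = s
        · subst h; simpa using hf' t x
        · simpa [Function.update_of_ne h] using hf t x)
      (fun t => by
        by_cases h : t = s
        · subst h; simpa using hf'' t
        · simpa [Function.update_of_ne h] using hf'c t)
      (fun t x => by
        by_cases h : t = s
        · subst h; simpa using Or.inr (hC' t x)
        · simpa [Function.update_of_ne h] using Or.inl (hf1 t x))
      (fun t x => by
        by_cases h : t = s
        · subst h; simpa using Or.inr (hC'' t x)
        · simpa [Function.update_of_ne h] using Or.inr (hC' t x))]
    refine (Finset.abs_sum_le_sum_abs _ _).trans (Finset.sum_le_sum fun t _ => ?_)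
    rw [covariance_interp, hr]
    split_ifs with hst
    -- Inside a group the rotation preserves covariances. This also removes the term `t = s`, the
    -- only one containing a second derivative.
    · have : -Real.sin θ * Real.cos θ + Real.cos θ * Real.sin θ = 0 := by ring
      rw [this]
      simp
    · have hne : t ≠ s := fun h => hst (by rw [h])
      have hsc : |(-Real.sin θ * Real.cos θ + 0) * r s t| ≤ |r s t| := by
        rw [abs_mul, add_zero]
        refine mul_le_of_le_one_left (abs_nonneg _) ?_
        rw [abs_mul, abs_neg]
        exact mul_le_one₀ (Real.abs_sin_le_one _) (abs_nonneg _) (Real.abs_cos_le_one _)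
      rw [abs_mul]
      refine mul_le_mul hsc ?_ (abs_nonneg _) (abs_nonneg _)
      refine le_trans ?_ (pair θ s t hst)
      refine (abs_integral_le_integral_abs).trans ?_
      refine integral_mono_of_nonneg (Eventually.of_forall fun ω => abs_nonneg _) ?_
        (Eventually.of_forall fun ω => ?_)
      · refine Integrable.of_bound (((hf'c s).abs.measurable.comp (hZm θ s)).mul
          ((hf'c t).abs.measurable.comp (hZm θ t))).aestronglyMeasurable (C * C)
          (Eventually.of_forall fun ω => ?_)
        rw [Real.norm_eq_abs, abs_mul, abs_abs, abs_abs]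
        exact mul_le_mul (hC' _ _) (hC' _ _) (abs_nonneg _) ((abs_nonneg _).trans (hC' s 0))
      · simp only [abs_mul, Function.update_of_ne hne]
        refine mul_le_mul_of_nonneg_right ?_ (abs_nonneg _)
        rw [Finset.abs_prod, ← Finset.mul_prod_erase _ _
          (Finset.mem_erase.2 ⟨hne.symm, Finset.mem_univ s⟩), Function.update_self]
        refine mul_le_of_le_one_right (abs_nonneg _) (Finset.prod_le_one (fun _ _ => abs_nonneg _)
          fun u hu => ?_)
        rw [Function.update_of_ne (Finset.ne_of_mem_erase hu)]
        exact hf1 u _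
  -- Angle `0` is the original vector, angle `π / 2` the decoupled one.
  have mv := Convex.norm_image_sub_le_of_norm_hasDerivWithin_le (𝕜 := ℝ) (s := Set.univ)
    (x := Real.pi / 2) (y := 0)
    (fun θ _ => (hasDerivAt_integral_interp (μ := μ) g hf hf'c hf1 hC' θ).hasDerivWithinAt)
    (fun θ _ => by rw [Real.norm_eq_abs]; exact hdb θ) convex_univ trivial trivial
  simp only [Real.norm_eq_abs, Real.cos_zero, Real.sin_zero, Real.cos_pi_div_two,
    Real.sin_pi_div_two, interp, one_mul, zero_mul, add_zero, zero_add, zero_sub, abs_neg] at mv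
  rw [abs_of_pos (by positivity : (0 : ℝ) < Real.pi / 2)] at mv
  refine mv.trans (le_of_eq ?_)
  simp_rw [Finset.sum_mul]

end Interpolation

/-! ### Windows -/

/-- A set `B` of reals is a window at level `w` if it is a half line or a bounded interval, smoothed
in such a way that the derivative concentrates at distance at least `w` from the origin. -/
def IsWindow (B : Set ℝ) (w : ℝ) : Prop :=
  MeasurableSet B ∧ ∃ f f' f'' : ℕ → ℝ → ℝ, (∀ j x, 0 ≤ f j x ∧ f j x ≤ 1) ∧
    (∀ j x, HasDerivAt (f j) (f' j x) x) ∧ (∀ j x, HasDerivAt (f' j) (f'' j x) x) ∧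
    (∀ j, Continuous (f'' j)) ∧ (∀ j, ∃ C, ∀ x, |f' j x| ≤ C ∧ |f'' j x| ≤ C) ∧
    (∃ S : Set ℝ, S.Countable ∧ ∀ x ∉ S, Tendsto (fun j => f j x) atTop
      (𝓝 (B.indicator (fun _ => 1) x))) ∧
    ∀ τ > 0, ∃ c : ℕ → ℝ, (∀ j, 0 ≤ c j) ∧ (∃ l ≤ 2 * Real.exp (-(w ^ 2 / (2 * τ))),
      Tendsto c atTop (𝓝 l)) ∧
      ∀ j, ∫⁻ x, ENNReal.ofReal |f' j x| * ENNReal.ofReal (Real.exp (-(x ^ 2 / (2 * τ))))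
        ≤ ENNReal.ofReal (c j)

/-- The smoothed indicator of the half line `(-∞, u]`. -/
def smoothStep (u : ℝ) (j : ℕ) (x : ℝ) : ℝ := stdNormalCDF ((j + 1) * (u - x))

/-- The derivative of the smoothed indicator. -/
def smoothStepDeriv (u : ℝ) (j : ℕ) (x : ℝ) : ℝ :=
  -((j + 1) * gaussianPDFReal 0 1 ((j + 1) * (u - x)))

/-- The second derivative of the smoothed indicator. -/
def smoothStepDerivTwo (u : ℝ) (j : ℕ) (x : ℝ) : ℝ :=
  -((j + 1) ^ 2 * (((j + 1) * (u - x)) * gaussianPDFReal 0 1 ((j + 1) * (u - x))))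

lemma hasDerivAt_scale (u : ℝ) (j : ℕ) (x : ℝ) :
    HasDerivAt (fun x : ℝ => ((j : ℝ) + 1) * (u - x)) (-((j : ℝ) + 1)) x := by
  simpa using ((hasDerivAt_id x).const_sub u).const_mul ((j : ℝ) + 1)

lemma hasDerivAt_smoothStep (u : ℝ) (j : ℕ) (x : ℝ) :
    HasDerivAt (smoothStep u j) (smoothStepDeriv u j x) x := by
  refine ((hasDerivAt_stdNormalCDF _).comp x (hasDerivAt_scale u j x)).congr_deriv ?_
  rw [smoothStepDeriv]; ring

lemma hasDerivAt_smoothStepDeriv (u : ℝ) (j : ℕ) (x : ℝ) :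
    HasDerivAt (smoothStepDeriv u j) (smoothStepDerivTwo u j x) x := by
  refine ((((hasDerivAt_stdPDF _).comp x (hasDerivAt_scale u j x)).const_mul
    ((j : ℝ) + 1)).neg).congr_deriv ?_
  rw [smoothStepDerivTwo]; ring

lemma continuous_smoothStepDerivTwo (u : ℝ) (j : ℕ) : Continuous (smoothStepDerivTwo u j) := by
  unfold smoothStepDerivTwo
  have : Continuous fun x : ℝ => gaussianPDFReal 0 1 (((j : ℝ) + 1) * (u - x)) :=
    continuous_stdPDF.comp (by fun_prop)
  fun_prop

lemma abs_smoothStepDeriv_le (u : ℝ) (j : ℕ) (x : ℝ) : |smoothStepDeriv u j x| ≤ j + 1 := by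
  rw [smoothStepDeriv, abs_neg, abs_mul, abs_of_pos (by positivity : (0 : ℝ) < j + 1),
    abs_of_nonneg (gaussianPDFReal_nonneg _ _ _)]
  exact mul_le_of_le_one_right (by positivity) (stdPDF_le_one _)

lemma abs_smoothStepDerivTwo_le (u : ℝ) (j : ℕ) (x : ℝ) :
    |smoothStepDerivTwo u j x| ≤ (j + 1) ^ 2 := by
  rw [smoothStepDerivTwo, abs_neg, abs_mul, abs_of_pos (by positivity : (0 : ℝ) < (j + 1) ^ 2)]
  exact mul_le_of_le_one_right (by positivity) (abs_mul_stdPDF_le_one _)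

/-- The point `x = u` is excluded because the smoothed value there stays at `1/2`; a single point is
harmless for Gaussian laws. -/
lemma tendsto_smoothStep {u x : ℝ} (hx : x ≠ u) :
    Tendsto (fun j => smoothStep u j x) atTop (𝓝 ((Set.Iic u).indicator (fun _ => 1) x)) := by
  have hj : Tendsto (fun j : ℕ => (j : ℝ) + 1) atTop atTop :=
    tendsto_atTop_add_const_right _ _ tendsto_natCast_atTop_atTop
  rcases lt_or_gt_of_ne hx with h | h
  · rw [Set.indicator_of_mem (Set.mem_Iic.2 h.le)]
    exact (tendsto_cdf_atTop (gaussianReal 0 1)).comp (hj.atTop_mul_const (sub_pos.2 h))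
  · rw [Set.indicator_of_notMem (by simpa using h)]
    exact (tendsto_cdf_atBot (gaussianReal 0 1)).comp (hj.atTop_mul_const_of_neg (sub_neg.2 h))

/-- The absolute derivative is the density of `u - Y / (j + 1)` with `Y` standard normal, so the
integral is an expectation, which concentrates at `u` as `j` grows. -/
lemma lintegral_smoothStepDeriv (u : ℝ) (j : ℕ) {τ : ℝ} (hτ : 0 < τ) :
    ∫⁻ x, ENNReal.ofReal |smoothStepDeriv u j x| * ENNReal.ofReal (Real.exp (-(x ^ 2 / (2 * τ))))
      = ENNReal.ofReal (∫ y, Real.exp (-((u - y / (j + 1)) ^ 2 / (2 * τ))) ∂(gaussianReal 0 1)) := by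
  set κ : ℝ := j + 1 with hκ
  have hκ0 : 0 < κ := by positivity
  set v : NNReal := NNReal.mk ((1 / κ) ^ 2) (sq_nonneg _) with hv
  have hvr : (v : ℝ) = (1 / κ) ^ 2 := rfl
  have hv0 : v ≠ 0 := by
    intro h
    have h2 : (v : ℝ) = 0 := by rw [h]; rfl
    rw [hvr] at h2
    have : 0 < (1 / κ) ^ 2 := by positivity
    linarith
  have hmap : (gaussianReal 0 1).map (fun y => u - y / κ) = gaussianReal u v := by
    have : (fun y : ℝ => u - y / κ) = (fun y => u + y) ∘ (fun y => -(1 / κ) * y) := by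
      funext y; simp only [Function.comp]; ring
    rw [this, ← Measure.map_map (by fun_prop) (by fun_prop), gaussianReal_map_const_mul,
      gaussianReal_map_const_add]
    simp only [mul_zero, zero_add, mul_one]
    congr 1
    exact NNReal.eq (by simp [hvr])
  have hpdf : ∀ x, |smoothStepDeriv u j x| = gaussianPDFReal u v x := fun x => by
    rw [smoothStepDeriv, abs_neg, abs_of_nonneg
      (mul_nonneg hκ0.le (gaussianPDFReal_nonneg _ _ _)), stdPDF_eq, gaussianPDFReal, hvr, ← hκ,
      Real.sqrt_mul (by positivity : 0 ≤ 2 * Real.pi) ((1 / κ) ^ 2), Real.sqrt_sq (by positivity)]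
    have e : -(κ * (u - x)) ^ 2 / 2 = -(x - u) ^ 2 / (2 * (1 / κ) ^ 2) := by
      field_simp
      ring
    rw [e]
    field_simp
  have hcont : Continuous fun x : ℝ => Real.exp (-(x ^ 2 / (2 * τ))) := by fun_prop
  have hint : Integrable (fun x : ℝ => Real.exp (-(x ^ 2 / (2 * τ)))) (gaussianReal u v) :=
    Integrable.of_bound hcont.aestronglyMeasurable 1 (Eventually.of_forall fun x => by
      rw [Real.norm_eq_abs, abs_of_pos (Real.exp_pos _), Real.exp_le_one_iff]
      have : 0 ≤ x ^ 2 / (2 * τ) := by positivity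
      linarith)
  rw [← integral_map (φ := fun y : ℝ => u - y / κ) (by fun_prop) hcont.aestronglyMeasurable, hmap,
    ofReal_integral_eq_lintegral_ofReal hint (Eventually.of_forall fun x => (Real.exp_pos _).le),
    gaussianReal_of_var_ne_zero _ hv0, lintegral_withDensity_eq_lintegral_mul _
      (measurable_gaussianPDF _ _) hcont.measurable.ennreal_ofReal]
  simp_rw [hpdf]
  rfl

lemma tendsto_integral_kernel (u : ℝ) {τ : ℝ} (hτ : 0 < τ) :
    Tendsto (fun j : ℕ => ∫ y, Real.exp (-((u - y / (j + 1)) ^ 2 / (2 * τ))) ∂(gaussianReal 0 1))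
      atTop (𝓝 (Real.exp (-(u ^ 2 / (2 * τ))))) := by
  have h := tendsto_integral_of_dominated_convergence (μ := gaussianReal 0 1)
    (F := fun (j : ℕ) y => Real.exp (-((u - y / (j + 1)) ^ 2 / (2 * τ))))
    (f := fun _ => Real.exp (-(u ^ 2 / (2 * τ)))) (fun _ => 1)
    (fun j => (by fun_prop : Continuous fun y : ℝ =>
      Real.exp (-((u - y / (j + 1)) ^ 2 / (2 * τ)))).aestronglyMeasurable)
    (integrable_const 1)
    (fun j => Eventually.of_forall fun y => by
      rw [Real.norm_eq_abs, abs_of_pos (Real.exp_pos _), Real.exp_le_one_iff]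
      have : 0 ≤ (u - y / (j + 1)) ^ 2 / (2 * τ) := by positivity
      linarith)
    (Eventually.of_forall fun y => by
      have hj : Tendsto (fun j : ℕ => (j : ℝ) + 1) atTop atTop :=
        tendsto_atTop_add_const_right _ _ tendsto_natCast_atTop_atTop
      have h1 : Tendsto (fun j : ℕ => u - y / (j + 1)) atTop (𝓝 (u - 0)) :=
        (hj.const_div_atTop y).const_sub u
      rw [sub_zero] at h1
      exact (Real.continuous_exp.tendsto _).comp (((h1.pow 2).div_const _).neg))
  simpa using h

lemma exp_neg_sq_div_le {w u τ : ℝ} (hw : 0 ≤ w) (hwu : w ≤ |u|) (hτ : 0 < τ) :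
    Real.exp (-(u ^ 2 / (2 * τ))) ≤ Real.exp (-(w ^ 2 / (2 * τ))) := by
  have : w ^ 2 ≤ u ^ 2 := by rw [← sq_abs u]; gcongr
  gcongr

/-- The only endpoint contributes `exp(-u² / (2τ))`; the factor `2` in `IsWindow` leaves room for
the second endpoint of an interval. -/
lemma isWindow_Iic {u w : ℝ} (hw : 0 ≤ w) (hwu : w ≤ |u|) : IsWindow (Set.Iic u) w := by
  refine ⟨measurableSet_Iic, smoothStep u, smoothStepDeriv u, smoothStepDerivTwo u,
    fun j x => ⟨stdNormalCDF_nonneg _, stdNormalCDF_le_one _⟩, hasDerivAt_smoothStep u,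
    hasDerivAt_smoothStepDeriv u, continuous_smoothStepDerivTwo u,
    fun j => ⟨max (j + 1) ((j + 1) ^ 2), fun x => ⟨(abs_smoothStepDeriv_le u j x).trans
      (le_max_left _ _), (abs_smoothStepDerivTwo_le u j x).trans (le_max_right _ _)⟩⟩,
    ⟨{u}, Set.countable_singleton u, fun x hx => tendsto_smoothStep hx⟩, fun τ hτ => ?_⟩
  refine ⟨_, fun j => integral_nonneg fun y => (Real.exp_pos _).le,
    ⟨_, ?_, tendsto_integral_kernel u hτ⟩, fun j => (lintegral_smoothStepDeriv u j hτ).le⟩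
  have := exp_neg_sq_div_le hw hwu hτ
  linarith [Real.exp_pos (-(w ^ 2 / (2 * τ)))]

lemma isWindow_Ioc {u v w : ℝ} (hw : 0 ≤ w) (hwu : w ≤ |u|) (hwv : w ≤ |v|) (hvu : v ≤ u) :
    IsWindow (Set.Ioc v u) w := by
  refine ⟨measurableSet_Ioc, fun j x => smoothStep u j x - smoothStep v j x,
    fun j x => smoothStepDeriv u j x - smoothStepDeriv v j x,
    fun j x => smoothStepDerivTwo u j x - smoothStepDerivTwo v j x,
    fun j x => ⟨?_, ?_⟩, fun j x => (hasDerivAt_smoothStep u j x).sub (hasDerivAt_smoothStep v j x),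
    fun j x => (hasDerivAt_smoothStepDeriv u j x).sub (hasDerivAt_smoothStepDeriv v j x),
    fun j => (continuous_smoothStepDerivTwo u j).sub (continuous_smoothStepDerivTwo v j),
    fun j => ⟨max ((j + 1) + (j + 1)) ((j + 1) ^ 2 + (j + 1) ^ 2), fun x => ⟨?_, ?_⟩⟩,
    ⟨{u, v}, (Set.countable_singleton v).insert u, fun x hx => ?_⟩, fun τ hτ => ?_⟩
  · refine sub_nonneg.2 (stdNormalCDF_mono ?_)
    gcongr
  · linarith [stdNormalCDF_le_one (((j : ℝ) + 1) * (u - x)),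
      stdNormalCDF_nonneg (((j : ℝ) + 1) * (v - x)), smoothStep.eq_1 u j x, smoothStep.eq_1 v j x]
  · exact ((abs_sub _ _).trans (add_le_add (abs_smoothStepDeriv_le u j x)
      (abs_smoothStepDeriv_le v j x))).trans (le_max_left _ _)
  · exact ((abs_sub _ _).trans (add_le_add (abs_smoothStepDerivTwo_le u j x)
      (abs_smoothStepDerivTwo_le v j x))).trans (le_max_right _ _)
  · simp only [Set.mem_insert_iff, Set.mem_singleton_iff, not_or] at hx
    refine ((tendsto_smoothStep hx.1).sub (tendsto_smoothStep hx.2)).congr' ?_ |>.trans (le_of_eq ?_)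
    · exact EventuallyEq.rfl
    · congr 1
      by_cases h1 : x ≤ u <;> by_cases h2 : x ≤ v
      · simp [Set.indicator, h1, h2, not_lt.2 h2]
      · simp [Set.indicator, h1, h2, not_le.1 h2]
      · exact absurd (h2.trans hvu) h1
      · simp [Set.indicator, h1, h2]
  · refine ⟨fun j => (∫ y, Real.exp (-((u - y / (j + 1)) ^ 2 / (2 * τ))) ∂(gaussianReal 0 1)) +
      ∫ y, Real.exp (-((v - y / (j + 1)) ^ 2 / (2 * τ))) ∂(gaussianReal 0 1),
      fun j => add_nonneg (integral_nonneg fun y => (Real.exp_pos _).le)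
        (integral_nonneg fun y => (Real.exp_pos _).le),
      ⟨_, ?_, (tendsto_integral_kernel u hτ).add (tendsto_integral_kernel v hτ)⟩, fun j => ?_⟩
    · linarith [exp_neg_sq_div_le hw hwu hτ, exp_neg_sq_div_le hw hwv hτ]
    · rw [ENNReal.ofReal_add (integral_nonneg fun y => (Real.exp_pos _).le)
        (integral_nonneg fun y => (Real.exp_pos _).le), ← lintegral_smoothStepDeriv u j hτ,
        ← lintegral_smoothStepDeriv v j hτ]
      have hm : Measurable fun x => ENNReal.ofReal |smoothStepDeriv u j x| *
          ENNReal.ofReal (Real.exp (-(x ^ 2 / (2 * τ)))) := by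
        have : Continuous (smoothStepDeriv u j) :=
          continuous_iff_continuousAt.2 fun x => (hasDerivAt_smoothStepDeriv u j x).continuousAt
        fun_prop
      rw [← lintegral_add_left hm]
      refine lintegral_mono fun x => ?_
      rw [← add_mul, ← ENNReal.ofReal_add (abs_nonneg _) (abs_nonneg _)]
      gcongr
      exact abs_sub _ _

/-! ### Decoupling of Gaussian vectors -/

/-- Convergence of the expected smoothed product to the probability of a product of windows. -/
lemma tendsto_integral_prod_smooth {T Ω : Type*} [Fintype T] [MeasurableSpace Ω] {P : Measure Ω}
    [IsProbabilityMeasure P] {V : T → Ω → ℝ} (hV : ∀ t, Measurable (V t))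
    (hlaw : ∀ t, P.map (V t) = gaussianReal 0 1) {B : T → Set ℝ} (hB : ∀ t, MeasurableSet (B t))
    {f : T → ℕ → ℝ → ℝ} (hf : ∀ t j, Continuous (f t j)) (hf1 : ∀ t j x, |f t j x| ≤ 1)
    {S : T → Set ℝ} (hS : ∀ t, (S t).Countable)
    (hlim : ∀ t, ∀ x ∉ S t, Tendsto (fun j => f t j x) atTop
      (𝓝 ((B t).indicator (fun _ => 1) x))) :
    Tendsto (fun j => ∫ ω, ∏ t, f t j (V t ω) ∂P) atTop (𝓝 (P.real {ω | ∀ t, V t ω ∈ B t})) := by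
  have hmeas : MeasurableSet {ω | ∀ t, V t ω ∈ B t} := by
    rw [Set.ofPred_forall]
    exact MeasurableSet.iInter fun t => hV t (hB t)
  have e : P.real {ω | ∀ t, V t ω ∈ B t} = ∫ ω, ∏ t, (B t).indicator (fun _ => (1 : ℝ)) (V t ω) ∂P := by
    rw [← integral_indicator_one hmeas]
    congr 1
    funext ω
    by_cases h : ∀ t, V t ω ∈ B t
    · rw [Set.indicator_of_mem (by exact h)]
      simp [h]
    · rw [Set.indicator_of_notMem (by exact h)]
      push Not at h
      obtain ⟨t, ht⟩ := h
      exact (Finset.prod_eq_zero (Finset.mem_univ t) (Set.indicator_of_notMem ht _)).symm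
  rw [e]
  -- The smoothed indicators may fail to converge on countable sets only, and these are null for the
  -- nondegenerate marginals.
  have hnull : ∀ᵐ ω ∂P, ∀ t, V t ω ∉ S t := by
    rw [ae_all_iff]
    intro t
    have h1 : (gaussianReal 0 1) (S t) = 0 := by
      have := nullSingletonClass_gaussianReal (μ := 0) (v := 1) one_ne_zero
      exact (hS t).measure_zero _
    rw [← hlaw t, Measure.map_apply (hV t) (hS t).measurableSet] at h1
    rw [ae_iff]
    simp only [not_not]
    exact h1
  refine tendsto_integral_of_dominated_convergence (fun _ => 1) (fun j => ?_) (integrable_const 1)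
    (fun j => Eventually.of_forall fun ω => ?_) ?_
  · exact (Finset.measurable_fun_prod _ fun t _ =>
      (hf t j).measurable.comp (hV t)).aestronglyMeasurable
  · rw [Real.norm_eq_abs, Finset.abs_prod]
    exact Finset.prod_le_one (fun _ _ => abs_nonneg _) fun t _ => hf1 t j _
  · filter_upwards [hnull] with ω hω
    exact tendsto_finsetProd _ fun t _ => hlim t _ (hω t)

/-- The normal comparison inequality between a Gaussian vector and its decoupled version. -/
theorem abs_measure_windows_sub_prod_le {T ι : Type*} [Fintype T] [Fintype ι] [DecidableEq ι]
    {μ : Measure (T → ℝ)} [IsGaussian μ] (g : T → ι)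
    (h0 : ∀ t, ∫ x, x t ∂μ = 0) (h1 : ∀ t, Var[fun x => x t; μ] = 1)
    {r : T → T → ℝ} (hr : ∀ s t, cov[fun x => x s, fun x => x t; μ] = r s t) {R : ℝ} (hR : R < 1)
    (hrR : ∀ s t, g s ≠ g t → |r s t| ≤ R) {B : T → Set ℝ} {w : T → ℝ}
    (hB : ∀ t, IsWindow (B t) (w t)) :
    |μ.real {x | ∀ t, x t ∈ B t} - ∏ i, μ.real {x | ∀ t, g t = i → x t ∈ B t}| ≤
      2 * Real.pi * (√(1 - R ^ 2))⁻¹ * ∑ s, ∑ t, if g s = g t then 0 else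
        |r s t| * Real.exp (-((w s ^ 2 + w t ^ 2) / (2 * (1 + |r s t|)))) := by
  classical
  unfold IsWindow at hB
  choose hBm f f' f'' hf01 hfd hfd' hfc'' hfC hS hfc using hB
  choose S hScount hSlim using hS
  choose C hC using hfC
  have hpos : ∀ s t, 0 < 1 + |r s t| := fun s t => by positivity
  choose c hc0 hcl hci using fun s t => hfc s (1 + |r s t|) (hpos s t)
  choose l hl hcl using hcl
  have hfcont : ∀ t j, Continuous (f t j) := fun t j =>
    continuous_iff_continuousAt.2 fun x => (hfd t j x).continuousAt
  have hf1 : ∀ t j x, |f t j x| ≤ 1 := fun t j x => by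
    rw [abs_of_nonneg (hf01 t j x).1]; exact (hf01 t j x).2
  have hsymm : ∀ s t, r s t = r t s := fun s t => by rw [← hr, ← hr, covariance_comm]
  have hlaw : ∀ (o : Option ι) (t : T),
      (copies μ ι).map (fun ω => ω o t) = gaussianReal 0 1 := fun o t => by
    have hG : HasGaussianLaw (fun x : T → ℝ => x t) μ :=
      (IsGaussian.hasGaussianLaw_id (μ := μ)).map_fun (ContinuousLinearMap.proj (R := ℝ) t)
    have e1 : μ.map (fun x : T → ℝ => x t) = gaussianReal 0 1 := by
      rw [hG.map_eq_gaussianReal, h0, h1]; simp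
    have e2 := (measurePreserving_eval (fun _ : Option ι => μ) o).map_eq
    have e3 := Measure.map_map (μ := Measure.pi fun _ : Option ι => μ)
      (measurable_pi_apply t : Measurable fun x : T → ℝ => x t) (measurable_pi_apply o)
    rw [← e1]
    conv_rhs => rw [← e2]
    exact e3.symm
  have lim1 := tendsto_integral_prod_smooth (P := copies μ ι) (V := fun t ω => ω none t)
    (fun t => by fun_prop) (hlaw none) hBm hfcont hf1 hScount hSlim
  have lim2 := tendsto_integral_prod_smooth (P := copies μ ι) (V := fun t ω => ω (some (g t)) t)
    (fun t => by fun_prop) (fun t => hlaw _ t) hBm hfcont hf1 hScount hSlim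
  have hms : ∀ i, MeasurableSet {x : T → ℝ | ∀ t, g t = i → x t ∈ B t} := fun i => by
    rw [Set.ofPred_forall]
    refine MeasurableSet.iInter fun t => ?_
    rw [Set.ofPred_forall]
    exact MeasurableSet.iInter fun _ => measurable_pi_apply t (hBm t)
  have hms' : MeasurableSet {x : T → ℝ | ∀ t, x t ∈ B t} := by
    rw [Set.ofPred_forall]
    exact MeasurableSet.iInter fun t => measurable_pi_apply t (hBm t)
  have p1 : (copies μ ι).real {ω | ∀ t, ω none t ∈ B t} = μ.real {x | ∀ t, x t ∈ B t} := by
    have e2 := (measurePreserving_eval (fun _ : Option ι => μ) none).measureReal_preimage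
      hms'.nullMeasurableSet
    exact e2
  have p2 : (copies μ ι).real {ω | ∀ t, ω (some (g t)) t ∈ B t} =
      ∏ i, μ.real {x | ∀ t, g t = i → x t ∈ B t} := by
    -- The copy attached to a group is tested only on the coordinates of that group and the
    -- reference copy not at all, so the event is a product set over the independent copies.
    have e : {ω : Option ι → T → ℝ | ∀ t, ω (some (g t)) t ∈ B t} =
        Set.univ.pi (fun o : Option ι => o.elim Set.univ
          fun i => {x : T → ℝ | ∀ t, g t = i → x t ∈ B t}) := by
      ext ω
      simp only [Set.mem_ofPred_eq, Set.mem_univ_pi, Option.forall, Option.elim_none, Set.mem_univ,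
        Option.elim_some, true_and]
      exact ⟨fun h i t hi => hi ▸ h t, fun h t => h (g t) t rfl⟩
    rw [e, Measure.real, Measure.pi_pi, ENNReal.toReal_prod, Fintype.prod_option]
    simp [Measure.real]
  rw [p1] at lim1
  rw [p2] at lim2
  have hr1 : ∀ s t, g s ≠ g t → |r s t| < 1 := fun s t h => (hrR s t h).trans_lt hR
  have bound : ∀ j, |(∫ ω, ∏ t, f t j (ω none t) ∂(copies μ ι)) -
        ∫ ω, ∏ t, f t j (ω (some (g t)) t) ∂(copies μ ι)| ≤
      ∑ s, ∑ t, (if g s = g t then 0 else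
        |r s t| * ((√(1 - r s t ^ 2))⁻¹ * (c s t j * c t s j))) * (Real.pi / 2) := fun j => by
    refine abs_integral_interp_sub_le (μ := μ) g h0 h1 hr hr1 (fun t => hfd t j)
      (fun t => hfd' t j) (fun t => hfc'' t j) (fun t => hf1 t j) (C := ∑ t, |C t j|)
      (fun t x => ?_) (fun t x => ?_) (c := fun s t => c s t j) (fun s t => hc0 s t j)
      (fun s t => hci s t j)
    · exact ((hC t j x).1.trans (le_abs_self _)).trans
        (Finset.single_le_sum (f := fun t => |C t j|) (fun _ _ => abs_nonneg _) (Finset.mem_univ t))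
    · exact ((hC t j x).2.trans (le_abs_self _)).trans
        (Finset.single_le_sum (f := fun t => |C t j|) (fun _ _ => abs_nonneg _) (Finset.mem_univ t))
  have lim3 : Tendsto (fun j => ∑ s, ∑ t, (if g s = g t then 0 else
        |r s t| * ((√(1 - r s t ^ 2))⁻¹ * (c s t j * c t s j))) * (Real.pi / 2)) atTop
      (𝓝 (∑ s, ∑ t, (if g s = g t then 0 else
        |r s t| * ((√(1 - r s t ^ 2))⁻¹ * (l s t * l t s))) * (Real.pi / 2))) := by
    refine tendsto_finsetSum _ fun s _ => tendsto_finsetSum _ fun t _ => ?_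
    refine Tendsto.mul_const _ ?_
    split_ifs
    · exact tendsto_const_nhds
    · exact (((hcl s t).mul (hcl t s)).const_mul _).const_mul _
  have hl0 : ∀ s t, 0 ≤ l s t := fun s t => ge_of_tendsto' (hcl s t) (hc0 s t)
  refine (le_of_tendsto_of_tendsto' (lim1.sub lim2).abs lim3 bound).trans ?_
  rw [Finset.mul_sum]
  refine Finset.sum_le_sum fun s _ => ?_
  rw [Finset.mul_sum]
  refine Finset.sum_le_sum fun t _ => ?_
  split_ifs with hst
  · simp
  · have hR2 : 0 < 1 - R ^ 2 := by
      have : 0 ≤ R := (abs_nonneg _).trans (hrR s t hst)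
      nlinarith
    have a1 : (√(1 - r s t ^ 2))⁻¹ ≤ (√(1 - R ^ 2))⁻¹ := by
      rw [← sq_abs (r s t)]
      gcongr
      exact hrR s t hst
    have a2 : l s t * l t s ≤
        4 * Real.exp (-((w s ^ 2 + w t ^ 2) / (2 * (1 + |r s t|)))) := by
      have b2 := hl t s
      rw [hsymm t s] at b2
      calc l s t * l t s ≤ (2 * Real.exp (-(w s ^ 2 / (2 * (1 + |r s t|))))) *
            (2 * Real.exp (-(w t ^ 2 / (2 * (1 + |r s t|))))) :=
            mul_le_mul (hl s t) b2 (hl0 t s) (by positivity)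
        _ = 4 * (Real.exp (-(w s ^ 2 / (2 * (1 + |r s t|)))) *
            Real.exp (-(w t ^ 2 / (2 * (1 + |r s t|))))) := by ring
        _ = _ := by
            rw [← Real.exp_add]
            congr 2
            ring
    have a3 : (√(1 - r s t ^ 2))⁻¹ * (l s t * l t s) ≤ (√(1 - R ^ 2))⁻¹ *
        (4 * Real.exp (-((w s ^ 2 + w t ^ 2) / (2 * (1 + |r s t|))))) :=
      mul_le_mul a1 a2 (mul_nonneg (hl0 s t) (hl0 t s)) (by positivity)
    -- The constant `2π` is the length `π / 2` of the rotation times a factor `2` from each of the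
    -- two windows.
    calc |r s t| * ((√(1 - r s t ^ 2))⁻¹ * (l s t * l t s)) * (Real.pi / 2)
        ≤ |r s t| * ((√(1 - R ^ 2))⁻¹ *
          (4 * Real.exp (-((w s ^ 2 + w t ^ 2) / (2 * (1 + |r s t|)))))) * (Real.pi / 2) := by
          gcongr
      _ = _ := by ring

/-! ### Asymptotics of the levels -/

lemma tendsto_log_natCast : Tendsto (fun n : ℕ => Real.log n) atTop atTop :=
  Real.tendsto_log_atTop.comp tendsto_natCast_atTop_atTop

lemma eventually_log_pos : ∀ᶠ n : ℕ in atTop, 0 < Real.log n :=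
  tendsto_log_natCast.eventually_gt_atTop 0

/-- For `k = 1` and `k = 2` these are the error terms in `a_n b_n → 1` and in `n a_n φ(b_n) → 1`. -/
lemma tendsto_logLog_pow_div_log (k : ℕ) :
    Tendsto (fun n : ℕ => Real.log (4 * Real.pi * Real.log n) ^ k / Real.log n) atTop (𝓝 0) := by
  have h1 : Tendsto (fun n : ℕ => 4 * Real.pi * Real.log n) atTop atTop :=
    tendsto_log_natCast.const_mul_atTop (by positivity)
  have h2 := (Real.tendsto_pow_log_div_mul_add_atTop (1 / (4 * Real.pi)) 0 k
    (by positivity)).comp h1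
  refine h2.congr fun n => ?_
  simp only [Function.comp]
  congr 1
  field_simp
  ring

lemma tendsto_scaleConst : Tendsto scaleConst atTop (𝓝 0) := by
  have h1 : Tendsto (fun n : ℕ => √(2 * Real.log n)) atTop atTop :=
    Real.tendsto_sqrt_atTop.comp (tendsto_log_natCast.const_mul_atTop (by norm_num))
  exact (tendsto_const_nhds (x := (1 : ℝ))).div_atTop h1

lemma scaleConst_pos {n : ℕ} (h : 0 < Real.log n) : 0 < scaleConst n := by
  unfold scaleConst; positivity

lemma scaleConst_mul_locConst {n : ℕ} (h : 0 < Real.log n) :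
    scaleConst n * locConst n
      = 1 - Real.log (4 * Real.pi * Real.log n) ^ 1 / Real.log n * (1 / 4) := by
  have h1 : 0 < √(2 * Real.log n) := by positivity
  have h2 : √(2 * Real.log n) ^ 2 = 2 * Real.log n := Real.sq_sqrt (by positivity)
  unfold scaleConst locConst
  field_simp
  rw [h2]
  ring

lemma tendsto_scaleConst_mul_locConst :
    Tendsto (fun n => scaleConst n * locConst n) atTop (𝓝 1) := by
  have h := ((tendsto_logLog_pow_div_log 1).mul_const (1 / 4)).const_sub 1
  simp only [zero_mul, sub_zero] at h
  refine h.congr' ?_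
  filter_upwards [eventually_log_pos] with n hn
  rw [scaleConst_mul_locConst hn]

lemma tendsto_scaleConst_mul_level (z : ℝ) :
    Tendsto (fun n => scaleConst n * level n z) atTop (𝓝 1) := by
  have h := ((tendsto_scaleConst.mul tendsto_scaleConst).mul_const z).add
    tendsto_scaleConst_mul_locConst
  simp only [zero_mul, zero_add] at h
  refine h.congr fun n => ?_
  unfold level
  ring

/-- This is what `b_n` is chosen for. With `g = ln(4π ln n)` one has `b_n² / 2 = ln n - g / 2 + g² /
(16 ln n)`, and `exp(g / 2) = √(2 ln n) √(2π)` cancels both `a_n` and the normalisation of the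
density. -/
lemma mul_scaleConst_mul_stdPDF_locConst {n : ℕ} (h : 0 < Real.log n) :
    n * scaleConst n * gaussianPDFReal 0 1 (locConst n)
      = Real.exp (-(Real.log (4 * Real.pi * Real.log n) ^ 2 / Real.log n * (1 / 16))) := by
  have hn : (0 : ℝ) < n := by
    rcases Nat.eq_zero_or_pos n with h0 | h0
    · simp [h0] at h
    · exact_mod_cast h0
  have h1 : 0 < √(2 * Real.log n) := by positivity
  have h2 : √(2 * Real.log n) ^ 2 = 2 * Real.log n := Real.sq_sqrt (by positivity)
  set g := Real.log (4 * Real.pi * Real.log n) with hg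
  have hb : -locConst n ^ 2 / 2 = -Real.log n + g / 2 - g ^ 2 / Real.log n * (1 / 16) := by
    unfold locConst
    rw [← hg]
    field_simp
    have h3 : √(2 * Real.log n) ^ 4 = (2 * Real.log n) ^ 2 := by
      calc √(2 * Real.log n) ^ 4 = (√(2 * Real.log n) ^ 2) ^ 2 := by ring
        _ = _ := by rw [h2]
    ring_nf
    rw [mul_comm (Real.log n) 2, h3, h2]
    ring
  have hg2 : Real.exp (g / 2) = √(2 * Real.log n) * √(2 * Real.pi) := by
    rw [← Real.sqrt_mul (by positivity), hg, Real.exp_half, Real.exp_log (by positivity)]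
    congr 1
    ring
  rw [stdPDF_eq, hb, sub_eq_add_neg, Real.exp_add, Real.exp_add, hg2, Real.exp_neg,
    Real.exp_log hn, scaleConst]
  field_simp

lemma tendsto_mul_stdPDF_locConst :
    Tendsto (fun n : ℕ => n * scaleConst n * gaussianPDFReal 0 1 (locConst n)) atTop (𝓝 1) := by
  have h := (((tendsto_logLog_pow_div_log 2).mul_const (1 / 16)).neg).rexp
  simp only [zero_mul, neg_zero, Real.exp_zero] at h
  refine h.congr' ?_
  filter_upwards [eventually_log_pos] with n hn
  rw [mul_scaleConst_mul_stdPDF_locConst hn]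

lemma stdPDF_level (n : ℕ) (z : ℝ) : gaussianPDFReal 0 1 (level n z) =
    gaussianPDFReal 0 1 (locConst n) *
      Real.exp (-(scaleConst n * locConst n * z + (scaleConst n * z) ^ 2 / 2)) := by
  rw [stdPDF_eq, stdPDF_eq, mul_assoc, ← Real.exp_add]
  congr 2
  unfold level
  ring

/-- The rescaled normal density converges to the exponential function. -/
lemma tendsto_mul_stdPDF_level (z : ℝ) :
    Tendsto (fun n : ℕ => n * scaleConst n * gaussianPDFReal 0 1 (level n z)) atTop
      (𝓝 (Real.exp (-z))) := by
  have h1 : Tendsto (fun n => -(scaleConst n * locConst n * z + (scaleConst n * z) ^ 2 / 2)) atTop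
      (𝓝 (-(1 * z + (0 * z) ^ 2 / 2))) :=
    ((tendsto_scaleConst_mul_locConst.mul_const z).add
      (((tendsto_scaleConst.mul_const z).pow 2).div_const 2)).neg
  have h := tendsto_mul_stdPDF_locConst.mul h1.rexp
  simp only [one_mul, zero_mul, ne_eq, OfNat.ofNat_ne_zero, not_false_eq_true, zero_pow, zero_div,
    add_zero] at h
  refine h.congr fun n => ?_
  rw [stdPDF_level]
  ring

/-- The integrable majorant on `(y, ∞)` for dominated convergence. Positive `z` use `a_n b_n ≥ 1/2`;
for `y < z < 0` the bound `a_n b_n ≤ 2` is absorbed by `exp(2|y|)`. -/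
lemma eventually_mul_stdPDF_level_le (y : ℝ) : ∀ᶠ n : ℕ in atTop, ∀ z > y,
    n * scaleConst n * gaussianPDFReal 0 1 (level n z) ≤
      2 * Real.exp (2 * |y|) * Real.exp (-(1 / 2) * z) := by
  filter_upwards [tendsto_mul_stdPDF_locConst.eventually_le_const (by norm_num : (1 : ℝ) < 2),
    tendsto_scaleConst_mul_locConst.eventually_le_const (by norm_num : (1 : ℝ) < 2),
    tendsto_scaleConst_mul_locConst.eventually_const_le (by norm_num : (1 / 2 : ℝ) < 1)]
    with n h1 h2 h3 z hz
  rw [stdPDF_level, ← mul_assoc, mul_assoc 2, ← Real.exp_add]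
  refine mul_le_mul h1 (Real.exp_le_exp.2 ?_) (Real.exp_pos _).le (by norm_num)
  have hsq : 0 ≤ (scaleConst n * z) ^ 2 / 2 := by positivity
  rcases le_or_gt 0 z with h0 | h0
  · nlinarith [abs_nonneg y]
  · have : |y| = -y := abs_of_neg (hz.trans h0)
    nlinarith

lemma tendsto_level_atTop (z : ℝ) : Tendsto (fun n => level n z) atTop atTop := by
  have h1 : Tendsto (fun n : ℕ => √(2 * Real.log n)) atTop atTop :=
    Real.tendsto_sqrt_atTop.comp (tendsto_log_natCast.const_mul_atTop (by norm_num))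
  have h := (tendsto_scaleConst_mul_level z).pos_mul_atTop one_pos h1
  refine h.congr' ?_
  filter_upwards [eventually_log_pos] with n hn
  have : 0 < √(2 * Real.log n) := by positivity
  rw [scaleConst]
  field_simp

lemma eventually_level_sq_le (z : ℝ) : ∀ᶠ n : ℕ in atTop, level n z ^ 2 ≤ 3 * Real.log n := by
  have h := (tendsto_scaleConst_mul_level z).pow 2
  filter_upwards [h.eventually_le_const (by norm_num : (1 : ℝ) ^ 2 < 3 / 2), eventually_log_pos]
    with n h1 hn
  have h2 : √(2 * Real.log n) ^ 2 = 2 * Real.log n := Real.sq_sqrt (by positivity)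
  rw [mul_pow, scaleConst, div_pow, h2, one_pow] at h1
  rw [div_mul_eq_mul_div, one_mul, div_le_iff₀ (by positivity)] at h1
  linarith

/-- The limit of `n a_n φ(u_n(z))` read backwards; the root of the logarithm is `1 / a_n` up to a
constant. -/
lemma exists_exp_neg_level_sq_le (z : ℝ) : ∃ K > 0, ∀ᶠ n : ℕ in atTop,
    Real.exp (-(level n z ^ 2 / 2)) ≤ K * √(Real.log n) / n := by
  refine ⟨2 * Real.exp (-z) * √(2 * Real.pi) * √2, by positivity, ?_⟩
  filter_upwards [(tendsto_mul_stdPDF_level z).eventually_le_const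
    (by linarith [Real.exp_pos (-z)] : Real.exp (-z) < 2 * Real.exp (-z)), eventually_log_pos,
    eventually_gt_atTop 0] with n h1 hn hn0
  have hn0' : (0 : ℝ) < n := by exact_mod_cast hn0
  rw [stdPDF_eq, scaleConst, Real.sqrt_mul (by norm_num : (0:ℝ) ≤ 2) (Real.log n)] at h1
  have hs : 0 < √(Real.log n) := Real.sqrt_pos.2 hn
  have e : -level n z ^ 2 / 2 = -(level n z ^ 2 / 2) := by ring
  rw [e] at h1
  rw [le_div_iff₀ hn0']
  have e2 : (n : ℝ) * (1 / (√2 * √(Real.log n))) *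
      ((√(2 * Real.pi))⁻¹ * Real.exp (-(level n z ^ 2 / 2)))
      = Real.exp (-(level n z ^ 2 / 2)) * n / (√2 * √(Real.log n) * √(2 * Real.pi)) := by
    field_simp
  rw [e2, div_le_iff₀ (by positivity)] at h1
  linarith

/-! ### Tail integrals -/

/-- Rescaled Gaussian integrals over a tail converge to exponential integrals. -/
lemma tendsto_mul_tail_integral {y : ℝ} {G : ℕ → ℝ → ℝ} {G₀ : ℝ → ℝ} {S : Set ℝ}
    (hS : S.Countable) (hm : ∀ n, Measurable (G n)) (h0 : ∀ n t, 0 ≤ G n t) (h1 : ∀ n t, G n t ≤ 1)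
    (hlim : ∀ z ∉ S, Tendsto (fun n => G n (level n z)) atTop (𝓝 (G₀ z))) :
    Tendsto (fun n : ℕ => n * ∫ t in Set.Ioi (level n y), G n t ∂(gaussianReal 0 1)) atTop
      (𝓝 (∫ z in Set.Ioi y, Real.exp (-z) * G₀ z)) := by
  -- Substitution `t = level n z`, with Jacobian `a_n`, which is positive once `ln n > 0`.
  have hcov : ∀ᶠ n : ℕ in atTop,
      n * ∫ t in Set.Ioi (level n y), G n t ∂(gaussianReal 0 1) =
        ∫ z in Set.Ioi y, (n * scaleConst n * gaussianPDFReal 0 1 (level n z)) * G n (level n z) := by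
    filter_upwards [eventually_log_pos] with n hn
    have ha := scaleConst_pos hn
    set F : ℝ → ℝ := fun t => (Set.Ioi (level n y)).indicator
      (fun t => gaussianPDFReal 0 1 t * G n t) t with hF
    have e1 : ∫ t in Set.Ioi (level n y), G n t ∂(gaussianReal 0 1) = ∫ t, F t := by
      rw [← integral_indicator measurableSet_Ioi,
        integral_gaussianReal_eq_integral_smul one_ne_zero]
      refine integral_congr_ae (Eventually.of_forall fun t => ?_)
      simp only [hF, Set.indicator, smul_eq_mul]
      split_ifs <;> simp
    have e2 : ∫ z, F (level n z) = (scaleConst n)⁻¹ * ∫ t, F t := by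
      have := Measure.integral_comp_mul_left (fun t => F (t + locConst n)) (scaleConst n)
      rw [integral_add_right_eq_self, abs_of_pos (inv_pos.2 ha), smul_eq_mul] at this
      exact this
    have e3 : ∫ t, F t = scaleConst n * ∫ z, F (level n z) := by
      rw [e2]; field_simp
    rw [e1, e3, ← integral_indicator measurableSet_Ioi, ← integral_const_mul, ← integral_const_mul]
    refine integral_congr_ae (Eventually.of_forall fun z => ?_)
    have hiff : level n z ∈ Set.Ioi (level n y) ↔ z ∈ Set.Ioi y := by
      simp only [Set.mem_Ioi, level]
      constructor
      · intro h; exact lt_of_mul_lt_mul_left (by linarith) ha.le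
      · intro h; have := mul_lt_mul_of_pos_left h ha; linarith
    simp only [hF]
    by_cases hz : z ∈ Set.Ioi y
    · rw [Set.indicator_of_mem hz, Set.indicator_of_mem (hiff.2 hz)]; ring
    · rw [Set.indicator_of_notMem hz, Set.indicator_of_notMem (fun h => hz (hiff.1 h))]; ring
  refine Tendsto.congr' (EventuallyEq.symm hcov) ?_
  have hlev : ∀ n, Measurable fun z => level n z := fun n => by unfold level; fun_prop
  refine tendsto_integral_filter_of_dominated_convergence
    (fun z => 2 * Real.exp (2 * |y|) * Real.exp (-(1 / 2) * z)) ?_ ?_ ?_ ?_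
  · refine Eventually.of_forall fun n => Measurable.aestronglyMeasurable ?_
    exact (((measurable_gaussianPDFReal 0 1).comp (hlev n)).const_mul _).mul ((hm n).comp (hlev n))
  · filter_upwards [eventually_mul_stdPDF_level_le y, eventually_log_pos] with n hn hl
    filter_upwards [ae_restrict_mem measurableSet_Ioi] with z hz
    have hpos : 0 ≤ n * scaleConst n * gaussianPDFReal 0 1 (level n z) :=
      mul_nonneg (mul_nonneg (Nat.cast_nonneg n) (scaleConst_pos hl).le)
        (gaussianPDFReal_nonneg _ _ _)
    rw [Real.norm_eq_abs, abs_mul, abs_of_nonneg hpos, abs_of_nonneg (h0 _ _)]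
    exact (mul_le_of_le_one_right hpos (h1 _ _)).trans (hn z hz)
  · exact (exp_neg_integrableOn_Ioi y (by norm_num)).const_mul _
  · have hae : ∀ᵐ z ∂(volume.restrict (Set.Ioi y)), z ∉ S :=
      ae_restrict_of_ae (hS.ae_notMem volume)
    filter_upwards [hae] with z hz
    exact (tendsto_mul_stdPDF_level z).mul (hlim z hz)

lemma tendsto_mul_tail (x : ℝ) :
    Tendsto (fun n : ℕ => n * (gaussianReal 0 1).real (Set.Ioi (level n x))) atTop
      (𝓝 (Real.exp (-x))) := by
  have h := tendsto_mul_tail_integral (y := x) (G := fun _ _ => 1) (G₀ := fun _ => 1)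
    Set.countable_empty (fun _ => measurable_const) (fun _ _ => zero_le_one) (fun _ _ => le_rfl)
    (fun _ _ => tendsto_const_nhds)
  simpa only [mul_one, integral_exp_neg_Ioi, setIntegral_const, smul_eq_mul] using h

/-! ### The Hüsler–Reiss limit -/

/-- The exponent `-log H_lam` of the Hüsler–Reiss distribution function. -/
def hrExponent (lam : ℝ≥0∞) (x y : ℝ) : ℝ :=
  if lam = 0 then max (Real.exp (-x)) (Real.exp (-y))
  else if lam = ⊤ then Real.exp (-x) + Real.exp (-y)
  else stdNormalCDF (lam.toReal + (x - y) / (2 * lam.toReal)) * Real.exp (-y)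
    + stdNormalCDF (lam.toReal + (y - x) / (2 * lam.toReal)) * Real.exp (-x)

lemma hrCDF_eq_exp (lam : ℝ≥0∞) (x y : ℝ) : hrCDF lam x y = Real.exp (-hrExponent lam x y) := by
  unfold hrCDF hrExponent gumbel
  split_ifs
  · rw [← Real.exp_monotone.map_min, ← min_neg_neg]
  · rw [← Real.exp_add]; congr 1; ring
  · congr 1; ring

/-- The conditional limit of the first coordinate given the rescaled second one. -/
def condLimit (lam : ℝ≥0∞) (x z : ℝ) : ℝ :=
  if lam = 0 then (Set.Iio x).indicator (fun _ => 1) z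
  else if lam = ⊤ then 1
  else stdNormalCDF (lam.toReal + (x - z) / (2 * lam.toReal))

/-- The integral is the limiting intensity of points exceeding in the second coordinate only; adding
the tail `exp(-x)` of the first coordinate yields the full exponent. -/
lemma integral_condLimit (lam : ℝ≥0∞) (x y : ℝ) :
    ∫ z in Set.Ioi y, Real.exp (-z) * condLimit lam x z = hrExponent lam x y - Real.exp (-x) := by
  have hexp : ∀ c : ℝ, IntegrableOn (fun z : ℝ => Real.exp (-z)) (Set.Ioi c) := fun c => by
    simpa using exp_neg_integrableOn_Ioi c one_pos
  unfold condLimit hrExponent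
  by_cases h0 : lam = 0
  · simp only [if_pos h0]
    have e : ∀ z, Real.exp (-z) * (Set.Iio x).indicator (fun _ => (1 : ℝ)) z
        = (Set.Iio x).indicator (fun z => Real.exp (-z)) z := fun z => by
      simp only [Set.indicator]; split_ifs <;> simp
    simp_rw [e]
    rw [setIntegral_indicator measurableSet_Iio, Set.Ioi_inter_Iio]
    rcases le_or_gt x y with hxy | hxy
    · rw [Set.Ioo_eq_empty (not_lt.2 hxy), max_eq_left (Real.exp_le_exp.2 (by linarith))]
      simp
    · rw [max_eq_right (Real.exp_le_exp.2 (by linarith)), ← integral_Ioc_eq_integral_Ioo,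
        ← intervalIntegral.integral_of_le hxy.le,
        ← intervalIntegral.integral_Ioi_sub_Ioi (hexp y) hxy.le, integral_exp_neg_Ioi,
        integral_exp_neg_Ioi]
  by_cases ht : lam = ⊤
  · simp only [if_neg h0, if_pos ht, mul_one, integral_exp_neg_Ioi]
    ring
  simp only [if_neg h0, if_neg ht]
  set l := lam.toReal with hl
  have hl0 : 0 < l := ENNReal.toReal_pos h0 ht
  -- An explicit antiderivative. The density terms in its derivative cancel because `e^{-z} φ(l + (x
  -- - z)/(2l)) = e^{-x} φ(l + (z - x)/(2l))`.
  set F : ℝ → ℝ := fun z => -(Real.exp (-z) * stdNormalCDF (l + (x - z) / (2 * l))) -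
    Real.exp (-x) * stdNormalCDF (l + (z - x) / (2 * l)) with hF
  have hd : ∀ z, HasDerivAt F (Real.exp (-z) * stdNormalCDF (l + (x - z) / (2 * l))) z := by
    intro z
    have d1 : HasDerivAt (fun z : ℝ => Real.exp (-z)) (-Real.exp (-z)) z := by
      simpa using (hasDerivAt_neg z).exp
    have d2 : HasDerivAt (fun z : ℝ => l + (x - z) / (2 * l)) (-1 / (2 * l)) z := by
      simpa using (((hasDerivAt_id z).const_sub x).div_const (2 * l)).const_add l
    have d3 : HasDerivAt (fun z : ℝ => l + (z - x) / (2 * l)) (1 / (2 * l)) z := by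
      simpa using (((hasDerivAt_id z).sub_const x).div_const (2 * l)).const_add l
    have d4 := (d1.mul ((hasDerivAt_stdNormalCDF _).comp z d2)).neg.sub
      (((hasDerivAt_stdNormalCDF _).comp z d3).const_mul (Real.exp (-x)))
    refine d4.congr_deriv ?_
    have key : Real.exp (-z) * gaussianPDFReal 0 1 (l + (x - z) / (2 * l))
        = Real.exp (-x) * gaussianPDFReal 0 1 (l + (z - x) / (2 * l)) := by
      rw [stdPDF_eq, stdPDF_eq, mul_left_comm, mul_left_comm (Real.exp (-x)), ← Real.exp_add,
        ← Real.exp_add]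
      congr 2
      field_simp
      ring
    simp only [Function.comp]
    have e : Real.exp (-z) * (gaussianPDFReal 0 1 (l + (x - z) / (2 * l)) * (-1 / (2 * l)))
        = -(Real.exp (-x) * (gaussianPDFReal 0 1 (l + (z - x) / (2 * l)) * (1 / (2 * l)))) := by
      calc _ = -(Real.exp (-z) * gaussianPDFReal 0 1 (l + (x - z) / (2 * l)) * (1 / (2 * l))) := by
            ring
        _ = _ := by rw [key]; ring
    rw [e]
    ring
  have hlim : Tendsto F atTop (𝓝 (-Real.exp (-x))) := by
    have t1 : Tendsto (fun z : ℝ => Real.exp (-z)) atTop (𝓝 0) := Real.tendsto_exp_neg_atTop_nhds_zero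
    have t2 : Tendsto (fun z : ℝ => Real.exp (-z) * stdNormalCDF (l + (x - z) / (2 * l))) atTop
        (𝓝 0) := by
      refine squeeze_zero (fun z => mul_nonneg (Real.exp_pos _).le (stdNormalCDF_nonneg _))
        (fun z => mul_le_of_le_one_right (Real.exp_pos _).le (stdNormalCDF_le_one _)) t1
    have t3 : Tendsto (fun z : ℝ => stdNormalCDF (l + (z - x) / (2 * l))) atTop (𝓝 1) := by
      refine (tendsto_cdf_atTop (gaussianReal 0 1)).comp ?_
      refine tendsto_atTop_add_const_left _ _ ?_
      exact (tendsto_atTop_add_const_right _ (-x) tendsto_id).atTop_div_const (by positivity)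
    simpa using t2.neg.sub (t3.const_mul (Real.exp (-x)))
  rw [integral_Ioi_of_hasDerivAt_of_nonneg (hd y).continuousAt.continuousWithinAt
    (fun z _ => hd z) (fun z _ => mul_nonneg (Real.exp_pos _).le (stdNormalCDF_nonneg _)) hlim]
  simp only [hF]
  ring

lemma measureReal_bivGaussian_eq_integral (r u v : ℝ) :
    (bivGaussian r).real {p | p.1 ≤ u ∧ v < p.2} =
      ∫ t in Set.Ioi v, (gaussianReal 0 1).real {w | r * t + √(1 - r ^ 2) * w ≤ u}
        ∂(gaussianReal 0 1) := by
  have hms : MeasurableSet {p : ℝ × ℝ | p.1 ≤ u ∧ v < p.2} :=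
    (measurableSet_le measurable_fst measurable_const).inter
      (measurableSet_lt measurable_const measurable_snd)
  have hf : Measurable fun p : ℝ × ℝ => (r * p.1 + √(1 - r ^ 2) * p.2, p.1) := by fun_prop
  rw [bivGaussian, map_measureReal_apply hf hms, Measure.real, Measure.prod_apply (hf hms),
    ← integral_toReal (measurable_measure_prodMk_left (hf hms)).aemeasurable
      (Eventually.of_forall fun t => measure_lt_top _ _), ← integral_indicator measurableSet_Ioi]
  refine integral_congr_ae (Eventually.of_forall fun t => ?_)
  by_cases ht : v < t
  · simp only [Set.indicator_of_mem (Set.mem_Ioi.2 ht), Measure.real]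
    congr 2
    ext w
    simp [ht]
  · simp only [Set.indicator_of_notMem (by simpa using ht : t ∉ Set.Ioi v)]
    have : (Prod.mk t ⁻¹' ((fun p : ℝ × ℝ => (r * p.1 + √(1 - r ^ 2) * p.2, p.1)) ⁻¹'
        {p | p.1 ≤ u ∧ v < p.2})) = ∅ := by
      ext w
      simp [ht]
    rw [this]
    simp

/-- Stated without dividing by `s n`, which vanishes when the correlation is `1` or `-1`. -/
lemma tendsto_measure_halfline_one {s d : ℕ → ℝ} (hs : ∀ᶠ n in atTop, 0 ≤ s n)
    (h : ∀ K, ∀ᶠ n in atTop, K * s n ≤ d n) :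
    Tendsto (fun n => (gaussianReal 0 1).real {w | s n * w ≤ d n}) atTop (𝓝 1) := by
  rw [Metric.tendsto_atTop]
  intro ε hε
  have hK := (tendsto_cdf_atTop (gaussianReal 0 1)).eventually_const_lt
    (by linarith : 1 - ε < 1)
  obtain ⟨K, hK⟩ := hK.exists
  obtain ⟨N, hN⟩ := eventually_atTop.1 (hs.and (h K))
  refine ⟨N, fun n hn => ?_⟩
  obtain ⟨h1, h2⟩ := hN n hn
  rw [cdf_eq_real] at hK
  have hmono : (gaussianReal 0 1).real (Set.Iic K) ≤ (gaussianReal 0 1).real {w | s n * w ≤ d n} :=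
    measureReal_mono fun w hw => by
      have := mul_le_mul_of_nonneg_left (Set.mem_Iic.1 hw) h1
      show s n * w ≤ d n
      linarith
  have hle : (gaussianReal 0 1).real {w | s n * w ≤ d n} ≤ 1 := measureReal_le_one
  rw [Real.dist_eq, abs_sub_lt_iff]
  constructor <;> linarith

lemma tendsto_measure_halfline_zero {s d : ℕ → ℝ} (hs : ∀ᶠ n in atTop, 0 ≤ s n)
    (h : ∀ K, ∀ᶠ n in atTop, d n + K * s n < 0) :
    Tendsto (fun n => (gaussianReal 0 1).real {w | s n * w ≤ d n}) atTop (𝓝 0) := by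
  rw [Metric.tendsto_atTop]
  intro ε hε
  have hK := (tendsto_cdf_atBot (gaussianReal 0 1)).eventually_lt_const hε
  obtain ⟨K, hK⟩ := hK.exists
  obtain ⟨N, hN⟩ := eventually_atTop.1 (hs.and (h (-K)))
  refine ⟨N, fun n hn => ?_⟩
  obtain ⟨h1, h2⟩ := hN n hn
  rw [cdf_eq_real] at hK
  have hmono : (gaussianReal 0 1).real {w | s n * w ≤ d n} ≤ (gaussianReal 0 1).real (Set.Iic K) :=
    measureReal_mono fun w hw => by
      have hw' : s n * w ≤ d n := hw
      rw [Set.mem_Iic]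
      by_contra hcon
      have := mul_le_mul_of_nonneg_left (not_le.1 hcon).le h1
      linarith
  have hle : 0 ≤ (gaussianReal 0 1).real {w | s n * w ≤ d n} := measureReal_nonneg
  rw [Real.dist_eq, abs_sub_lt_iff]
  constructor <;> linarith

lemma tendsto_measure_halfline_cdf {s d : ℕ → ℝ} {A : ℝ} (hs : ∀ᶠ n in atTop, 0 < s n)
    (h : Tendsto (fun n => d n / s n) atTop (𝓝 A)) :
    Tendsto (fun n => (gaussianReal 0 1).real {w | s n * w ≤ d n}) atTop (𝓝 (stdNormalCDF A)) := by
  refine ((continuous_stdNormalCDF.tendsto A).comp h).congr' ?_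
  filter_upwards [hs] with n hn
  simp only [Function.comp, stdNormalCDF, cdf_eq_real]
  congr 1
  ext w
  show w ≤ d n / s n ↔ s n * w ≤ d n
  rw [le_div_iff₀ hn, mul_comm]

/-- The conditional probabilities converge. -/
lemma tendsto_condProb {ρ : ℕ → ℝ} {lam : ℝ≥0∞} (hρ : ∀ᶠ n in atTop, |ρ n| ≤ 1)
    (hlam : Tendsto (fun n : ℕ => ENNReal.ofReal ((1 - ρ n) * Real.log n)) atTop (𝓝 (lam ^ 2)))
    {x z : ℝ} (hz : z ≠ x) :
    Tendsto (fun n : ℕ => (gaussianReal 0 1).real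
      {w | ρ n * level n z + √(1 - ρ n ^ 2) * w ≤ level n x}) atTop (𝓝 (condLimit lam x z)) := by
  -- Multiplying the conditional inequality by `√(2 ln n)` turns it into `s n * w ≤ d n`, where both
  -- sides depend on the correlation through `q n`, the quantity with limit `λ²`, and bounded
  -- factors.
  set q : ℕ → ℝ := fun n => (1 - ρ n) * Real.log n with hq
  set c : ℕ → ℝ := fun n => scaleConst n * level n z with hc
  have hc1 : Tendsto c atTop (𝓝 1) := tendsto_scaleConst_mul_level z
  set s : ℕ → ℝ := fun n => √(2 * q n * (1 + ρ n)) with hs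
  set d : ℕ → ℝ := fun n => (x - z) + 2 * q n * c n with hd
  have hs0 : ∀ n, 0 ≤ s n := fun n => Real.sqrt_nonneg _
  have hq0 : ∀ᶠ n in atTop, 0 ≤ q n := by
    filter_upwards [hρ, eventually_log_pos] with n h1 h2
    have := (abs_le.1 h1).2
    exact mul_nonneg (by linarith) h2.le
  have hset : ∀ᶠ n : ℕ in atTop, (gaussianReal 0 1).real {w | s n * w ≤ d n} =
      (gaussianReal 0 1).real {w | ρ n * level n z + √(1 - ρ n ^ 2) * w ≤ level n x} := by
    filter_upwards [hρ, eventually_log_pos] with n h1 h2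
    congr 1
    ext w
    have hL : 0 < √(2 * Real.log n) := by positivity
    have hL2 : √(2 * Real.log n) * √(2 * Real.log n) = 2 * Real.log n :=
      Real.mul_self_sqrt (by positivity)
    have hsn : s n = √(2 * Real.log n) * √(1 - ρ n ^ 2) := by
      show √(2 * ((1 - ρ n) * Real.log n) * (1 + ρ n)) = _
      rw [← Real.sqrt_mul (by positivity)]
      congr 1
      ring
    have hcL : √(2 * Real.log n) * c n = level n z := by
      simp only [hc, scaleConst]; field_simp
    have hdiff : √(2 * Real.log n) * (level n x - level n z) = x - z := by
      simp only [level, scaleConst]; field_simp; ring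
    have hdn : d n = √(2 * Real.log n) * (level n x - ρ n * level n z) := by
      have : √(2 * Real.log n) * (level n x - ρ n * level n z)
          = (x - z) + (1 - ρ n) * (√(2 * Real.log n) * level n z) := by
        rw [← hdiff]; ring
      rw [this, ← hcL, ← mul_assoc (√(2 * Real.log n)), hL2]
      simp only [hd, hq]
      ring
    show s n * w ≤ d n ↔ ρ n * level n z + √(1 - ρ n ^ 2) * w ≤ level n x
    rw [hsn, hdn, mul_assoc, mul_le_mul_iff_right₀ hL]
    constructor <;> intro h <;> linarith
  refine Tendsto.congr' hset ?_
  have hsle : ∀ᶠ n in atTop, s n ≤ 2 * √(q n) := by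
    filter_upwards [hρ, hq0] with n h1 h2
    have : 2 * √(q n) = √(4 * q n) := by
      rw [Real.sqrt_mul (by norm_num : (0 : ℝ) ≤ 4) (q n), show (4 : ℝ) = 2 ^ 2 by norm_num,
        Real.sqrt_sq (by norm_num)]
    rw [this]
    apply Real.sqrt_le_sqrt
    nlinarith [(abs_le.1 h1).2]
  unfold condLimit
  by_cases h0 : lam = 0
  · rw [if_pos h0]
    have hq1 : Tendsto q atTop (𝓝 0) := by
      have h := (ENNReal.tendsto_toReal (by simp [h0])).comp hlam
      rw [h0] at h
      simp only [ne_eq, OfNat.ofNat_ne_zero, not_false_eq_true, zero_pow, ENNReal.toReal_zero] at h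
      refine h.congr' ?_
      filter_upwards [hq0] with n hn
      exact ENNReal.toReal_ofReal hn
    have hs1 : Tendsto s atTop (𝓝 0) := by
      have h2 : Tendsto (fun n => 2 * √(q n)) atTop (𝓝 0) := by
        simpa using (((Real.continuous_sqrt.tendsto 0).comp hq1).const_mul 2)
      exact squeeze_zero' (Eventually.of_forall hs0) hsle h2
    have hd1 : Tendsto d atTop (𝓝 (x - z)) := by
      simpa using ((hq1.const_mul 2).mul hc1).const_add (x - z)
    -- For `λ = 0` the noise `s` vanishes and the sign of `x - z` decides; this is the only case
    -- needing `z ≠ x`.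
    rcases lt_or_gt_of_ne hz with h | h
    · rw [Set.indicator_of_mem (by exact h)]
      refine tendsto_measure_halfline_one (Eventually.of_forall hs0) fun K => ?_
      have : Tendsto (fun n => d n - K * s n) atTop (𝓝 (x - z)) := by
        simpa using hd1.sub (hs1.const_mul K)
      filter_upwards [this.eventually_const_lt (sub_pos.2 h)] with n hn
      linarith
    · rw [Set.indicator_of_notMem (by simpa using h.le)]
      refine tendsto_measure_halfline_zero (Eventually.of_forall hs0) fun K => ?_
      have : Tendsto (fun n => d n + K * s n) atTop (𝓝 (x - z)) := by
        simpa using hd1.add (hs1.const_mul K)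
      exact this.eventually_lt_const (sub_neg.2 h)
  by_cases ht : lam = ⊤
  · rw [if_neg h0, if_pos ht]
    have hq1 : Tendsto q atTop atTop := by
      rw [ht, ENNReal.top_pow two_ne_zero, ENNReal.tendsto_ofReal_nhds_top] at hlam
      exact hlam
    -- For `λ = ∞` the threshold eventually satisfies `d ≥ x - z + q`, while `s ≤ 2 √q`. The lower
    -- bound on `q` below makes `q ≥ 2|K| √q + |x - z|`.
    refine tendsto_measure_halfline_one (Eventually.of_forall hs0) fun K => ?_
    filter_upwards [hsle, hq1.eventually_ge_atTop ((2 * |K| + |x - z| + 1) ^ 2),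
      hc1.eventually_const_le (by norm_num : (1 / 2 : ℝ) < 1)] with n h1 h2 h3
    have hB : 0 ≤ 2 * |K| + |x - z| + 1 := by positivity
    have hqn : 0 ≤ q n := (sq_nonneg _).trans h2
    have hsq : 2 * |K| + |x - z| + 1 ≤ √(q n) := Real.le_sqrt_of_sq_le h2
    have hsq2 : √(q n) * √(q n) = q n := Real.mul_self_sqrt hqn
    have h4 : K * s n ≤ |K| * (2 * √(q n)) :=
      (mul_le_mul_of_nonneg_right (le_abs_self K) (hs0 n)).trans
        (mul_le_mul_of_nonneg_left h1 (abs_nonneg K))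
    have h5 : q n ≤ 2 * q n * c n := by nlinarith
    have h6 : -|x - z| ≤ x - z := neg_abs_le _
    have h7 : |x - z| ≤ |x - z| * √(q n) := by
      refine le_mul_of_one_le_right (abs_nonneg _) ?_
      linarith [abs_nonneg K, abs_nonneg (x - z)]
    show K * s n ≤ (x - z) + 2 * q n * c n
    nlinarith [mul_le_mul_of_nonneg_right hsq (Real.sqrt_nonneg (q n)), Real.sqrt_nonneg (q n)]
  rw [if_neg h0, if_neg ht]
  set l := lam.toReal with hl
  have hl0 : 0 < l := ENNReal.toReal_pos h0 ht
  have hq1 : Tendsto q atTop (𝓝 (l ^ 2)) := by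
    have h := (ENNReal.tendsto_toReal (ENNReal.pow_ne_top ht)).comp hlam
    rw [ENNReal.toReal_pow] at h
    refine h.congr' ?_
    filter_upwards [hq0] with n hn
    exact ENNReal.toReal_ofReal hn
  have hρ1 : Tendsto ρ atTop (𝓝 1) := by
    have h := (hq1.div_atTop tendsto_log_natCast).const_sub 1
    rw [sub_zero] at h
    refine h.congr' ?_
    filter_upwards [eventually_log_pos] with n hn
    simp only [hq]
    field_simp
    ring
  have hs1 : Tendsto s atTop (𝓝 (2 * l)) := by
    have h := (Real.continuous_sqrt.tendsto _).comp ((hq1.const_mul 2).mul (hρ1.const_add 1))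
    have e : √(2 * l ^ 2 * (1 + 1)) = 2 * l := by
      rw [show 2 * l ^ 2 * (1 + 1) = (2 * l) ^ 2 by ring, Real.sqrt_sq (by positivity)]
    rw [e] at h
    exact h
  have hd1 : Tendsto d atTop (𝓝 ((x - z) + 2 * l ^ 2 * 1)) :=
    ((hq1.const_mul 2).mul hc1).const_add (x - z)
  have hratio := hd1.div hs1 (by positivity)
  have e : ((x - z) + 2 * l ^ 2 * 1) / (2 * l) = l + (x - z) / (2 * l) := by
    field_simp; ring
  rw [e] at hratio
  exact tendsto_measure_halfline_cdf (hs1.eventually_const_lt (by positivity : 0 < 2 * l)) hratio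

lemma isStdPair_bivGaussian {r : ℝ} (hr : r ^ 2 ≤ 1) :
    IsStdPair (bivGaussian r) Prod.fst Prod.snd r := by
  have h := IsStdPair.canonical hr
  have hf : Measurable fun p : ℝ × ℝ => (r * p.1 + √(1 - r ^ 2) * p.2, p.1) := by fun_prop
  refine ⟨?_, ?_, ?_, ?_, ?_, ?_⟩
  · have : IsGaussian (bivGaussian r) := h.gaussian.isGaussian_map
    exact IsGaussian.hasGaussianLaw_id (μ := bivGaussian r)
  · rw [bivGaussian, integral_map hf.aemeasurable measurable_fst.aestronglyMeasurable]
    exact h.mean_fst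
  · rw [bivGaussian, integral_map hf.aemeasurable measurable_snd.aestronglyMeasurable]
    exact h.mean_snd
  · rw [bivGaussian, variance_map measurable_fst.aemeasurable hf.aemeasurable]
    exact h.var_fst
  · rw [bivGaussian, variance_map measurable_snd.aemeasurable hf.aemeasurable]
    exact h.var_snd
  · rw [bivGaussian, covariance_map measurable_fst.aestronglyMeasurable
      measurable_snd.aestronglyMeasurable hf.aemeasurable]
    exact h.cov_eq

namespace IsStdPair

variable {Ω : Type*} [MeasurableSpace Ω] {P : Measure Ω} {U V : Ω → ℝ} {r : ℝ}

lemma map_fst (h : IsStdPair P U V r) : P.map U = gaussianReal 0 1 := by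
  rw [h.gaussian.fst.map_eq_gaussianReal, h.mean_fst, h.var_fst]; simp

lemma measureReal_gt (h : IsStdPair P U V r) (u : ℝ) :
    P.real {ω | u < U ω} = (gaussianReal 0 1).real (Set.Ioi u) := by
  rw [← h.map_fst, map_measureReal_apply_of_aemeasurable h.gaussian.fst.aemeasurable measurableSet_Ioi]
  rfl

lemma ae_ne (h : IsStdPair P U V r) (u : ℝ) : ∀ᵐ ω ∂P, U ω ≠ u := by
  have := nullSingletonClass_gaussianReal (μ := 0) (v := 1) one_ne_zero
  have h1 : (P.map U) {u} = 0 := by rw [h.map_fst]; exact measure_singleton u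
  rw [Measure.map_apply_of_aemeasurable h.gaussian.fst.aemeasurable (measurableSet_singleton u)] at h1
  rw [ae_iff]
  simp only [ne_eq, not_not]
  exact h1

lemma measureReal_or (h : IsStdPair P U V r) (u v : ℝ) :
    P.real {ω | u < U ω ∨ v < V ω} = (bivGaussian r).real {p | u < p.1 ∨ v < p.2} := by
  rw [← h.map_eq_bivGaussian, map_measureReal_apply_of_aemeasurable h.gaussian.aemeasurable]
  · rfl
  · exact (measurableSet_lt measurable_const measurable_fst).union
      (measurableSet_lt measurable_const measurable_snd)

end IsStdPair

lemma abs_le_one_iff_sq {r : ℝ} (h : |r| ≤ 1) : r ^ 2 ≤ 1 := (sq_le_one_iff_abs_le_one r).2 h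

/-- The rescaled probability that one of the two coordinates exceeds its level. -/
lemma tendsto_mul_bivGaussian_or {ρ : ℕ → ℝ} {lam : ℝ≥0∞} (hρ : ∀ᶠ n in atTop, |ρ n| ≤ 1)
    (hlam : Tendsto (fun n : ℕ => ENNReal.ofReal ((1 - ρ n) * Real.log n)) atTop (𝓝 (lam ^ 2)))
    (x y : ℝ) :
    Tendsto (fun n : ℕ => n * (bivGaussian (ρ n)).real {p | level n x < p.1 ∨ level n y < p.2})
      atTop (𝓝 (hrExponent lam x y)) := by
  have hm : ∀ n, Measurable fun t : ℝ => (gaussianReal 0 1).real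
      {w | ρ n * t + √(1 - ρ n ^ 2) * w ≤ level n x} := fun n => by
    have hs : MeasurableSet {p : ℝ × ℝ | ρ n * p.1 + √(1 - ρ n ^ 2) * p.2 ≤ level n x} :=
      measurableSet_le (by fun_prop) measurable_const
    exact (measurable_measure_prodMk_left hs).ennreal_toReal
  have h2 := tendsto_mul_tail_integral (y := y) (S := {x})
    (G := fun n t => (gaussianReal 0 1).real {w | ρ n * t + √(1 - ρ n ^ 2) * w ≤ level n x})
    (G₀ := condLimit lam x) (Set.countable_singleton x) hm (fun _ _ => measureReal_nonneg)
    (fun _ _ => measureReal_le_one) (fun z hz => tendsto_condProb hρ hlam hz)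
  rw [integral_condLimit] at h2
  -- The union splits disjointly into an exceedance of the first coordinate and an exceedance of the
  -- second alone.
  have h3 := (tendsto_mul_tail x).add h2
  rw [add_sub_cancel] at h3
  refine h3.congr' ?_
  filter_upwards [hρ] with n hn
  have hp := isStdPair_bivGaussian (abs_le_one_iff_sq hn)
  rw [← measureReal_bivGaussian_eq_integral, ← hp.measureReal_gt, ← mul_add,
    ← measureReal_union]
  · congr 2
    ext p
    by_cases h : level n x < p.1
    · simp [h]
    · simp [h, not_lt.1 h]
  · rw [Set.disjoint_left]
    intro p h1 h2
    exact absurd h2.1 (not_le.2 h1)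
  · exact (measurableSet_le measurable_fst measurable_const).inter
      (measurableSet_lt measurable_const measurable_snd)

lemma measureReal_and {Ω : Type*} [MeasurableSpace Ω] {P : Measure Ω} [IsFiniteMeasure P]
    {A B : Set Ω} (hB : MeasurableSet B) :
    P.real (A ∩ B) = P.real A + P.real B - P.real (A ∪ B) := by
  have := measureReal_union_add_inter (μ := P) (s := A) hB
  linarith

/-- The rescaled probability that the vector leaves the box. -/
lemma tendsto_mul_bivGaussian_box {ρ : ℕ → ℝ} {lam : ℝ≥0∞} (hρ : ∀ᶠ n in atTop, |ρ n| ≤ 1)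
    (hlam : Tendsto (fun n : ℕ => ENNReal.ofReal ((1 - ρ n) * Real.log n)) atTop (𝓝 (lam ^ 2)))
    (hlam' : Tendsto (fun n : ℕ => (1 + ρ n) * Real.log n) atTop atTop)
    (x₁ x₂ y₁ y₂ : ℝ) :
    Tendsto (fun n : ℕ => n * (1 - (bivGaussian (ρ n)).real
        (Set.Ioc (-level n y₁) (level n x₁) ×ˢ Set.Ioc (-level n y₂) (level n x₂))))
      atTop (𝓝 (hrExponent lam x₁ x₂ + hrExponent lam y₁ y₂)) := by
  -- Changing the sign of one coordinate gives correlation `-ρ`, and `(1 + ρ) ln n → ∞` is then the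
  -- case `λ = ∞`: the flipped pair has asymptotically independent exceedances.
  have hneg : ∀ x y : ℝ, Tendsto (fun n : ℕ =>
      n * (bivGaussian (-ρ n)).real {p | level n x < p.1 ∨ level n y < p.2}) atTop
      (𝓝 (Real.exp (-x) + Real.exp (-y))) := fun x y => by
    have := tendsto_mul_bivGaussian_or (ρ := fun n => -ρ n) (lam := ⊤) (by simpa using hρ)
      (by
        rw [ENNReal.top_pow two_ne_zero, ENNReal.tendsto_ofReal_nhds_top]
        simpa using hlam') x y
    simpa [hrExponent] using this
  have hcross : ∀ x y : ℝ, Tendsto (fun n : ℕ =>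
      n * ((gaussianReal 0 1).real (Set.Ioi (level n x)) +
        (gaussianReal 0 1).real (Set.Ioi (level n y)) -
        (bivGaussian (-ρ n)).real {p | level n x < p.1 ∨ level n y < p.2})) atTop (𝓝 0) :=
    fun x y => by
      have := ((tendsto_mul_tail x).add (tendsto_mul_tail y)).sub (hneg x y)
      rw [sub_self] at this
      refine this.congr fun n => ?_
      ring
  have hmain := (tendsto_mul_bivGaussian_or hρ hlam x₁ x₂).add
    (tendsto_mul_bivGaussian_or hρ hlam y₁ y₂)
  -- Once the levels are nonnegative, no coordinate can be both too large and too small, so leaving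
  -- above and below involves different coordinates. That is a joint exceedance of a flipped pair,
  -- negligible by `hcross`.
  have hinter : Tendsto (fun n : ℕ => n * (bivGaussian (ρ n)).real
      ({p | level n x₁ < p.1 ∨ level n x₂ < p.2} ∩
        {p | level n y₁ < -p.1 ∨ level n y₂ < -p.2})) atTop (𝓝 0) := by
    have hsum := (hcross x₁ y₂).add (hcross x₂ y₁)
    rw [add_zero] at hsum
    refine squeeze_zero' (Eventually.of_forall fun n => by positivity) ?_ hsum
    filter_upwards [hρ, (tendsto_level_atTop x₁).eventually_ge_atTop 0,
      (tendsto_level_atTop x₂).eventually_ge_atTop 0,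
      (tendsto_level_atTop y₁).eventually_ge_atTop 0,
      (tendsto_level_atTop y₂).eventually_ge_atTop 0] with n hn k1 k2 k3 k4
    have hp := isStdPair_bivGaussian (abs_le_one_iff_sq hn)
    rw [← mul_add]
    refine mul_le_mul_of_nonneg_left ?_ (Nat.cast_nonneg n)
    have hsub : ({p : ℝ × ℝ | level n x₁ < p.1 ∨ level n x₂ < p.2} ∩
        {p | level n y₁ < -p.1 ∨ level n y₂ < -p.2}) ⊆
        ({p | level n x₁ < p.1} ∩ {p | level n y₂ < -p.2}) ∪
        ({p | level n x₂ < p.2} ∩ {p | level n y₁ < -p.1}) := by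
      rintro p ⟨h1 | h1, h2 | h2⟩
      · linarith
      · exact Or.inl ⟨h1, h2⟩
      · exact Or.inr ⟨h1, h2⟩
      · linarith
    refine (measureReal_mono hsub).trans ((measureReal_union_le _ _).trans (add_le_add ?_ ?_))
    · have hm : MeasurableSet {p : ℝ × ℝ | level n y₂ < -p.2} :=
        measurableSet_lt measurable_const measurable_snd.neg
      rw [measureReal_and hm,
        ← hp.neg_right.measureReal_or, hp.measureReal_gt, hp.neg_right.swap.measureReal_gt]
      exact le_rfl
    · have hm : MeasurableSet {p : ℝ × ℝ | level n y₁ < -p.1} :=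
        measurableSet_lt measurable_const measurable_fst.neg
      rw [measureReal_and hm,
        ← hp.swap.neg_right.measureReal_or, hp.swap.measureReal_gt,
        hp.swap.neg_right.swap.measureReal_gt]
      exact le_rfl
  have hfinal := hmain.sub hinter
  rw [sub_zero] at hfinal
  refine hfinal.congr' ?_
  filter_upwards [hρ] with n hn
  have hp := isStdPair_bivGaussian (abs_le_one_iff_sq hn)
  have hbox : MeasurableSet (Set.Ioc (-level n y₁) (level n x₁) ×ˢ
      Set.Ioc (-level n y₂) (level n x₂)) := measurableSet_Ioc.prod measurableSet_Ioc
  rw [← hp.neg_neg.measureReal_or (level n y₁) (level n y₂), ← mul_add, ← mul_sub]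
  congr 1
  rw [← probReal_compl_eq_one_sub hbox]
  have hA : MeasurableSet {p : ℝ × ℝ | level n y₁ < -p.1 ∨ level n y₂ < -p.2} :=
    (measurableSet_lt measurable_const measurable_fst.neg).union
      (measurableSet_lt measurable_const measurable_snd.neg)
  have hu := measureReal_union_add_inter (μ := bivGaussian (ρ n))
    (s := {p : ℝ × ℝ | level n x₁ < p.1 ∨ level n x₂ < p.2}) hA
  have hc : (bivGaussian (ρ n)).real (Set.Ioc (-level n y₁) (level n x₁) ×ˢ
      Set.Ioc (-level n y₂) (level n x₂))ᶜ = (bivGaussian (ρ n)).real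
      ({p : ℝ × ℝ | level n x₁ < p.1 ∨ level n x₂ < p.2} ∪
        {p | level n y₁ < -p.1 ∨ level n y₂ < -p.2}) := by
    -- The interval is open on the left whereas the lower exceedance is strict, so the two sets
    -- differ only on null boundary lines.
    refine measureReal_congr ?_
    filter_upwards [hp.ae_ne (-level n y₁), hp.swap.ae_ne (-level n y₂)] with p h1 h2
    refine propext ?_
    show ¬ (p ∈ _) ↔ ((level n x₁ < p.1 ∨ level n x₂ < p.2) ∨
      (level n y₁ < -p.1 ∨ level n y₂ < -p.2))
    simp only [Set.mem_prod, Set.mem_Ioc]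
    have g1 : level n y₁ < -p.1 ↔ ¬ (-level n y₁ < p.1) := by
      rw [not_lt]
      exact ⟨fun h => by linarith, fun h => by have := lt_of_le_of_ne h h1; linarith⟩
    have g2 : level n y₂ < -p.2 ↔ ¬ (-level n y₂ < p.2) := by
      rw [not_lt]
      exact ⟨fun h => by linarith, fun h => by have := lt_of_le_of_ne h h2; linarith⟩
    have g3 : level n x₁ < p.1 ↔ ¬ (p.1 ≤ level n x₁) := not_le.symm
    have g4 : level n x₂ < p.2 ↔ ¬ (p.2 ≤ level n x₂) := not_le.symm
    rw [g1, g2, g3, g4]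
    tauto
  rw [hc]
  linarith

/-- The limit of the probability that all of `n` independent vectors lie in the quadrant. -/
lemma tendsto_bivGaussian_quadrant_pow {ρ : ℕ → ℝ} {lam : ℝ≥0∞} (hρ : ∀ᶠ n in atTop, |ρ n| ≤ 1)
    (hlam : Tendsto (fun n : ℕ => ENNReal.ofReal ((1 - ρ n) * Real.log n)) atTop (𝓝 (lam ^ 2)))
    (x y : ℝ) :
    Tendsto (fun n : ℕ => (bivGaussian (ρ n)).real
      (Set.Iic (level n x) ×ˢ Set.Iic (level n y)) ^ n) atTop (𝓝 (hrCDF lam x y)) := by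
  rw [hrCDF_eq_exp]
  have h := Real.tendsto_one_add_pow_exp_of_tendsto (g := fun n =>
    -(bivGaussian (ρ n)).real {p | level n x < p.1 ∨ level n y < p.2})
    (t := -hrExponent lam x y) (by
      have := (tendsto_mul_bivGaussian_or hρ hlam x y).neg
      refine this.congr fun n => ?_
      ring)
  refine h.congr fun n => ?_
  congr 1
  have hm : MeasurableSet (Set.Iic (level n x) ×ˢ Set.Iic (level n y)) :=
    measurableSet_Iic.prod measurableSet_Iic
  have hc := probReal_compl_eq_one_sub (μ := bivGaussian (ρ n)) hm
  have e : (Set.Iic (level n x) ×ˢ Set.Iic (level n y))ᶜ =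
      {p : ℝ × ℝ | level n x < p.1 ∨ level n y < p.2} := by
    ext p
    show ¬ (p ∈ _) ↔ (level n x < p.1 ∨ level n y < p.2)
    simp only [Set.mem_prod, Set.mem_Iic]
    rw [not_and_or, not_le, not_le]
  rw [e] at hc
  rw [hc]
  ring

/-- The limit of the probability that all of `n` independent vectors lie in the box. -/
lemma tendsto_bivGaussian_box_pow {ρ : ℕ → ℝ} {lam : ℝ≥0∞} (hρ : ∀ᶠ n in atTop, |ρ n| ≤ 1)
    (hlam : Tendsto (fun n : ℕ => ENNReal.ofReal ((1 - ρ n) * Real.log n)) atTop (𝓝 (lam ^ 2)))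
    (hlam' : Tendsto (fun n : ℕ => (1 + ρ n) * Real.log n) atTop atTop)
    (x₁ x₂ y₁ y₂ : ℝ) :
    Tendsto (fun n : ℕ => (bivGaussian (ρ n)).real
        (Set.Ioc (-level n y₁) (level n x₁) ×ˢ Set.Ioc (-level n y₂) (level n x₂)) ^ n)
      atTop (𝓝 (hrCDF lam x₁ x₂ * hrCDF lam y₁ y₂)) := by
  rw [hrCDF_eq_exp, hrCDF_eq_exp, ← Real.exp_add, ← neg_add]
  have h := Real.tendsto_one_add_pow_exp_of_tendsto (g := fun n =>
    -(1 - (bivGaussian (ρ n)).real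
        (Set.Ioc (-level n y₁) (level n x₁) ×ˢ Set.Ioc (-level n y₂) (level n x₂))))
    (t := -(hrExponent lam x₁ x₂ + hrExponent lam y₁ y₂)) (by
      have := (tendsto_mul_bivGaussian_box hρ hlam hlam' x₁ x₂ y₁ y₂).neg
      refine this.congr fun n => ?_
      ring)
  refine h.congr fun n => ?_
  congr 1
  ring

/-! ### Estimates of the comparison sums -/

lemma card_filter_gap_lt_le {n : ℕ} (k J : ℕ) :
    (Finset.univ.filter fun l : Fin n => gap k l < J).card ≤ 2 * J := by
  have h : ((Finset.univ.filter fun l : Fin n => gap k l < J).map Fin.valEmbedding) ⊆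
      Finset.Ico (k + 1 - J) (k + J) := by
    intro l hl
    simp only [Finset.mem_map, Finset.mem_filter, Finset.mem_univ, true_and] at hl
    obtain ⟨l', h1, rfl⟩ := hl
    simp only [gap, Fin.valEmbedding_apply, Finset.mem_Ico] at h1 ⊢
    omega
  have := Finset.card_le_card h
  rw [Finset.card_map, Nat.card_Ico] at this
  omega

lemma mul_exp_neg_le_near {r R A : ℝ} (hR : |r| ≤ R) (hR1 : R ≤ 1) (hA : 0 ≤ A) :
    |r| * Real.exp (-(A / (2 * (1 + |r|)))) ≤ Real.exp (-(A / (2 * (1 + R)))) := by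
  have h1 : Real.exp (-(A / (2 * (1 + |r|)))) ≤ Real.exp (-(A / (2 * (1 + R)))) := by
    have := abs_nonneg r
    gcongr
  calc _ ≤ 1 * Real.exp (-(A / (2 * (1 + R)))) :=
        mul_le_mul (hR.trans hR1) h1 (Real.exp_pos _).le zero_le_one
    _ = _ := one_mul _

/-- Since `1 / (1 + |r|) ≥ 1 - |r|`, the correlation costs a factor at most `exp(q A / 2)`, which is
bounded as long as `q ln n` is, because `A` will be of order `ln n`. -/
lemma mul_exp_neg_le_far {r q A : ℝ} (hq : |r| ≤ q) (hA : 0 ≤ A) :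
    |r| * Real.exp (-(A / (2 * (1 + |r|)))) ≤ q * (Real.exp (q * A / 2) * Real.exp (-(A / 2))) := by
  have hr := abs_nonneg r
  refine mul_le_mul hq ?_ (Real.exp_pos _).le (hr.trans hq)
  rw [← Real.exp_add]
  refine Real.exp_le_exp.2 ?_
  have h1 : A / 2 - |r| * A / 2 ≤ A / (2 * (1 + |r|)) := by
    rw [le_div_iff₀ (by positivity)]
    nlinarith [mul_nonneg hA (sq_nonneg |r|)]
  nlinarith [mul_le_mul_of_nonneg_right hq hA]

/-- Each of the `2m` first indices has at most `2J` near positions with two components each, which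
gives `8mJ`; all `4mn` pairs are charged the far bound. -/
lemma sum_mul_exp_neg_le {m n J : ℕ} {R q A : ℝ} (hR1 : R ≤ 1) (hq : 0 ≤ q) (hA : 0 ≤ A)
    {r : Fin m × Fin 2 → Fin n × Fin 2 → ℝ} (hr : ∀ s t, |r s t| ≤ R)
    (hrq : ∀ s t, J ≤ gap s.1 t.1 → |r s t| ≤ q) :
    ∑ s, ∑ t, |r s t| * Real.exp (-(A / (2 * (1 + |r s t|)))) ≤
      8 * (m * J * Real.exp (-(A / (2 * (1 + R))))) +
        4 * (m * n * (q * (Real.exp (q * A / 2) * Real.exp (-(A / 2))))) := by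
  set a := Real.exp (-(A / (2 * (1 + R)))) with ha
  set b := q * (Real.exp (q * A / 2) * Real.exp (-(A / 2))) with hb
  have ha0 : 0 < a := Real.exp_pos _
  have hb0 : 0 ≤ b := by positivity
  have hterm : ∀ s t, |r s t| * Real.exp (-(A / (2 * (1 + |r s t|)))) ≤
      (if gap s.1 t.1 < J then a else 0) + b := fun s t => by
    split_ifs with h
    · exact (mul_exp_neg_le_near (hr s t) hR1 hA).trans (by linarith)
    · rw [zero_add]
      exact mul_exp_neg_le_far (hrq s t (not_lt.1 h)) hA
  have hinner : ∀ s : Fin m × Fin 2, ∑ t : Fin n × Fin 2,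
      |r s t| * Real.exp (-(A / (2 * (1 + |r s t|)))) ≤ 4 * J * a + 2 * n * b := fun s => by
    refine (Finset.sum_le_sum fun t _ => hterm s t).trans ?_
    rw [Finset.sum_add_distrib, Fintype.sum_prod_type]
    refine add_le_add ?_ (le_of_eq ?_)
    · have e : ∀ l : Fin n, ∑ _i : Fin 2, (if gap s.1 l < J then a else 0) =
          2 * (if gap s.1 l < J then a else 0) := fun l => by
        rw [Finset.sum_const]; simp
      refine (Finset.sum_congr rfl fun l _ => e l).trans_le ?_
      rw [← Finset.mul_sum, ← Finset.sum_filter, Finset.sum_const, nsmul_eq_mul]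
      have h := card_filter_gap_lt_le (n := n) s.1 J
      have h' : (((Finset.univ.filter fun l : Fin n => gap s.1 l < J).card : ℕ) : ℝ) ≤ 2 * J := by
        exact_mod_cast h
      have := mul_le_mul_of_nonneg_right h' ha0.le
      linarith
    · simp only [Finset.sum_const, Finset.card_univ, Fintype.card_prod, Fintype.card_fin,
        nsmul_eq_mul]
      push_cast
      ring
  refine (Finset.sum_le_sum fun s _ => hinner s).trans (le_of_eq ?_)
  simp only [Finset.sum_const, Finset.card_univ, Fintype.card_prod, Fintype.card_fin, nsmul_eq_mul]
  push_cast
  ring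

lemma exists_exp_neg_level_sq_le_rpow (z : ℝ) {κ : ℝ} (hκ : 0 < κ) : ∃ K > 0, ∀ᶠ n : ℕ in atTop,
    Real.exp (-(level n z ^ 2 / 2)) ≤ K * (n : ℝ) ^ (κ - 1) := by
  obtain ⟨K, hK, h⟩ := exists_exp_neg_level_sq_le z
  refine ⟨K, hK, ?_⟩
  have hlog : ∀ᶠ n : ℕ in atTop, Real.log n ≤ (n : ℝ) ^ κ := by
    have h1 := (isLittleO_log_rpow_atTop hκ).bound one_pos
    filter_upwards [tendsto_natCast_atTop_atTop.eventually h1] with n hn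
    rw [one_mul, Real.norm_eq_abs, Real.norm_eq_abs,
      abs_of_nonneg (Real.rpow_nonneg (Nat.cast_nonneg n) _)] at hn
    exact (le_abs_self _).trans hn
  filter_upwards [h, hlog, tendsto_log_natCast.eventually_ge_atTop 1, eventually_gt_atTop 0]
    with n h1 h2 h3 h4
  have hn0 : (0 : ℝ) < n := by exact_mod_cast h4
  refine h1.trans ?_
  have hs : √(Real.log n) ≤ (n : ℝ) ^ κ := by
    refine le_trans ?_ h2
    rw [Real.sqrt_le_left (by linarith)]
    nlinarith
  rw [Real.rpow_sub_one hn0.ne', ← mul_div_assoc]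
  gcongr

/-- Exponent count: with `p = 1 / (1 + θ)` each row contributes its length to the power `-p`, up to
an arbitrarily small loss `κ p` for logarithms. As `p ≤ 1`, the factor `m · m^{(κ-1)p}` may be
replaced by the same expression in `n`, leaving `1 + β - 2p + 2κp`. The hypothesis on `β` says `G =
2p - 1 - β > 0`, and `κ = G / (4p)` spends half of `G`. -/
lemma exists_near_bound (z : ℝ) {θ β : ℝ} (hθ0 : 0 ≤ θ)
    (hβ : β < (1 - θ) / (1 + θ)) : ∃ η > (0 : ℝ), ∃ K > (0 : ℝ), ∃ N : ℕ, ∀ m n : ℕ, N ≤ m → m ≤ n →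
      m * (n : ℝ) ^ β * Real.exp (-((level m z ^ 2 + level n z ^ 2) / (2 * (1 + θ)))) ≤
        K * (n : ℝ) ^ (-η) := by
  set p := 1 / (1 + θ) with hp
  have hp0 : 0 < p := by positivity
  have hp1 : p ≤ 1 := by rw [hp, div_le_one (by positivity)]; linarith
  set G := (1 - θ) / (1 + θ) - β with hG
  have hG0 : 0 < G := by rw [hG]; linarith
  have hpG : 2 * p - 1 = G + β := by
    rw [hp, hG]; field_simp; ring
  set κ := G / (4 * p) with hκ
  have hκ0 : 0 < κ := by positivity
  have hκp : 2 * κ * p = G / 2 := by rw [hκ]; field_simp; ring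
  obtain ⟨K, hK, hE⟩ := exists_exp_neg_level_sq_le_rpow z hκ0
  obtain ⟨N, hN⟩ := eventually_atTop.1 (hE.and (eventually_gt_atTop 0))
  refine ⟨G / 2, by positivity, K ^ p * K ^ p, by positivity, N, fun m n hm hmn => ?_⟩
  obtain ⟨hEm, hm0⟩ := hN m hm
  obtain ⟨hEn, hn0⟩ := hN n (hm.trans hmn)
  have hm0' : (0 : ℝ) < m := by exact_mod_cast hm0
  have hn0' : (0 : ℝ) < n := by exact_mod_cast hn0
  have hmn' : (m : ℝ) ≤ n := by exact_mod_cast hmn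
  have split : Real.exp (-((level m z ^ 2 + level n z ^ 2) / (2 * (1 + θ)))) =
      Real.exp (-(level m z ^ 2 / 2)) ^ p * Real.exp (-(level n z ^ 2 / 2)) ^ p := by
    rw [← Real.exp_mul, ← Real.exp_mul, ← Real.exp_add]
    congr 1
    rw [hp]
    field_simp
    ring
  have pw : ∀ k : ℕ, 0 < (k : ℝ) → Real.exp (-(level k z ^ 2 / 2)) ≤ K * (k : ℝ) ^ (κ - 1) →
      Real.exp (-(level k z ^ 2 / 2)) ^ p ≤ K ^ p * (k : ℝ) ^ ((κ - 1) * p) := fun k hk h => by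
    rw [Real.rpow_mul hk.le, ← Real.mul_rpow hK.le (by positivity)]
    exact Real.rpow_le_rpow (Real.exp_pos _).le h hp0.le
  have hexp0 : 0 ≤ 1 + (κ - 1) * p := by nlinarith
  have hmm : (m : ℝ) * (m : ℝ) ^ ((κ - 1) * p) ≤ n * (n : ℝ) ^ ((κ - 1) * p) := by
    rw [← Real.rpow_one_add' hm0'.le (by nlinarith [mul_pos hκ0 hp0]),
      ← Real.rpow_one_add' hn0'.le (by nlinarith [mul_pos hκ0 hp0])]
    exact Real.rpow_le_rpow hm0'.le hmn' hexp0
  rw [split]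
  calc m * (n : ℝ) ^ β * (Real.exp (-(level m z ^ 2 / 2)) ^ p * Real.exp (-(level n z ^ 2 / 2)) ^ p)
      ≤ m * (n : ℝ) ^ β * ((K ^ p * (m : ℝ) ^ ((κ - 1) * p)) *
          (K ^ p * (n : ℝ) ^ ((κ - 1) * p))) := by
        gcongr
        · exact pw m hm0' hEm
        · exact pw n hn0' hEn
    _ = K ^ p * K ^ p * ((m * (m : ℝ) ^ ((κ - 1) * p)) * ((n : ℝ) ^ β * (n : ℝ) ^ ((κ - 1) * p))) := by
        ring
    _ ≤ K ^ p * K ^ p * ((n * (n : ℝ) ^ ((κ - 1) * p)) *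
          ((n : ℝ) ^ β * (n : ℝ) ^ ((κ - 1) * p))) := by
        gcongr
    _ = K ^ p * K ^ p * (n : ℝ) ^ (-(G / 2)) := by
        congr 1
        nth_rewrite 1 [← Real.rpow_one (n : ℝ)]
        rw [← Real.rpow_add hn0', ← Real.rpow_add hn0', ← Real.rpow_add hn0']
        congr 1
        nlinarith

/-- The two kernels are `O(√(ln m) / m)` and `O(√(ln n) / n)`, so `mn` pairs sum to `O(ln n)` times
`q`. The squared levels are at most `3 ln n`, so the correlation factor is at most `exp 3`. -/
lemma exists_far_bound (z : ℝ) : ∃ K > (0 : ℝ), ∃ N : ℕ, ∀ m n : ℕ, N ≤ m → m ≤ n →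
    ∀ q : ℝ, 0 ≤ q → q * Real.log n ≤ 1 →
      m * n * (q * (Real.exp (q * (level m z ^ 2 + level n z ^ 2) / 2) *
        Real.exp (-((level m z ^ 2 + level n z ^ 2) / 2)))) ≤ K * (q * Real.log n) := by
  obtain ⟨K, hK, hE⟩ := exists_exp_neg_level_sq_le z
  obtain ⟨N, hN⟩ := eventually_atTop.1 (((hE.and (eventually_gt_atTop 0)).and
    eventually_log_pos).and (eventually_level_sq_le z))
  refine ⟨Real.exp 3 * (K * K), by positivity, N, fun m n hm hmn q hq hq1 => ?_⟩
  obtain ⟨⟨⟨hEm, hm0⟩, hlm⟩, hsm⟩ := hN m hm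
  obtain ⟨⟨⟨hEn, hn0⟩, hln⟩, hsn⟩ := hN n (hm.trans hmn)
  have hm0' : (0 : ℝ) < m := by exact_mod_cast hm0
  have hn0' : (0 : ℝ) < n := by exact_mod_cast hn0
  have hlog : Real.log m ≤ Real.log n := Real.log_le_log hm0' (by exact_mod_cast hmn)
  have h1 : Real.exp (q * (level m z ^ 2 + level n z ^ 2) / 2) ≤ Real.exp 3 := by
    refine Real.exp_le_exp.2 ?_
    have : level m z ^ 2 + level n z ^ 2 ≤ 6 * Real.log n := by linarith
    nlinarith [mul_le_mul_of_nonneg_left this hq]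
  have h2 : Real.exp (-((level m z ^ 2 + level n z ^ 2) / 2)) =
      Real.exp (-(level m z ^ 2 / 2)) * Real.exp (-(level n z ^ 2 / 2)) := by
    rw [← Real.exp_add]; congr 1; ring
  have h3 : √(Real.log m) * √(Real.log n) ≤ Real.log n := by
    calc √(Real.log m) * √(Real.log n) ≤ √(Real.log n) * √(Real.log n) := by gcongr
      _ = _ := Real.mul_self_sqrt hln.le
  rw [h2]
  rw [le_div_iff₀ hm0'] at hEm
  rw [le_div_iff₀ hn0'] at hEn
  calc m * n * (q * (Real.exp (q * (level m z ^ 2 + level n z ^ 2) / 2) *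
        (Real.exp (-(level m z ^ 2 / 2)) * Real.exp (-(level n z ^ 2 / 2)))))
      = q * Real.exp (q * (level m z ^ 2 + level n z ^ 2) / 2) *
        ((Real.exp (-(level m z ^ 2 / 2)) * m) * (Real.exp (-(level n z ^ 2 / 2)) * n)) := by ring
    _ ≤ q * Real.exp 3 * ((K * √(Real.log m)) * (K * √(Real.log n))) := by
        gcongr
    _ = Real.exp 3 * (K * K) * (q * (√(Real.log m) * √(Real.log n))) := by ring
    _ ≤ _ := by gcongr

/-- The comparison sum between the rows `m ≤ n` under a decay condition on the correlations. -/
lemma exists_comparison_sum_bound (z : ℝ) {θ β : ℝ} (hθ0 : 0 ≤ θ) (hθ1 : θ < 1) (hβ0 : 0 < β)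
    (hβ : β < (1 - θ) / (1 + θ)) : ∃ η > (0 : ℝ), ∃ K > (0 : ℝ), ∃ N : ℕ, ∀ m n : ℕ, N ≤ m → m ≤ n →
      ∀ (r : Fin m × Fin 2 → Fin n × Fin 2 → ℝ) (q : ℝ), 0 ≤ q → q * Real.log n ≤ 1 →
      (∀ s t, |r s t| ≤ θ) → (∀ s t, powFloor β n ≤ gap s.1 t.1 → |r s t| ≤ q) →
      ∑ s, ∑ t, |r s t| *
        Real.exp (-((level m z ^ 2 + level n z ^ 2) / (2 * (1 + |r s t|)))) ≤
        K * ((n : ℝ) ^ (-η) + q * Real.log n) := by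
  obtain ⟨η, hη, K₁, hK₁, N₁, h₁⟩ := exists_near_bound z hθ0 hβ
  obtain ⟨K₂, hK₂, N₂, h₂⟩ := exists_far_bound z
  refine ⟨η, hη, 8 * K₁ + 4 * K₂, by positivity, max (max N₁ N₂) 1, fun m n hm hmn r q hq hq1 hr hrq => ?_⟩
  have hm1 : N₁ ≤ m := le_trans (le_trans (le_max_left _ _) (le_max_left _ _)) hm
  have hm2 : N₂ ≤ m := le_trans (le_trans (le_max_right _ _) (le_max_left _ _)) hm
  have hn1 : 1 ≤ n := le_trans (le_trans (le_max_right _ _) hm) hmn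
  have hlog : 0 ≤ Real.log n := Real.log_natCast_nonneg n
  refine (sum_mul_exp_neg_le hθ1.le hq (by positivity) hr hrq).trans ?_
  have hJ : (powFloor β n : ℝ) ≤ (n : ℝ) ^ β := Nat.floor_le (by positivity)
  have b1 : m * (powFloor β n : ℝ) *
      Real.exp (-((level m z ^ 2 + level n z ^ 2) / (2 * (1 + θ)))) ≤ K₁ * (n : ℝ) ^ (-η) := by
    refine le_trans ?_ (h₁ m n hm1 hmn)
    gcongr
  have b2 := h₂ m n hm2 hmn q hq hq1
  have hx : 0 ≤ (n : ℝ) ^ (-η) := by positivity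
  have hy : 0 ≤ q * Real.log n := by positivity
  nlinarith [mul_nonneg hK₁.le hy, mul_nonneg hK₂.le hx]

/-! ### Logarithmic means and the passage from a sparse subsequence to all indices. -/

section Deterministic

lemma sum_Icc_one_div_eq_harmonic (n : ℕ) :
    ∑ k ∈ Finset.Icc 1 n, 1 / (k : ℝ) = (harmonic n : ℝ) := by
  rw [harmonic_eq_sum_Icc]
  push_cast
  exact Finset.sum_congr rfl fun k _ => one_div _

lemma sum_Icc_one_div_le (n : ℕ) : ∑ k ∈ Finset.Icc 1 n, 1 / (k : ℝ) ≤ 1 + Real.log n := by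
  rw [sum_Icc_one_div_eq_harmonic]
  exact harmonic_le_one_add_log n

lemma tendsto_harmonic_div_log :
    Tendsto (fun n : ℕ => (harmonic n : ℝ) / Real.log n) atTop (𝓝 1) := by
  have h1 : Tendsto (fun n : ℕ => ((harmonic n : ℝ) - Real.log n) / Real.log n) atTop (𝓝 0) :=
    Real.tendsto_harmonic_sub_log.div_atTop tendsto_log_natCast
  have h2 := h1.add_const 1
  rw [zero_add] at h2
  refine h2.congr' ?_
  filter_upwards [eventually_log_pos] with n hn
  field_simp
  ring

/-- The logarithmic means of a convergent sequence converge to the same limit. -/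
theorem tendsto_log_mean {e : ℕ → ℝ} {p : ℝ} (he : Tendsto e atTop (𝓝 p)) :
    Tendsto (fun n : ℕ => (∑ k ∈ Finset.Icc 1 n, 1 / (k : ℝ) * e k) / Real.log n)
      atTop (𝓝 p) := by
  have hshift : ∀ (f : ℕ → ℝ) (n : ℕ), ∑ k ∈ Finset.Icc 1 n, f k
      = ∑ k ∈ Finset.range n, f (k + 1) := by
    intro f n
    rw [Finset.range_eq_Ico, Finset.sum_Ico_add' f 0 n 1]
    rfl
  -- Weighted Cesàro argument: terms that are little-o of a divergent positive series have partial
  -- sums little-o of its partial sums.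
  have hlo : (fun k : ℕ => 1 / ((k + 1 : ℕ) : ℝ) * (e (k + 1) - p))
      =o[atTop] fun k : ℕ => 1 / ((k + 1 : ℕ) : ℝ) := by
    have h0 : (fun k : ℕ => e (k + 1) - p) =o[atTop] fun _ : ℕ => (1 : ℝ) := by
      rw [Asymptotics.isLittleO_one_iff]
      have := ((tendsto_add_atTop_iff_nat 1).2 he).sub_const p
      simpa using this
    simpa using (Asymptotics.isBigO_refl (fun k : ℕ => 1 / ((k + 1 : ℕ) : ℝ)) atTop).mul_isLittleO h0
  have hsum := hlo.sum_range (fun k => by positivity) (by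
    have : Tendsto (fun n : ℕ => Real.log (n + 1 : ℕ)) atTop atTop :=
      (tendsto_add_atTop_iff_nat 1).2 tendsto_log_natCast
    refine tendsto_atTop_mono (fun n => ?_) this
    rw [← hshift (fun k => 1 / (k : ℝ)), sum_Icc_one_div_eq_harmonic]
    exact log_add_one_le_harmonic n)
  have hdiv := hsum.tendsto_div_nhds_zero
  have h3 := (hdiv.add_const p).mul tendsto_harmonic_div_log
  rw [zero_add, mul_one] at h3
  refine h3.congr' ?_
  filter_upwards [eventually_log_pos, eventually_ge_atTop 1] with n hn hn1
  have hpos : (0 : ℝ) < harmonic n := by exact_mod_cast harmonic_pos (by omega)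
  have h4 := hshift (fun k => 1 / (k : ℝ)) n
  have h5 := hshift (fun k => 1 / (k : ℝ) * (e k - p)) n
  rw [← h4, ← h5, sum_Icc_one_div_eq_harmonic]
  simp only [mul_sub, Finset.sum_sub_distrib, ← Finset.sum_mul]
  rw [sum_Icc_one_div_eq_harmonic]
  field_simp
  ring

/-- The sparse scale `exp (j ^ δ)` along which logarithmic averages are controlled. -/
def sparseLog (δ : ℝ) (j : ℕ) : ℝ := Real.exp ((j : ℝ) ^ δ)

/-- The sparse subsequence `⌊exp (exp (j ^ δ))⌋`. -/
def sparseIndex (δ : ℝ) (j : ℕ) : ℕ := ⌊Real.exp (sparseLog δ j)⌋₊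

lemma sparseLog_pos (δ : ℝ) (j : ℕ) : 0 < sparseLog δ j := Real.exp_pos _

lemma one_le_sparseLog (δ : ℝ) (j : ℕ) : 1 ≤ sparseLog δ j :=
  Real.one_le_exp (by positivity)

lemma tendsto_natCast_rpow_atTop {δ : ℝ} (hδ : 0 < δ) :
    Tendsto (fun j : ℕ => (j : ℝ) ^ δ) atTop atTop :=
  (tendsto_rpow_atTop hδ).comp tendsto_natCast_atTop_atTop

lemma tendsto_sparseLog {δ : ℝ} (hδ : 0 < δ) : Tendsto (sparseLog δ) atTop atTop :=
  Real.tendsto_exp_atTop.comp (tendsto_natCast_rpow_atTop hδ)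

lemma sparseIndex_pos (δ : ℝ) (j : ℕ) : 0 < sparseIndex δ j :=
  Nat.floor_pos.2 (Real.one_le_exp (sparseLog_pos δ j).le)

lemma log_sparseIndex_le (δ : ℝ) (j : ℕ) : Real.log (sparseIndex δ j) ≤ sparseLog δ j := by
  rw [Real.log_le_iff_le_exp (by exact_mod_cast sparseIndex_pos δ j)]
  exact Nat.floor_le (Real.exp_pos _).le

lemma sub_log_two_le_log_sparseIndex (δ : ℝ) (j : ℕ) :
    sparseLog δ j - Real.log 2 ≤ Real.log (sparseIndex δ j) := by
  have h1 : (1 : ℝ) ≤ sparseIndex δ j := by exact_mod_cast sparseIndex_pos δ j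
  have h2 : Real.exp (sparseLog δ j) < sparseIndex δ j + 1 := Nat.lt_floor_add_one _
  rw [Real.le_log_iff_exp_le (by linarith), Real.exp_sub, Real.exp_log (by norm_num)]
  linarith

lemma tendsto_sparseIndex {δ : ℝ} (hδ : 0 < δ) : Tendsto (sparseIndex δ) atTop atTop :=
  tendsto_nat_floor_atTop.comp (Real.tendsto_exp_atTop.comp (tendsto_sparseLog hδ))

lemma tendsto_log_sparseIndex_div {δ : ℝ} (hδ : 0 < δ) :
    Tendsto (fun j => Real.log (sparseIndex δ j) / sparseLog δ j) atTop (𝓝 1) := by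
  have h0 : Tendsto (fun j => 1 - Real.log 2 / sparseLog δ j) atTop (𝓝 1) := by
    simpa using (tendsto_const_nhds (x := Real.log 2)).div_atTop (tendsto_sparseLog hδ)
      |>.const_sub 1
  refine tendsto_of_tendsto_of_tendsto_of_le_of_le h0 tendsto_const_nhds (fun j => ?_) fun j => ?_
  · have := sparseLog_pos δ j
    have h := sub_log_two_le_log_sparseIndex δ j
    rw [one_sub_div this.ne', div_le_div_iff_of_pos_right this]
    exact h
  · exact (div_le_one (sparseLog_pos δ j)).2 (log_sparseIndex_le δ j)

/-- By Bernoulli's inequality the increment is at most `δ j^{δ-1}`. This is why the sparse scale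
needs `δ < 1`. -/
lemma tendsto_rpow_succ_sub {δ : ℝ} (hδ0 : 0 < δ) (hδ1 : δ < 1) :
    Tendsto (fun j : ℕ => ((j + 1 : ℕ) : ℝ) ^ δ - (j : ℝ) ^ δ) atTop (𝓝 0) := by
  have h0 : Tendsto (fun j : ℕ => δ * (j : ℝ) ^ (-(1 - δ))) atTop (𝓝 0) := by
    simpa using ((tendsto_rpow_neg_atTop (sub_pos.2 hδ1)).comp
      tendsto_natCast_atTop_atTop).const_mul δ
  refine tendsto_of_tendsto_of_tendsto_of_le_of_le' tendsto_const_nhds h0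
    (Eventually.of_forall fun j => ?_) ?_
  · rw [sub_nonneg]
    exact Real.rpow_le_rpow (by positivity) (by push_cast; linarith) hδ0.le
  · filter_upwards [eventually_ge_atTop 1] with j hj
    have hj' : (0 : ℝ) < j := by exact_mod_cast hj
    have h1 : ((j + 1 : ℕ) : ℝ) = j * (1 + 1 / j) := by push_cast; field_simp
    have h2 : (1 + 1 / (j : ℝ)) ^ δ ≤ 1 + δ * (1 / j) :=
      rpow_one_add_le_one_add_mul_self (by have : 0 < 1 / (j : ℝ) := by positivity
                                           linarith) hδ0.le hδ1.le
    have h3 : (j : ℝ) ^ (-(1 - δ)) = (j : ℝ) ^ δ * (1 / j) := by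
      rw [neg_sub, Real.rpow_sub_one hj'.ne']; ring
    rw [h1, Real.mul_rpow hj'.le (by positivity), h3]
    have := mul_le_mul_of_nonneg_left h2 (Real.rpow_nonneg hj'.le δ)
    linarith

lemma tendsto_sparseLog_succ_div {δ : ℝ} (hδ0 : 0 < δ) (hδ1 : δ < 1) :
    Tendsto (fun j => sparseLog δ (j + 1) / sparseLog δ j) atTop (𝓝 1) := by
  have := (Real.continuous_exp.tendsto 0).comp (tendsto_rpow_succ_sub hδ0 hδ1)
  rw [Real.exp_zero] at this
  refine this.congr fun j => ?_
  simp only [Function.comp, sparseLog, Real.exp_sub]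

/-- Sums of nonnegative terms that are controlled along the sparse subsequence are controlled
along the full sequence. -/
theorem tendsto_div_log_of_sparse {δ : ℝ} (hδ0 : 0 < δ) (hδ1 : δ < 1) {T : ℕ → ℝ}
    (hT : Monotone T) (hT0 : ∀ n, 0 ≤ T n) {p : ℝ}
    (h : Tendsto (fun j => T (sparseIndex δ j) / sparseLog δ j) atTop (𝓝 p)) :
    Tendsto (fun n : ℕ => T n / Real.log n) atTop (𝓝 p) := by
  -- The inverse of `j ↦ exp(j^δ)` at `ln n`, rounded down, so that `ln n` lies between `sparseLog δ
  -- (J n)` and `sparseLog δ (J n + 1)`.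
  set J : ℕ → ℕ := fun n => ⌊Real.log (Real.log n) ^ δ⁻¹⌋₊ with hJ
  have hloglog : Tendsto (fun n : ℕ => Real.log (Real.log n)) atTop atTop :=
    Real.tendsto_log_atTop.comp tendsto_log_natCast
  have hJt : Tendsto J atTop atTop :=
    tendsto_nat_floor_atTop.comp ((tendsto_rpow_atTop (inv_pos.2 hδ0)).comp hloglog)
  have hr := tendsto_sparseLog_succ_div hδ0 hδ1
  have hlow : Tendsto (fun j => T (sparseIndex δ j) / sparseLog δ (j + 1)) atTop (𝓝 p) := by
    have := h.div hr one_ne_zero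
    rw [div_one] at this
    refine this.congr fun j => ?_
    have h1 := sparseLog_pos δ j
    have h2 := sparseLog_pos δ (j + 1)
    simp only [Pi.div_apply]
    field_simp
  have hupp : Tendsto (fun j => T (sparseIndex δ (j + 1)) / sparseLog δ j) atTop (𝓝 p) := by
    have := ((tendsto_add_atTop_iff_nat 1).2 h).mul hr
    rw [mul_one] at this
    refine this.congr fun j => ?_
    have h1 := sparseLog_pos δ j
    have h2 := sparseLog_pos δ (j + 1)
    field_simp
  refine tendsto_of_tendsto_of_tendsto_of_le_of_le' (hlow.comp hJt) (hupp.comp hJt) ?_ ?_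
  all_goals
    filter_upwards [hloglog.eventually_gt_atTop 0, eventually_log_pos, eventually_ge_atTop 1]
      with n hn hlog hn1
    have hn' : (0 : ℝ) < n := by exact_mod_cast hn1
    have hfl : (J n : ℝ) ^ δ ≤ Real.log (Real.log n) := by
      have h1 : (J n : ℝ) ≤ Real.log (Real.log n) ^ δ⁻¹ := Nat.floor_le (by positivity)
      have h2 := Real.rpow_le_rpow (by positivity) h1 hδ0.le
      rwa [Real.rpow_inv_rpow hn.le hδ0.ne'] at h2
    have hfu : Real.log (Real.log n) ≤ ((J n + 1 : ℕ) : ℝ) ^ δ := by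
      have h1 : Real.log (Real.log n) ^ δ⁻¹ ≤ ((J n + 1 : ℕ) : ℝ) := by
        push_cast
        exact (Nat.lt_floor_add_one _).le
      have h2 := Real.rpow_le_rpow (by positivity) h1 hδ0.le
      rwa [Real.rpow_inv_rpow hn.le hδ0.ne'] at h2
    have hLl : sparseLog δ (J n) ≤ Real.log n := by
      rw [← Real.exp_log hlog]
      exact Real.exp_le_exp.2 hfl
    have hLu : Real.log n ≤ sparseLog δ (J n + 1) := by
      rw [← Real.exp_log hlog]
      exact Real.exp_le_exp.2 hfu
  · have hidx : sparseIndex δ (J n) ≤ n := by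
      refine Nat.floor_le_of_le ?_
      rw [← Real.exp_log hn']
      exact Real.exp_le_exp.2 hLl
    exact div_le_div₀ (hT0 _) (hT hidx) hlog hLu
  · have hidx : n ≤ sparseIndex δ (J n + 1) := by
      refine Nat.le_floor ?_
      rw [← Real.exp_log hn']
      exact Real.exp_le_exp.2 hLu
    exact div_le_div₀ (hT0 _) (hT hidx) (sparseLog_pos _ _) hLl

end Deterministic

/-! ### Almost sure logarithmic averaging from second moments. -/

section Probabilistic

variable {Ω : Type*} [MeasurableSpace Ω] {P : Measure Ω}

/-- Random variables with summable second moments tend to zero almost surely. -/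
theorem ae_tendsto_zero_of_integral_sq_le {Z : ℕ → Ω → ℝ}
    (hZ : ∀ j, Integrable (fun ω => Z j ω ^ 2) P) {a : ℕ → ℝ} (ha : Summable a)
    (hle : ∀ᶠ j in atTop, ∫ ω, Z j ω ^ 2 ∂P ≤ a j) :
    ∀ᵐ ω ∂P, Tendsto (fun j => Z j ω) atTop (𝓝 0) := by
  have hs : Summable fun j => ∫ ω, Z j ω ^ 2 ∂P := by
    refine ha.of_norm_bounded_eventually_nat ?_
    filter_upwards [hle] with j hj
    rwa [Real.norm_of_nonneg (integral_nonneg fun ω => sq_nonneg _)]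
  -- The series of squares has finite expectation, hence converges almost surely, and its terms tend
  -- to zero.
  have hfin : ∫⁻ ω, ∑' j, ENNReal.ofReal (Z j ω ^ 2) ∂P ≠ ⊤ := by
    rw [lintegral_tsum fun j => (hZ j).aemeasurable.ennreal_ofReal]
    have : ∀ j, ∫⁻ ω, ENNReal.ofReal (Z j ω ^ 2) ∂P = ENNReal.ofReal (∫ ω, Z j ω ^ 2 ∂P) :=
      fun j => (ofReal_integral_eq_lintegral_ofReal (hZ j)
        (Eventually.of_forall fun ω => sq_nonneg _)).symm
    simp_rw [this]
    exact hs.tsum_ofReal_ne_top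
  filter_upwards [ae_lt_top' (AEMeasurable.tsum fun j =>
    (hZ j).aemeasurable.ennreal_ofReal) hfin] with ω hω
  have h1 := ENNReal.tendsto_atTop_zero_of_tsum_ne_top hω.ne
  have h2 : Tendsto (fun j => Z j ω ^ 2) atTop (𝓝 0) := by
    have := (ENNReal.tendsto_toReal ENNReal.zero_ne_top).comp h1
    refine this.congr fun j => ?_
    simp [ENNReal.toReal_ofReal (sq_nonneg (Z j ω))]
  have h3 := (Real.continuous_sqrt.tendsto 0).comp h2
  rw [Real.sqrt_zero] at h3
  rw [tendsto_zero_iff_abs_tendsto_zero]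
  exact h3.congr fun j => Real.sqrt_sq_eq_abs _

variable [IsProbabilityMeasure P]

/-- The second moment of a logarithmically weighted sum of bounded random variables whose
pair products have small expectation outside an initial block. -/
theorem integral_log_sum_sq_le {Y : ℕ → Ω → ℝ} (hY : ∀ k, AEStronglyMeasurable (Y k) P)
    (hY1 : ∀ k ω, |Y k ω| ≤ 1) {K N : ℕ} {D : ℝ} (hD : 0 ≤ D)
    (hYD : ∀ m n, m < n → K < n → |∫ ω, Y m ω * Y n ω ∂P| ≤ D) :
    ∫ ω, (∑ k ∈ Finset.Icc 1 N, 1 / (k : ℝ) * Y k ω) ^ 2 ∂P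
      ≤ (∑ k ∈ Finset.Icc 1 K, 1 / (k : ℝ)) ^ 2 + ∑ k ∈ Finset.Icc 1 N, 1 / (k : ℝ)
        + D * (∑ k ∈ Finset.Icc 1 N, 1 / (k : ℝ)) ^ 2 := by
  have hint : ∀ m n, Integrable (fun ω => Y m ω * Y n ω) P := fun m n => by
    refine Integrable.of_bound ((hY m).mul (hY n)) 1 (Eventually.of_forall fun ω => ?_)
    rw [Real.norm_eq_abs, abs_mul]
    exact mul_le_one₀ (hY1 m ω) (abs_nonneg _) (hY1 n ω)
  have hle1 : ∀ m n, |∫ ω, Y m ω * Y n ω ∂P| ≤ 1 := fun m n => by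
    have := norm_integral_le_of_norm_le_const (μ := P) (f := fun ω => Y m ω * Y n ω) (C := 1)
      (Eventually.of_forall fun ω => by
        rw [Real.norm_eq_abs, abs_mul]
        exact mul_le_one₀ (hY1 m ω) (abs_nonneg _) (hY1 n ω))
    simpa using this
  have hexp : ∫ ω, (∑ k ∈ Finset.Icc 1 N, 1 / (k : ℝ) * Y k ω) ^ 2 ∂P
      = ∑ m ∈ Finset.Icc 1 N, ∑ n ∈ Finset.Icc 1 N,
        1 / (m : ℝ) * (1 / (n : ℝ)) * ∫ ω, Y m ω * Y n ω ∂P := by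
    have hint' : ∀ m n : ℕ, Integrable (fun ω => 1 / (m : ℝ) * Y m ω * (1 / (n : ℝ) * Y n ω)) P :=
      fun m n => ((hint m n).const_mul (1 / (m : ℝ) * (1 / (n : ℝ)))).congr
        (Eventually.of_forall fun ω => by ring)
    simp_rw [sq, Finset.sum_mul_sum]
    rw [integral_finsetSum _ fun m _ => integrable_finsetSum _ fun n _ => hint' m n]
    refine Finset.sum_congr rfl fun m _ => ?_
    rw [integral_finsetSum _ fun n _ => hint' m n]
    refine Finset.sum_congr rfl fun n _ => ?_
    rw [← integral_const_mul]
    exact integral_congr_ae (Eventually.of_forall fun ω => by ring)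
  -- Pairs inside the initial block and diagonal pairs use the trivial bound `1`; every other pair
  -- has larger index above `K` and is bounded by `D`.
  have hterm : ∀ m ∈ Finset.Icc 1 N, ∀ n ∈ Finset.Icc 1 N,
      1 / (m : ℝ) * (1 / (n : ℝ)) * ∫ ω, Y m ω * Y n ω ∂P
      ≤ (if m ≤ K ∧ n ≤ K then 1 / (m : ℝ) * (1 / (n : ℝ)) else 0)
        + (if m = n then 1 / (m : ℝ) else 0) + D * (1 / (m : ℝ) * (1 / (n : ℝ))) := by
    intro m hm n hn
    rw [Finset.mem_Icc] at hm hn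
    have hm' : (1 : ℝ) ≤ m := by exact_mod_cast hm.1
    have hn' : (1 : ℝ) ≤ n := by exact_mod_cast hn.1
    have hpos : 0 ≤ 1 / (m : ℝ) * (1 / (n : ℝ)) := by positivity
    have hmpos : 0 ≤ 1 / (m : ℝ) := by positivity
    have hn1 : 1 / (n : ℝ) ≤ 1 := by rw [div_le_one (by linarith)]; exact hn'
    have hb := (le_abs_self _).trans (hle1 m n)
    have hb1 := mul_le_mul_of_nonneg_left hb hpos
    have hDp : 0 ≤ D * (1 / (m : ℝ) * (1 / (n : ℝ))) := mul_nonneg hD hpos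
    rw [mul_one] at hb1
    by_cases hK : m ≤ K ∧ n ≤ K
    · have : 0 ≤ if m = n then 1 / (m : ℝ) else 0 := by split_ifs <;> positivity
      rw [if_pos hK]
      linarith
    · rw [if_neg hK]
      by_cases hmn : m = n
      · rw [if_pos hmn]
        have : 1 / (m : ℝ) * (1 / (n : ℝ)) ≤ 1 / (m : ℝ) := mul_le_of_le_one_right hmpos hn1
        linarith
      · rw [if_neg hmn]
        have hc : ∫ ω, Y m ω * Y n ω ∂P ≤ D := by
          rcases lt_or_gt_of_ne hmn with h | h
          · exact (le_abs_self _).trans (hYD m n h (by omega))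
          · have := hYD n m h (by omega)
            simp_rw [mul_comm (Y n _)] at this
            exact (le_abs_self _).trans this
        have := mul_le_mul_of_nonneg_left hc hpos
        linarith
  rw [hexp]
  refine (Finset.sum_le_sum fun m hm => Finset.sum_le_sum fun n hn => hterm m hm n hn).trans ?_
  simp only [Finset.sum_add_distrib]
  refine add_le_add (add_le_add ?_ ?_) ?_
  · rw [sq, Finset.sum_mul_sum]
    have hset : ∑ m ∈ Finset.Icc 1 N, ∑ n ∈ Finset.Icc 1 N,
        (if m ≤ K ∧ n ≤ K then 1 / (m : ℝ) * (1 / (n : ℝ)) else 0)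
        = ∑ m ∈ (Finset.Icc 1 N).filter (· ≤ K), ∑ n ∈ (Finset.Icc 1 N).filter (· ≤ K),
          1 / (m : ℝ) * (1 / (n : ℝ)) := by
      rw [Finset.sum_filter]
      refine Finset.sum_congr rfl fun m _ => ?_
      by_cases hmK : m ≤ K
      · simp only [hmK, true_and, if_true]
        rw [Finset.sum_filter]
      · simp [hmK]
    rw [hset]
    have hsub : (Finset.Icc 1 N).filter (· ≤ K) ⊆ Finset.Icc 1 K := by
      intro k hk
      simp only [Finset.mem_filter, Finset.mem_Icc] at hk ⊢
      omega
    refine (Finset.sum_le_sum fun m _ => Finset.sum_le_sum_of_subset_of_nonneg hsub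
      fun n _ _ => by positivity).trans ?_
    exact Finset.sum_le_sum_of_subset_of_nonneg hsub
      fun m _ _ => Finset.sum_nonneg fun n _ => by positivity
  · refine Finset.sum_le_sum fun m hm => ?_
    rw [Finset.sum_ite_eq, if_pos hm]
  · rw [sq, Finset.sum_mul_sum, Finset.mul_sum]
    exact Finset.sum_le_sum fun m _ => by rw [Finset.mul_sum]

/-- Bounded random variables with correlations decaying like `(ln ln n) ^ (-(1 + ε))` obey the
logarithmically averaged law of large numbers along the sparse subsequence. -/
theorem ae_tendsto_sparse_log_sum {Y : ℕ → Ω → ℝ} (hY : ∀ k, AEStronglyMeasurable (Y k) P)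
    (hY1 : ∀ k ω, |Y k ω| ≤ 1) {C ε : ℝ} (hC : 0 ≤ C) (hε : 0 < ε) {N₀ : ℕ}
    (hYC : ∀ m n, m < n → N₀ ≤ n →
      |∫ ω, Y m ω * Y n ω ∂P| ≤ C * Real.log (Real.log n) ^ (-(1 + ε))) :
    ∀ᵐ ω ∂P, Tendsto (fun j => (∑ k ∈ Finset.Icc 1 (sparseIndex (1 + ε / 2)⁻¹ j),
      1 / (k : ℝ) * Y k ω) / sparseLog (1 + ε / 2)⁻¹ j) atTop (𝓝 0) := by
  -- The exponent must be below `1`, so that the subsequence controls all indices, and above `1 / (1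
  -- + ε)`, so that `j^{-δ(1+ε)}` is summable.
  set δ : ℝ := (1 + ε / 2)⁻¹ with hδ
  have hδ0 : 0 < δ := by positivity
  set s : ℝ := 1 + ε with hs
  have hs0 : 0 < s := by linarith
  have hδs : 1 < δ * s := by
    rw [hδ, inv_mul_eq_div, lt_div_iff₀ (by positivity)]
    linarith
  have hsummable : Summable fun j : ℕ => (6 * s ^ s + 4 * (C * 2 ^ s)) * (j : ℝ) ^ (-(δ * s)) :=
    (Real.summable_nat_rpow.2 (by linarith)).mul_left _
  refine ae_tendsto_zero_of_integral_sq_le (fun j => ?_) hsummable ?_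
  · have hm : AEStronglyMeasurable (fun ω => ((∑ k ∈ Finset.Icc 1 (sparseIndex δ j),
        1 / (k : ℝ) * Y k ω) / sparseLog δ j)) P :=
      AEStronglyMeasurable.div₀ (Finset.aestronglyMeasurable_fun_sum _ fun k _ =>
        (hY k).const_mul (1 / (k : ℝ))) aestronglyMeasurable_const
    refine Integrable.of_bound (hm.pow 2)
      (((∑ k ∈ Finset.Icc 1 (sparseIndex δ j), 1 / (k : ℝ)) / sparseLog δ j) ^ 2)
      (Eventually.of_forall fun ω => ?_)
    rw [norm_pow, Real.norm_eq_abs, abs_div, abs_of_pos (sparseLog_pos δ j)]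
    have hLp := sparseLog_pos δ j
    have : |∑ k ∈ Finset.Icc 1 (sparseIndex δ j), 1 / (k : ℝ) * Y k ω|
        ≤ ∑ k ∈ Finset.Icc 1 (sparseIndex δ j), 1 / (k : ℝ) := by
      refine (Finset.abs_sum_le_sum_abs _ _).trans (Finset.sum_le_sum fun k _ => ?_)
      rw [abs_mul, abs_of_nonneg (by positivity : 0 ≤ 1 / (k : ℝ))]
      exact mul_le_of_le_one_right (by positivity) (hY1 k ω)
    gcongr
  · have hN : ∀ᶠ j in atTop, (N₀ : ℝ) ≤ Real.exp √(sparseLog δ j) :=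
      (Real.tendsto_exp_atTop.comp (Real.tendsto_sqrt_atTop.comp
        (tendsto_sparseLog hδ0))).eventually_ge_atTop _
    filter_upwards [hN, eventually_ge_atTop 1] with j hj hj1
    set L := sparseLog δ j with hL
    have hL1 : 1 ≤ L := one_le_sparseLog δ j
    have hL0 : 0 < L := by linarith
    have hjpos : (0 : ℝ) < j := by exact_mod_cast hj1
    set x : ℝ := (j : ℝ) ^ δ with hx
    have hx0 : 0 < x := by positivity
    have hxs : x ^ (-s) = (j : ℝ) ^ (-(δ * s)) := by
      rw [hx, ← Real.rpow_mul hjpos.le, mul_neg]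
    -- With this cut-off the initial block contributes only `O(L)` to the second moment, negligible
    -- against `L²`, while beyond it `ln ln n` is still at least half of `ln L = x`.
    set K := ⌊Real.exp √L⌋₊ with hK
    set D := C * 2 ^ s * x ^ (-s) with hD
    have hD0 : 0 ≤ D := by positivity
    have hsqrt : √L = Real.exp (x / 2) := by
      rw [hL, sparseLog, ← hx, Real.sqrt_eq_rpow, ← Real.exp_mul]
      ring_nf
    have hcov : ∀ m n, m < n → K < n → |∫ ω, Y m ω * Y n ω ∂P| ≤ D := by
      intro m n hmn hKn
      have hn : Real.exp √L < n := (Nat.floor_lt (Real.exp_pos _).le).1 hKn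
      have hnN : N₀ ≤ n := by exact_mod_cast hj.trans hn.le
      refine (hYC m n hmn hnN).trans ?_
      have h1 : √L < Real.log n :=
        (Real.lt_log_iff_exp_lt ((Real.exp_pos _).trans hn)).2 hn
      have h2 : x / 2 < Real.log (Real.log n) := by
        rw [hsqrt] at h1
        exact (Real.lt_log_iff_exp_lt ((Real.exp_pos _).trans h1)).2 h1
      have h3 : Real.log (Real.log n) ^ (-s) ≤ (x / 2) ^ (-s) :=
        Real.rpow_le_rpow_of_nonpos (by positivity) h2.le (by linarith)
      have h4 : (x / 2) ^ (-s) = 2 ^ s * x ^ (-s) := by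
        rw [Real.div_rpow hx0.le (by norm_num), Real.rpow_neg (by norm_num : (0:ℝ) ≤ 2)]
        field_simp
      calc C * Real.log (Real.log n) ^ (-s) ≤ C * (x / 2) ^ (-s) := by gcongr
        _ = D := by rw [h4, hD]; ring
    have hmain := integral_log_sum_sq_le hY hY1 (N := sparseIndex δ j) hD0 hcov
    have hHK : ∑ k ∈ Finset.Icc 1 K, 1 / (k : ℝ) ≤ 2 * √L := by
      refine (sum_Icc_one_div_le K).trans ?_
      have h1 : Real.log K ≤ √L := by
        rw [Real.log_le_iff_le_exp (by
          exact_mod_cast Nat.floor_pos.2 (Real.one_le_exp (Real.sqrt_nonneg _)))]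
        exact Nat.floor_le (Real.exp_pos _).le
      have h2 : 1 ≤ √L := Real.one_le_sqrt.2 hL1
      linarith
    have hHN : ∑ k ∈ Finset.Icc 1 (sparseIndex δ j), 1 / (k : ℝ) ≤ 2 * L := by
      refine (sum_Icc_one_div_le _).trans ?_
      have := log_sparseIndex_le δ j
      linarith
    have hHK0 : 0 ≤ ∑ k ∈ Finset.Icc 1 K, 1 / (k : ℝ) := Finset.sum_nonneg fun k _ => by positivity
    have hHN0 : 0 ≤ ∑ k ∈ Finset.Icc 1 (sparseIndex δ j), 1 / (k : ℝ) :=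
      Finset.sum_nonneg fun k _ => by positivity
    have hbound : ∫ ω, (∑ k ∈ Finset.Icc 1 (sparseIndex δ j), 1 / (k : ℝ) * Y k ω) ^ 2 ∂P
        ≤ 6 * L + 4 * D * L ^ 2 := by
      calc _ ≤ _ := hmain
        _ ≤ (2 * √L) ^ 2 + 2 * L + D * (2 * L) ^ 2 := by gcongr
        _ = 6 * L + 4 * D * L ^ 2 := by rw [mul_pow, Real.sq_sqrt hL0.le]; ring
    -- Since `L = exp x`, its inverse is smaller than any power of `x`; the constant comes from
    -- raising `x / s ≤ exp(x / s)` to the power `s`.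
    have hLinv : 1 / L ≤ s ^ s * x ^ (-s) := by
      have h1 : x / s ≤ Real.exp (x / s) := by
        have := Real.add_one_le_exp (x / s)
        linarith
      have h2 : (x / s) ^ s ≤ L := by
        refine (Real.rpow_le_rpow (by positivity) h1 hs0.le).trans (le_of_eq ?_)
        rw [← Real.exp_mul, div_mul_cancel₀ _ hs0.ne']
        rfl
      calc 1 / L ≤ 1 / (x / s) ^ s := one_div_le_one_div_of_le (by positivity) h2
        _ = s ^ s * x ^ (-s) := by
          rw [Real.div_rpow hx0.le hs0.le, Real.rpow_neg hx0.le]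
          field_simp
    simp_rw [div_pow]
    rw [integral_div]
    calc _ ≤ (6 * L + 4 * D * L ^ 2) / L ^ 2 := by gcongr
      _ = 6 * (1 / L) + 4 * D := by field_simp
      _ ≤ 6 * (s ^ s * x ^ (-s)) + 4 * D := by gcongr
      _ = _ := by rw [hD, ← hxs]; ring

/-- Almost sure logarithmic averaging for events with convergent probabilities whose pairwise
dependence decays like `(ln ln n) ^ (-(1 + ε))`. -/
theorem ae_tendsto_logAverage {A : ℕ → Set Ω} (hA : ∀ k, NullMeasurableSet (A k) P) {p : ℝ}
    (hp : Tendsto (fun k => P.real (A k)) atTop (𝓝 p)) {C ε : ℝ} (hC : 0 ≤ C) (hε : 0 < ε)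
    {N₀ : ℕ} (hAC : ∀ m n, N₀ ≤ m → m < n →
      |P.real (A m ∩ A n) - P.real (A m) * P.real (A n)|
        ≤ C * Real.log (Real.log n) ^ (-(1 + ε))) :
    ∀ᵐ ω ∂P, Tendsto (fun n => logAverage A n ω) atTop (𝓝 p) := by
  -- From `n = 3` on `ln n ≥ 1`, so `ln ln n` is nonnegative and so is the right-hand bound.
  set N₁ := max N₀ 3 with hN₁
  set I : ℕ → Ω → ℝ := fun k => (A k).indicator fun _ => (1 : ℝ) with hI
  have hIm : ∀ k, AEStronglyMeasurable (I k) P := fun k =>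
    aestronglyMeasurable_const.indicator₀ (hA k)
  have hI0 : ∀ k ω, 0 ≤ I k ω := fun k ω => Set.indicator_nonneg (fun _ _ => zero_le_one) ω
  have hI1 : ∀ k ω, I k ω ≤ 1 := fun k ω =>
    Set.indicator_le_self' (f := fun _ => (1 : ℝ)) (fun _ _ => zero_le_one) ω
  have hIint : ∀ k, ∫ ω, I k ω ∂P = P.real (A k) := fun k => by
    rw [hI, integral_indicator₀ (hA k)]
    simp
  have hIi : ∀ k, Integrable (I k) P := fun k => Integrable.of_bound (hIm k) 1
    (Eventually.of_forall fun ω => by rw [Real.norm_of_nonneg (hI0 k ω)]; exact hI1 k ω)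
  -- Centred indicators, set to zero at the start so that the covariance bound holds for every
  -- smaller index `m`. This changes finitely many terms, which the logarithmic mean forgets.
  set Y : ℕ → Ω → ℝ := fun k ω => if N₁ ≤ k then I k ω - P.real (A k) else 0 with hYdef
  have hY : ∀ k, AEStronglyMeasurable (Y k) P := fun k => by
    by_cases h : N₁ ≤ k
    · simp only [hYdef, h, if_true]
      exact (hIm k).sub aestronglyMeasurable_const
    · simp only [hYdef, h, if_false]
      exact aestronglyMeasurable_const
  have hY1 : ∀ k ω, |Y k ω| ≤ 1 := fun k ω => by
    by_cases h : N₁ ≤ k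
    · simp only [hYdef, h, if_true]
      have h1 := hI0 k ω
      have h2 := hI1 k ω
      have h3 : 0 ≤ P.real (A k) := measureReal_nonneg
      have h4 : P.real (A k) ≤ 1 := measureReal_le_one
      rw [abs_le]
      constructor <;> linarith
    · simp [hYdef, h]
  have hYC : ∀ m n, m < n → N₁ ≤ n →
      |∫ ω, Y m ω * Y n ω ∂P| ≤ C * Real.log (Real.log n) ^ (-(1 + ε)) := by
    intro m n hmn hn
    by_cases hm : N₁ ≤ m
    · have hmul : ∀ ω, I m ω * I n ω = (A m ∩ A n).indicator (fun _ => (1 : ℝ)) ω := fun ω => by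
        have := Set.inter_indicator_mul (s := A m) (t := A n) (fun _ => (1 : ℝ))
          (fun _ => 1) ω
        simpa [hI] using this.symm
      have hprod : ∫ ω, I m ω * I n ω ∂P = P.real (A m ∩ A n) := by
        simp_rw [hmul]
        rw [integral_indicator₀ ((hA m).inter (hA n))]
        simp
      have hprodi : Integrable (fun ω => I m ω * I n ω) P :=
        Integrable.of_bound ((hIm m).mul (hIm n)) 1 (Eventually.of_forall fun ω => by
          rw [Real.norm_of_nonneg (mul_nonneg (hI0 m ω) (hI0 n ω))]
          exact mul_le_one₀ (hI1 m ω) (hI0 n ω) (hI1 n ω))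
      have heq : ∫ ω, Y m ω * Y n ω ∂P
          = P.real (A m ∩ A n) - P.real (A m) * P.real (A n) := by
        have : ∀ ω, Y m ω * Y n ω = I m ω * I n ω - P.real (A n) * I m ω
            - (P.real (A m) * I n ω - P.real (A m) * P.real (A n)) := fun ω => by
          simp only [hYdef, hm, hn, if_true]
          ring
        simp_rw [this]
        have hi1 : Integrable (fun ω => I m ω * I n ω - P.real (A n) * I m ω) P :=
          hprodi.sub ((hIi m).const_mul _)
        have hi2 : Integrable (fun ω => P.real (A m) * I n ω - P.real (A m) * P.real (A n)) P :=
          ((hIi n).const_mul _).sub (integrable_const _)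
        rw [integral_sub hi1 hi2,
          integral_sub hprodi ((hIi m).const_mul _),
          integral_sub ((hIi n).const_mul _) (integrable_const _),
          integral_const_mul, integral_const_mul, hprod, hIint, hIint]
        simp
        ring
      rw [heq]
      exact hAC m n ((le_max_left _ _).trans hm) hmn
    · have : ∀ ω, Y m ω * Y n ω = 0 := fun ω => by simp [hYdef, hm]
      simp only [this, integral_zero, abs_zero]
      have h3 : (3 : ℝ) ≤ n := by exact_mod_cast (le_max_right _ _).trans hn
      have h1 : (1 : ℝ) ≤ Real.log n := by
        rw [Real.le_log_iff_exp_le (by linarith)]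
        exact Real.exp_one_lt_three.le.trans h3
      have := Real.log_nonneg h1
      positivity
  have hε2 : 0 < ε / 2 := by linarith
  have hδ0 : 0 < (1 + ε / 2)⁻¹ := by positivity
  have hδ1 : (1 + ε / 2)⁻¹ < 1 := inv_lt_one_of_one_lt₀ (by linarith)
  filter_upwards [ae_tendsto_sparse_log_sum hY hY1 hC hε hYC] with ω hω
  set δ := (1 + ε / 2)⁻¹
  have he : Tendsto (fun k => I k ω - Y k ω) atTop (𝓝 p) := by
    refine hp.congr' ?_
    filter_upwards [eventually_ge_atTop N₁] with k hk
    simp [hYdef, hk]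
  have hmean := ((tendsto_log_mean he).comp (tendsto_sparseIndex hδ0)).mul
    (tendsto_log_sparseIndex_div hδ0)
  have hsum := hω.add hmean
  rw [zero_add, mul_one] at hsum
  have hsparse : Tendsto (fun j => (∑ k ∈ Finset.Icc 1 (sparseIndex δ j), 1 / (k : ℝ) * I k ω)
      / sparseLog δ j) atTop (𝓝 p) := by
    refine hsum.congr' ?_
    filter_upwards [(tendsto_sparseIndex hδ0).eventually eventually_log_pos] with j hj
    have hL := sparseLog_pos δ j
    simp only [Function.comp, mul_sub, Finset.sum_sub_distrib]
    field_simp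
    ring
  have := tendsto_div_log_of_sparse hδ0 hδ1
    (T := fun n => ∑ k ∈ Finset.Icc 1 n, 1 / (k : ℝ) * I k ω)
    (fun a b hab => Finset.sum_le_sum_of_subset_of_nonneg (Finset.Icc_subset_Icc_right hab)
      fun k _ _ => mul_nonneg (by positivity) (hI0 k ω))
    (fun n => Finset.sum_nonneg fun k _ => mul_nonneg (by positivity) (hI0 k ω)) hsparse
  refine this.congr fun n => ?_
  rw [logAverage, div_eq_inv_mul, one_div]

end Probabilistic

/-! ### Normal comparison for Gaussian variables on a general probability space. -/

section Decoupling

variable {Ω : Type*} [MeasurableSpace Ω] {P : Measure Ω}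

lemma hasGaussianLaw_of_isGaussianProcess {S T : Type*} [Fintype T] {Y : S → Ω → ℝ}
    (hY : IsGaussianProcess Y P) (e : T → S) : HasGaussianLaw (fun ω t => Y (e t) ω) P :=
  ((hY.comp_right e).hasGaussianLaw Finset.univ).map_fun
    (ContinuousLinearMap.pi fun t : T =>
      ContinuousLinearMap.proj (R := ℝ) (φ := fun _ => ℝ)
        (⟨t, Finset.mem_univ t⟩ : (Finset.univ : Finset T)))

/-- Normal comparison for the joint probability of windows and the product over groups of
coordinates, for Gaussian random variables on a general probability space. -/
theorem abs_measureReal_windows_sub_prod_le {T ι : Type*} [Fintype T] [Fintype ι] [DecidableEq ι]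
    {Z : T → Ω → ℝ} (hZ : HasGaussianLaw (fun ω t => Z t ω) P) (g : T → ι)
    (h0 : ∀ t, ∫ ω, Z t ω ∂P = 0) (h1 : ∀ t, Var[Z t; P] = 1) {R : ℝ} (hR : R < 1)
    (hrR : ∀ s t, g s ≠ g t → |cov[Z s, Z t; P]| ≤ R)
    {B : T → Set ℝ} {w : T → ℝ} (hB : ∀ t, IsWindow (B t) (w t)) :
    |P.real {ω | ∀ t, Z t ω ∈ B t} - ∏ i, P.real {ω | ∀ t, g t = i → Z t ω ∈ B t}| ≤
      2 * Real.pi * (√(1 - R ^ 2))⁻¹ * ∑ s, ∑ t, if g s = g t then 0 else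
        |cov[Z s, Z t; P]| *
          Real.exp (-((w s ^ 2 + w t ^ 2) / (2 * (1 + |cov[Z s, Z t; P]|)))) := by
  have hm : AEMeasurable (fun ω t => Z t ω) P := hZ.aemeasurable
  have hG : IsGaussian (P.map fun ω t => Z t ω) := hZ.isGaussian_map
  have key := abs_measure_windows_sub_prod_le (μ := P.map fun ω t => Z t ω) g
    (fun t => by
      rw [integral_map hm (measurable_pi_apply t).aestronglyMeasurable]
      exact h0 t)
    (fun t => by
      rw [variance_map (measurable_pi_apply t).aemeasurable hm]
      exact h1 t)
    (r := fun s t => cov[Z s, Z t; P])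
    (fun s t => by
      rw [covariance_map (measurable_pi_apply s).aestronglyMeasurable
        (measurable_pi_apply t).aestronglyMeasurable hm]
      rfl)
    hR hrR hB
  have hmeas : ∀ s : Set T, MeasurableSet {x : T → ℝ | ∀ t, t ∈ s → x t ∈ B t} := fun s => by
    have : {x : T → ℝ | ∀ t, t ∈ s → x t ∈ B t} = Set.pi s B := rfl
    rw [this]
    exact MeasurableSet.pi s.to_countable fun t _ => (hB t).1
  have hall : MeasurableSet {x : T → ℝ | ∀ t, x t ∈ B t} := by
    simpa using hmeas Set.univ
  have hgrp : ∀ i, MeasurableSet {x : T → ℝ | ∀ t, g t = i → x t ∈ B t} := fun i =>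
    hmeas {t | g t = i}
  rw [map_measureReal_apply_of_aemeasurable hm hall] at key
  simp_rw [map_measureReal_apply_of_aemeasurable hm (hgrp _)] at key
  exact key

end Decoupling

/-! ### Maxima and minima as conditions on all entries of a row. -/

section RowEvents

variable {Ω : Type*} {X : ℕ → ℕ → Fin 2 → Ω → ℝ}

/-- The event that all entries of row `n` lie in the sets `B i`. -/
def rowEvent (X : ℕ → ℕ → Fin 2 → Ω → ℝ) (n : ℕ) (B : Fin 2 → Set ℝ) : Set Ω :=
  {ω | ∀ s : Fin n × Fin 2, X n (s.1 + 1) s.2 ω ∈ B s.2}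

lemma rowMax_le_iff {n : ℕ} (hn : 1 ≤ n) (i : Fin 2) (ω : Ω) (u : ℝ) :
    rowMax X n i ω ≤ u ↔ ∀ k : Fin n, X n (k + 1) i ω ≤ u := by
  have hfin : ((fun k => X n k i ω) '' Set.Icc 1 n).Finite := (Set.finite_Icc 1 n).image _
  have hne : ((fun k => X n k i ω) '' Set.Icc 1 n).Nonempty := (Set.nonempty_Icc.2 hn).image _
  rw [rowMax, csSup_le_iff hfin.bddAbove hne, Set.forall_mem_image]
  constructor
  · intro h k
    exact h (Set.mem_Icc.2 ⟨by omega, by omega⟩)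
  · intro h k hk
    rw [Set.mem_Icc] at hk
    have := h ⟨k - 1, by omega⟩
    rwa [Nat.sub_add_cancel hk.1] at this

lemma lt_rowMin_iff {n : ℕ} (hn : 1 ≤ n) (i : Fin 2) (ω : Ω) (v : ℝ) :
    v < rowMin X n i ω ↔ ∀ k : Fin n, v < X n (k + 1) i ω := by
  have hfin : ((fun k => X n k i ω) '' Set.Icc 1 n).Finite := (Set.finite_Icc 1 n).image _
  have hne : ((fun k => X n k i ω) '' Set.Icc 1 n).Nonempty := (Set.nonempty_Icc.2 hn).image _
  rw [rowMin, hfin.lt_csInf_iff hne, Set.forall_mem_image]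
  constructor
  · intro h k
    exact h (Set.mem_Icc.2 ⟨by omega, by omega⟩)
  · intro h k hk
    rw [Set.mem_Icc] at hk
    have := h ⟨k - 1, by omega⟩
    rwa [Nat.sub_add_cancel hk.1] at this

lemma rowMin_le_rowMax {n : ℕ} (hn : 1 ≤ n) (i : Fin 2) (ω : Ω) :
    rowMin X n i ω ≤ rowMax X n i ω :=
  csInf_le_csSup ((Set.nonempty_Icc.2 hn).image _) ((Set.finite_Icc 1 n).image _).bddBelow
    ((Set.finite_Icc 1 n).image _).bddAbove

lemma maxEvent_eq_rowEvent {n : ℕ} (hn : 1 ≤ n) (x y : ℝ) :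
    maxEvent X n x y = rowEvent X n ![Set.Iic (level n x), Set.Iic (level n y)] := by
  ext ω
  simp only [maxEvent, rowEvent, Set.mem_ofPred_eq, rowMax_le_iff hn, Prod.forall, Fin.forall_fin_two,
    forall_and]
  rfl

lemma maxMinEvent_eq_rowEvent {n : ℕ} (hn : 1 ≤ n) (x₁ x₂ y₁ y₂ : ℝ) :
    maxMinEvent X n x₁ x₂ y₁ y₂ = rowEvent X n
      ![Set.Ioc (-level n y₁) (level n x₁), Set.Ioc (-level n y₂) (level n x₂)] := by
  ext ω
  simp only [maxMinEvent, rowEvent, Set.mem_ofPred_eq, rowMax_le_iff hn, lt_rowMin_iff hn,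
    rowMin_le_rowMax hn, true_and, ← forall_and, Prod.forall, Fin.forall_fin_two]
  rfl

/-- The averages start at `k = 1`, so the empty row `0`, where an event and its row form need not
agree, plays no role. -/
lemma logAverage_congr {A A' : ℕ → Set Ω} (h : ∀ k, 1 ≤ k → A k = A' k) (n : ℕ) (ω : Ω) :
    logAverage A n ω = logAverage A' n ω := by
  unfold logAverage
  congr 1
  refine Finset.sum_congr rfl fun k hk => ?_
  rw [h k (Finset.mem_Icc.1 hk).1]

end RowEvents

/-! ### Comparison estimates for the array and the almost sure limits. -/

section Array

variable {Ω : Type*} [MeasurableSpace Ω] {P : Measure Ω} {X : ℕ → ℕ → Fin 2 → Ω → ℝ}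
  {ρ₀ : ℕ → ℝ} {ρ : Fin 2 → Fin 2 → ℕ → ℕ → ℝ} {γ : Fin 2 → Fin 2 → ℕ → ℕ → ℕ → ℝ}

/-- The entry of an array at a position of row `n`. -/
def entry (n : ℕ) (s : Fin n × Fin 2) : Position × Fin 2 :=
  (⟨(n, s.1 + 1), Nat.succ_le_succ (Nat.zero_le _), s.1.isLt⟩, s.2)

lemma gap_succ (k l : ℕ) : gap (k + 1) (l + 1) = gap k l := by
  unfold gap
  push_cast
  congr 1
  ring

lemma corr_eq_covariance {Y Z : Ω → ℝ} (hY : Var[Y; P] = 1) (hZ : Var[Z; P] = 1) :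
    corr P Y Z = cov[Y, Z; P] := by
  simp [corr, hY, hZ]

lemma IsStationaryGaussianArray.aemeasurable (hX : IsStationaryGaussianArray P X ρ₀ ρ) {n : ℕ}
    (s : Fin n × Fin 2) : AEMeasurable (X n (s.1 + 1) s.2) P :=
  hX.gaussian.aemeasurable (entry n s)

lemma IsStationaryGaussianArray.nullMeasurableSet_rowEvent
    (hX : IsStationaryGaussianArray P X ρ₀ ρ) (n : ℕ) {B : Fin 2 → Set ℝ}
    (hB : ∀ i, MeasurableSet (B i)) : NullMeasurableSet (rowEvent X n B) P := by
  have : rowEvent X n B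
      = ⋂ s : Fin n × Fin 2, X n (s.1 + 1) s.2 ⁻¹' B s.2 := by
    ext ω
    simp [rowEvent]
  rw [this]
  exact NullMeasurableSet.iInter fun s => (hX.aemeasurable s).nullMeasurableSet_preimage (hB s.2)

lemma IsStationaryGaussianArray.covariance_row (hX : IsStationaryGaussianArray P X ρ₀ ρ) {n : ℕ}
    {s t : Fin n × Fin 2} (hst : s.1 ≠ t.1) :
    cov[X n (s.1 + 1) s.2, X n (t.1 + 1) t.2; P] = ρ s.2 t.2 (gap s.1 t.1) n := by
  rw [← corr_eq_covariance (hX.unit_variance _ _ (by omega) (by omega) _)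
    (hX.unit_variance _ _ (by omega) (by omega) _), ← gap_succ]
  exact hX.corr_row n _ _ (by omega) (by omega) (by omega) (by omega)
    (fun h => hst (Fin.ext (by omega))) _ _

lemma IsStationaryGaussianArray.covariance_cross (hX : IsStationaryGaussianArray P X ρ₀ ρ)
    (hγ : HasCrossRowCorr P X γ) {m n : ℕ} (hmn : m < n) (s : Fin m × Fin 2)
    (t : Fin n × Fin 2) :
    cov[X m (s.1 + 1) s.2, X n (t.1 + 1) t.2; P] = γ s.2 t.2 (gap s.1 t.1 + 1) m n := by
  rw [← corr_eq_covariance (hX.unit_variance _ _ (by omega) (by omega) _)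
    (hX.unit_variance _ _ (by omega) (by omega) _), ← gap_succ]
  exact hγ m n _ _ hmn (by omega) (by omega) (by omega) (by omega) _ _

lemma IsStationaryGaussianArray.isStdPair (hX : IsStationaryGaussianArray P X ρ₀ ρ) {n : ℕ}
    (k : Fin n) : IsStdPair P (X n (k + 1) 0) (X n (k + 1) 1) (ρ₀ n) where
  gaussian := hX.gaussian.hasGaussianLaw_prodMk (s := entry n (k, 0)) (t := entry n (k, 1))
  mean_fst := hX.mean_zero _ _ (by omega) (by omega) _
  mean_snd := hX.mean_zero _ _ (by omega) (by omega) _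
  var_fst := hX.unit_variance _ _ (by omega) (by omega) _
  var_snd := hX.unit_variance _ _ (by omega) (by omega) _
  cov_eq := by
    rw [← corr_eq_covariance (hX.unit_variance _ _ (by omega) (by omega) _)
      (hX.unit_variance _ _ (by omega) (by omega) _)]
    exact hX.corr_same n _ (by omega) (by omega)

lemma IsRowSup.nonneg {σ : ℝ} (hσ : IsRowSup ρ σ) : 0 ≤ σ :=
  (abs_nonneg (ρ 0 0 1 2)).trans (hσ.1 ⟨0, 0, 1, 2, le_rfl, by norm_num, rfl⟩)

lemma IsCrossSup.nonneg {θ : ℝ} (hθ : IsCrossSup γ θ) : 0 ≤ θ :=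
  (abs_nonneg (γ 0 0 1 1 2)).trans
    (hθ.1 ⟨0, 0, 1, 1, 2, le_rfl, by norm_num, le_rfl, by norm_num, rfl⟩)

lemma tendsto_natCast_rpow_neg {η : ℝ} (hη : 0 < η) :
    Tendsto (fun n : ℕ => (n : ℝ) ^ (-η)) atTop (𝓝 0) :=
  (tendsto_rpow_neg_atTop hη).comp tendsto_natCast_atTop_atTop

/-- Under the Berman condition the vectors of a row are asymptotically independent for rare
events. -/
theorem tendsto_measure_rowEvent_sub_pow (hX : IsStationaryGaussianArray P X ρ₀ ρ)
    {σ α : ℝ} (hσ : IsRowSup ρ σ) (hσ1 : σ < 1) (hα0 : 0 < α) (hα : α < (1 - σ) / (1 + σ))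
    (hBerman : BermanCondition ρ α) {z : ℝ} {B : ℕ → Fin 2 → Set ℝ}
    (hB : ∀ᶠ n in atTop, ∀ i, IsWindow (B n i) (level n z)) :
    Tendsto (fun n => P.real (rowEvent X n (B n))
      - (bivGaussian (ρ₀ n)).real (B n 0 ×ˢ B n 1) ^ n) atTop (𝓝 0) := by
  obtain ⟨η, hη, K, hK, N, hsum⟩ := exists_comparison_sum_bound z hσ.nonneg hσ1 hα0 hα
  set c : ℝ := 2 * Real.pi * (√(1 - σ ^ 2))⁻¹ with hc
  have hc0 : 0 ≤ c := by positivity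
  have hmain : ∀ δ : ℝ, 0 < δ → δ ≤ 1 → ∀ᶠ n in atTop,
      |P.real (rowEvent X n (B n)) - (bivGaussian (ρ₀ n)).real (B n 0 ×ˢ B n 1) ^ n|
        ≤ c * (K * ((n : ℝ) ^ (-η) + δ)) := by
    intro δ hδ hδ1
    filter_upwards [hB, eventually_ge_atTop N, eventually_log_pos, hBerman δ hδ]
      with n hBn hnN hlog hbn
    set Z : Fin n × Fin 2 → Ω → ℝ := fun s => X n (s.1 + 1) s.2 with hZ
    have hlaw : HasGaussianLaw (fun ω t => Z t ω) P :=
      hasGaussianLaw_of_isGaussianProcess hX.gaussian (entry n)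
    -- The groups are the positions. The two components at one position stay coupled, so their
    -- correlation, which may tend to `1`, is left out of the sum and the bound `σ < 1` is needed
    -- only across positions.
    set r : Fin n × Fin 2 → Fin n × Fin 2 → ℝ := fun s t =>
      if s.1 = t.1 then 0 else cov[Z s, Z t; P] with hr
    have hgap : ∀ s t : Fin n × Fin 2, s.1 ≠ t.1 → 1 ≤ gap s.1 t.1 ∧ gap s.1 t.1 < n := by
      intro s t hst
      have h1 := s.1.isLt
      have h2 := t.1.isLt
      have h3 : (s.1 : ℕ) ≠ t.1 := fun h => hst (Fin.ext h)
      unfold gap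
      omega
    have hcov : ∀ s t, s.1 ≠ t.1 → |cov[Z s, Z t; P]| ≤ σ := fun s t hst => by
      rw [hZ, hX.covariance_row hst]
      exact hσ.1 ⟨_, _, _, _, (hgap s t hst).1, (hgap s t hst).2, rfl⟩
    have hdec := abs_measureReal_windows_sub_prod_le hlaw Prod.fst
      (fun t => hX.mean_zero _ _ (by omega) (by omega) _)
      (fun t => hX.unit_variance _ _ (by omega) (by omega) _) hσ1 hcov
      (B := fun t => B n t.2) (w := fun _ => level n z) fun t => hBn t.2
    have hprod : ∏ i : Fin n, P.real {ω | ∀ t : Fin n × Fin 2, t.1 = i → Z t ω ∈ B n t.2}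
        = (bivGaussian (ρ₀ n)).real (B n 0 ×ˢ B n 1) ^ n := by
      rw [Finset.prod_eq_pow_card (b := (bivGaussian (ρ₀ n)).real (B n 0 ×ˢ B n 1)),
        Finset.card_univ, Fintype.card_fin]
      intro i _
      have hpair := hX.isStdPair i
      rw [← hpair.map_eq_bivGaussian, map_measureReal_apply_of_aemeasurable
        hpair.gaussian.aemeasurable ((hBn 0).1.prod (hBn 1).1)]
      congr 1
      ext ω
      simp only [Set.mem_ofPred_eq, Prod.forall, Fin.forall_fin_two, Set.mem_preimage,
        Set.mem_prod, hZ]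
      constructor
      · intro h
        exact ⟨(h i).1 rfl, (h i).2 rfl⟩
      · rintro h k
        exact ⟨fun hk => hk ▸ h.1, fun hk => hk ▸ h.2⟩
    rw [hprod] at hdec
    -- The Berman condition says that far correlations are at most `q = δ / ln n`, which makes the
    -- far contribution proportional to `δ`.
    have hq : δ / Real.log n * Real.log n = δ := div_mul_cancel₀ _ hlog.ne'
    have hbound := hsum n n hnN le_rfl r (δ / Real.log n) (by positivity) (by rw [hq]; exact hδ1)
      (fun s t => by
        by_cases hst : s.1 = t.1
        · simp only [hr, hst, if_true, abs_zero]
          exact hσ.nonneg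
        · simp only [hr, hst, if_false]
          exact hcov s t hst)
      (fun s t hfar => by
        by_cases hst : s.1 = t.1
        · simp only [hr, hst, if_true, abs_zero]
          positivity
        · simp only [hr, hst, if_false]
          rw [hZ, hX.covariance_row hst, le_div_iff₀ hlog]
          exact hbn _ _ _ hfar (hgap s t hst).2)
    rw [hq] at hbound
    refine hdec.trans (mul_le_mul_of_nonneg_left (le_trans (le_of_eq ?_) hbound) hc0)
    refine Finset.sum_congr rfl fun s _ => Finset.sum_congr rfl fun t _ => ?_
    by_cases hst : s.1 = t.1 <;> simp [hr, hst]
  rw [tendsto_zero_iff_abs_tendsto_zero, Metric.tendsto_atTop']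
  intro e he
  -- Both terms of the bound will be at most `c K δ`, so the total is at most `e / 2`.
  set δ : ℝ := min 1 (e / (4 * (c * K + 1))) with hδdef
  have hcK : 0 < c * K + 1 := by positivity
  have hδ : 0 < δ := lt_min one_pos (by positivity)
  have hδe : δ * (4 * (c * K + 1)) ≤ e := by
    rw [← le_div_iff₀ (by positivity)]
    exact min_le_right _ _
  have hev := (hmain δ hδ (min_le_left _ _)).and
    ((tendsto_natCast_rpow_neg hη).eventually_le_const hδ)
  obtain ⟨M, hM⟩ := eventually_atTop.1 hev
  refine ⟨M, fun n hn => ?_⟩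
  obtain ⟨h1, h2⟩ := hM n hn.le
  simp only [Function.comp, Real.dist_eq, sub_zero, abs_abs]
  calc _ ≤ c * (K * ((n : ℝ) ^ (-η) + δ)) := h1
    _ ≤ c * (K * (δ + δ)) := by gcongr
    _ < e := by nlinarith

/-- Cross-row correlations beyond the distance `[n ^ β]` are of order
`1 / (ln n (ln ln n) ^ (1 + ε))`. -/
lemma CrossRate.exists_eventually_abs_mul_log_le {β ε : ℝ} (h : CrossRate γ β ε) (hβ : 0 < β)
    (hε : 0 < ε) : ∃ C, 0 ≤ C ∧ ∀ᶠ n : ℕ in atTop, ∀ m, 1 ≤ m → m < n → ∀ i j t,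
      powFloor β n ≤ t → t ≤ n →
        |γ i j t m n| ≤ C * Real.log (Real.log n) ^ (-(1 + ε)) / Real.log n := by
  obtain ⟨C₀, hC₀⟩ := h
  refine ⟨|C₀| * (2 / β) * 2 ^ (1 + ε), by positivity, ?_⟩
  have hloglog : Tendsto (fun n : ℕ => Real.log (Real.log n)) atTop atTop :=
    Real.tendsto_log_atTop.comp tendsto_log_natCast
  filter_upwards [hC₀, eventually_log_pos, hloglog.eventually_gt_atTop 0,
    hloglog.eventually_ge_atTop (-2 * Real.log (β / 2)), eventually_ge_atTop 1,
    (tendsto_natCast_rpow_atTop (half_pos hβ)).eventually_ge_atTop 2]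
    with n hn hlog hll hll2 hn1 hpow m hm hmn i j t ht htn
  have hn0 : (0 : ℝ) < n := by exact_mod_cast hn1
  -- The integer part loses less than `1`, and `n^β - 1 ≥ n^{β/2}` once `n^{β/2} ≥ 2`. Hence `ln t`
  -- and `ln ln t` are at least `(β/2) ln n` and `(1/2) ln ln n`, and `t` can be traded for `n` at
  -- the cost of constants.
  have hle : (n : ℝ) ^ (β / 2) ≤ t := by
    have h1 : (n : ℝ) ^ β < powFloor β n + 1 := Nat.lt_floor_add_one _
    have h2 : (powFloor β n : ℝ) ≤ t := by exact_mod_cast ht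
    have h3 : (n : ℝ) ^ β = (n : ℝ) ^ (β / 2) * (n : ℝ) ^ (β / 2) := by
      rw [← Real.rpow_add hn0]
      ring_nf
    nlinarith
  have hlt : β / 2 * Real.log n ≤ Real.log t := by
    rw [← Real.log_rpow hn0]
    exact Real.log_le_log (by positivity) hle
  have hllt : 1 / 2 * Real.log (Real.log n) ≤ Real.log (Real.log t) := by
    have h1 := Real.log_le_log (by positivity) hlt
    rw [Real.log_mul (by positivity) hlog.ne'] at h1
    linarith
  have hCt := hn m hm hmn i j t ht htn
  have hlow : β / 2 * Real.log n * (1 / 2 * Real.log (Real.log n)) ^ (1 + ε)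
      ≤ Real.log t * Real.log (Real.log t) ^ (1 + ε) := by
    gcongr
  have h1 : |γ i j t m n| * (β / 2 * Real.log n * (1 / 2 * Real.log (Real.log n)) ^ (1 + ε))
      ≤ |C₀| := by
    refine (mul_le_mul_of_nonneg_left hlow (abs_nonneg _)).trans ?_
    rw [← mul_assoc]
    exact hCt.trans (le_abs_self _)
  rw [← le_div_iff₀ (by positivity)] at h1
  refine h1.trans (le_of_eq ?_)
  rw [Real.mul_rpow (by norm_num) hll.le, Real.rpow_neg hll.le, one_div,
    Real.inv_rpow (by norm_num)]
  field_simp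

lemma eventually_rpow_neg_le_logLog {η : ℝ} (hη : 0 < η) {s : ℝ} (hs : 0 < s) :
    ∀ᶠ n : ℕ in atTop, (n : ℝ) ^ (-η) ≤ Real.log (Real.log n) ^ (-s) := by
  have hloglog : Tendsto (fun n : ℕ => Real.log (Real.log n)) atTop atTop :=
    Real.tendsto_log_atTop.comp tendsto_log_natCast
  have hlo := ((isLittleO_log_rpow_rpow_atTop s hη).bound one_pos)
  filter_upwards [tendsto_natCast_atTop_atTop.eventually hlo, eventually_log_pos,
    hloglog.eventually_gt_atTop 0, eventually_ge_atTop 1] with n hn hlog hll hn1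
  have hn0 : (0 : ℝ) < n := by exact_mod_cast hn1
  rw [one_mul, Real.norm_of_nonneg (by positivity), Real.norm_of_nonneg (by positivity)] at hn
  rw [Real.rpow_neg hn0.le, Real.rpow_neg hll.le]
  refine inv_anti₀ (by positivity) (le_trans ?_ hn)
  have := Real.log_le_sub_one_of_pos hlog
  exact Real.rpow_le_rpow hll.le (by linarith) hs.le

/-- Row events of different rows are asymptotically independent. -/
theorem exists_abs_measure_inter_rowEvent_sub_le (hX : IsStationaryGaussianArray P X ρ₀ ρ)
    (hγ : HasCrossRowCorr P X γ) {θ β : ℝ} (hθ : IsCrossSup γ θ) (hθ1 : θ < 1)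
    (hβ0 : 0 < β) (hβ : β < (1 - θ) / (1 + θ)) {ε : ℝ} (hε : 0 < ε)
    (hrate : CrossRate γ β ε) {z : ℝ} {B : ℕ → Fin 2 → Set ℝ}
    (hB : ∀ᶠ n in atTop, ∀ i, IsWindow (B n i) (level n z)) :
    ∃ C, 0 ≤ C ∧ ∃ N₀ : ℕ, ∀ m n, N₀ ≤ m → m < n →
      |P.real (rowEvent X m (B m) ∩ rowEvent X n (B n))
          - P.real (rowEvent X m (B m)) * P.real (rowEvent X n (B n))|
        ≤ C * Real.log (Real.log n) ^ (-(1 + ε)) := by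
  obtain ⟨η, hη, K, hK, N, hsum⟩ := exists_comparison_sum_bound z hθ.nonneg hθ1 hβ0 hβ
  obtain ⟨C₁, hC₁, hfar⟩ := hrate.exists_eventually_abs_mul_log_le hβ0 hε
  set c : ℝ := 2 * Real.pi * (√(1 - θ ^ 2))⁻¹ with hc
  have hc0 : 0 ≤ c := by positivity
  have hloglog : Tendsto (fun n : ℕ => Real.log (Real.log n)) atTop atTop :=
    Real.tendsto_log_atTop.comp tendsto_log_natCast
  have hs : 0 < 1 + ε := by linarith
  have hsmall : ∀ᶠ n : ℕ in atTop, C₁ * Real.log (Real.log n) ^ (-(1 + ε)) ≤ 1 := by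
    have := ((tendsto_rpow_neg_atTop hs).comp hloglog).const_mul C₁
    rw [mul_zero] at this
    exact this.eventually_le_const one_pos
  obtain ⟨N₁, hN₁⟩ := eventually_atTop.1 ((((hB.and hfar).and hsmall).and eventually_log_pos).and
    ((eventually_rpow_neg_le_logLog hη hs).and (hloglog.eventually_gt_atTop 0)))
  refine ⟨2 * (c * (K * (1 + C₁))), by positivity, max N (max N₁ 1), fun m n hm hmn => ?_⟩
  have hmN : N ≤ m := (le_max_left _ _).trans hm
  have hmN₁ : N₁ ≤ m := (le_max_left _ _).trans ((le_max_right _ _).trans hm)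
  have hm1 : 1 ≤ m := (le_max_right _ _).trans ((le_max_right _ _).trans hm)
  have hBm := (hN₁ m hmN₁).1.1.1.1
  obtain ⟨⟨⟨⟨hBn, hfarn⟩, hsmalln⟩, hlog⟩, hpown, hll⟩ := hN₁ n (hmN₁.trans hmn.le)
  -- The two rows form one Gaussian vector with the rows as its two groups, so only correlations
  -- between the rows enter the comparison.
  set Z : (Fin m × Fin 2) ⊕ (Fin n × Fin 2) → Ω → ℝ :=
    Sum.elim (fun s => X m (s.1 + 1) s.2) fun t => X n (t.1 + 1) t.2 with hZ
  have hlaw : HasGaussianLaw (fun ω t => Z t ω) P := by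
    have := hasGaussianLaw_of_isGaussianProcess hX.gaussian (Sum.elim (entry m) (entry n))
    convert this using 3 with ω t
    cases t <;> rfl
  set r : Fin m × Fin 2 → Fin n × Fin 2 → ℝ := fun s t => cov[Z (.inl s), Z (.inr t); P] with hr
  have hrγ : ∀ s t, r s t = γ s.2 t.2 (gap s.1 t.1 + 1) m n := fun s t =>
    hX.covariance_cross hγ hmn s t
  have hgap : ∀ (s : Fin m × Fin 2) (t : Fin n × Fin 2), gap s.1 t.1 + 1 ≤ n := by
    intro s t
    have h1 := s.1.isLt
    have h2 := t.1.isLt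
    unfold gap
    omega
  have hrθ : ∀ s t, |r s t| ≤ θ := fun s t => by
    rw [hrγ]
    exact hθ.1 ⟨_, _, _, _, _, by omega, hgap s t, hm1, hmn, rfl⟩
  have hcomm : ∀ s t, cov[Z (.inr t), Z (.inl s); P] = r s t := fun s t => covariance_comm _ _
  have hdec := abs_measureReal_windows_sub_prod_le hlaw (Sum.isLeft)
    (by
      rintro (t | t)
      · exact hX.mean_zero _ _ (by omega) (by omega) _
      · exact hX.mean_zero _ _ (by omega) (by omega) _)
    (by
      rintro (t | t)
      · exact hX.unit_variance _ _ (by omega) (by omega) _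
      · exact hX.unit_variance _ _ (by omega) (by omega) _) hθ1
    (by
      rintro (s | s) (t | t) hst
      · simp at hst
      · exact hrθ s t
      · rw [hcomm]
        exact hrθ t s
      · simp at hst)
    (B := Sum.elim (fun s => B m s.2) fun t => B n t.2)
    (w := Sum.elim (fun _ => level m z) fun _ => level n z)
    (by
      rintro (t | t)
      · exact hBm t.2
      · exact hBn t.2)
  rw [Fintype.prod_bool] at hdec
  have hinter : {ω | ∀ t, Z t ω ∈ (Sum.elim (fun s => B m s.2) fun t => B n t.2 :
      (Fin m × Fin 2) ⊕ (Fin n × Fin 2) → Set ℝ) t}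
      = rowEvent X m (B m) ∩ rowEvent X n (B n) := by
    ext ω
    simp [rowEvent, hZ, Sum.forall]
  have hleft : {ω | ∀ t, t.isLeft = true → Z t ω ∈ (Sum.elim (fun s => B m s.2) fun t => B n t.2 :
      (Fin m × Fin 2) ⊕ (Fin n × Fin 2) → Set ℝ) t} = rowEvent X m (B m) := by
    ext ω
    simp [rowEvent, hZ, Sum.forall]
  have hright : {ω | ∀ t, t.isLeft = false → Z t ω ∈ (Sum.elim (fun s => B m s.2)
      fun t => B n t.2 : (Fin m × Fin 2) ⊕ (Fin n × Fin 2) → Set ℝ) t}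
      = rowEvent X n (B n) := by
    ext ω
    simp [rowEvent, hZ, Sum.forall]
  rw [hinter, hleft, hright] at hdec
  set G : Fin m × Fin 2 → Fin n × Fin 2 → ℝ := fun s t =>
    |r s t| * Real.exp (-((level m z ^ 2 + level n z ^ 2) / (2 * (1 + |r s t|)))) with hG
  -- The comparison sum runs over ordered pairs, so each pair of entries from different rows occurs
  -- twice.
  have hsums : ∀ F : (Fin m × Fin 2) ⊕ (Fin n × Fin 2) → (Fin m × Fin 2) ⊕ (Fin n × Fin 2) → ℝ,
      (∀ s s', F (.inl s) (.inl s') = 0) → (∀ t t', F (.inr t) (.inr t') = 0) →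
      (∀ s t, F (.inl s) (.inr t) = G s t) → (∀ s t, F (.inr t) (.inl s) = G s t) →
      ∑ a, ∑ b, F a b = 2 * ∑ s, ∑ t, G s t := by
    intro F h1 h2 h3 h4
    simp only [Fintype.sum_sum_type, h1, h2, h3, h4, Finset.sum_const_zero, zero_add, add_zero]
    rw [Finset.sum_comm (s := (Finset.univ : Finset (Fin n × Fin 2)))]
    ring
  rw [hsums _ (by simp) (by simp) (fun s t => by simp [hG, hr]) (fun s t => by
    simp [hG, hcomm, add_comm])] at hdec
  have hq : C₁ * Real.log (Real.log n) ^ (-(1 + ε)) / Real.log n * Real.log n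
      = C₁ * Real.log (Real.log n) ^ (-(1 + ε)) := div_mul_cancel₀ _ hlog.ne'
  have hbound := hsum m n hmN hmn.le r
    (C₁ * Real.log (Real.log n) ^ (-(1 + ε)) / Real.log n) (by positivity)
    (by rw [hq]; exact hsmalln) hrθ
    -- The argument of `γ` is the gap plus one, so a gap of at least `[n^β]` is more than enough.
    (fun s t hst => by
      rw [hrγ]
      exact hfarn m hm1 hmn _ _ _ (hst.trans (Nat.le_succ _)) (hgap s t))
  rw [hq] at hbound
  calc _ ≤ _ := hdec
    _ ≤ c * (2 * (K * ((n : ℝ) ^ (-η) + C₁ * Real.log (Real.log n) ^ (-(1 + ε))))) := by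
        gcongr
    _ ≤ c * (2 * (K * (Real.log (Real.log n) ^ (-(1 + ε))
          + C₁ * Real.log (Real.log n) ^ (-(1 + ε))))) := by
        gcongr
    _ = _ := by ring

/-- Almost sure limit of logarithmic averages of row events, given the limit for independent
vectors with the same correlation. -/
theorem ae_tendsto_logAverage_rowEvent [IsProbabilityMeasure P]
    (hX : IsStationaryGaussianArray P X ρ₀ ρ)
    {σ α : ℝ} (hσ : IsRowSup ρ σ) (hσ1 : σ < 1) (hα0 : 0 < α) (hα : α < (1 - σ) / (1 + σ))
    (hBerman : BermanCondition ρ α)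
    (hγ : HasCrossRowCorr P X γ) {θ β : ℝ} (hθ : IsCrossSup γ θ) (hθ1 : θ < 1)
    (hβ0 : 0 < β) (hβ : β < (1 - θ) / (1 + θ)) {ε : ℝ} (hε : 0 < ε)
    (hrate : CrossRate γ β ε) {z : ℝ} {B : ℕ → Fin 2 → Set ℝ}
    (hBm : ∀ n i, MeasurableSet (B n i))
    (hB : ∀ᶠ n in atTop, ∀ i, IsWindow (B n i) (level n z)) {p : ℝ}
    (hp : Tendsto (fun n => (bivGaussian (ρ₀ n)).real (B n 0 ×ˢ B n 1) ^ n) atTop (𝓝 p)) :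
    ∀ᵐ ω ∂P, Tendsto (fun n => logAverage (fun k => rowEvent X k (B k)) n ω) atTop (𝓝 p) := by
  obtain ⟨C, hC, N₀, hcross⟩ :=
    exists_abs_measure_inter_rowEvent_sub_le hX hγ hθ hθ1 hβ0 hβ hε hrate hB
  refine ae_tendsto_logAverage (fun k => hX.nullMeasurableSet_rowEvent k (hBm k)) ?_ hC hε hcross
  have := (tendsto_measure_rowEvent_sub_pow hX hσ hσ1 hα0 hα hBerman hB).add hp
  simpa using this

lemma level_mono {n : ℕ} (h : 0 < Real.log n) {z z' : ℝ} (hz : z ≤ z') :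
    level n z ≤ level n z' := by
  have := mul_le_mul_of_nonneg_left hz (scaleConst_pos h).le
  unfold level
  linarith

/-- The smallest argument gives a common lower bound for the distance of all endpoints from the
origin, so one level serves in the comparison sums. -/
lemma eventually_isWindow_Iic (x y : ℝ) : ∀ᶠ n in atTop, ∀ i : Fin 2,
    IsWindow ((![Set.Iic (level n x), Set.Iic (level n y)] : Fin 2 → Set ℝ) i)
      (level n (min x y)) := by
  filter_upwards [eventually_log_pos, (tendsto_level_atTop (min x y)).eventually_ge_atTop 0]
    with n hlog h0
  rw [Fin.forall_fin_two]
  exact ⟨isWindow_Iic h0 ((level_mono hlog (min_le_left x y)).trans (le_abs_self _)),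
    isWindow_Iic h0 ((level_mono hlog (min_le_right x y)).trans (le_abs_self _))⟩

lemma eventually_isWindow_Ioc (x₁ x₂ y₁ y₂ : ℝ) : ∀ᶠ n in atTop, ∀ i : Fin 2,
    IsWindow ((![Set.Ioc (-level n y₁) (level n x₁), Set.Ioc (-level n y₂) (level n x₂)] :
      Fin 2 → Set ℝ) i) (level n (min (min x₁ x₂) (min y₁ y₂))) := by
  set z := min (min x₁ x₂) (min y₁ y₂) with hz
  filter_upwards [eventually_log_pos, (tendsto_level_atTop z).eventually_ge_atTop 0]
    with n hlog h0
  have hx₁ : level n z ≤ level n x₁ := level_mono hlog (by simp [hz])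
  have hx₂ : level n z ≤ level n x₂ := level_mono hlog (by simp [hz])
  have hy₁ : level n z ≤ level n y₁ := level_mono hlog (by simp [hz])
  have hy₂ : level n z ≤ level n y₂ := level_mono hlog (by simp [hz])
  rw [Fin.forall_fin_two]
  exact ⟨isWindow_Ioc h0 (hx₁.trans (le_abs_self _))
      (by rw [abs_neg]; exact hy₁.trans (le_abs_self _)) (by linarith),
    isWindow_Ioc h0 (hx₂.trans (le_abs_self _))
      (by rw [abs_neg]; exact hy₂.trans (le_abs_self _)) (by linarith)⟩

/-- Write `(1 + ρ₀) ln n = 2 ln n - (1 - ρ₀) ln n`; for finite `λ` the subtracted term is bounded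
above. -/
lemma tendsto_one_add_mul_log_atTop {lam : ℝ≥0∞} (hlam : Tendsto
    (fun n : ℕ => ENNReal.ofReal ((1 - ρ₀ n) * Real.log n)) atTop (𝓝 (lam ^ 2)))
    (hfin : lam ≠ ⊤) : Tendsto (fun n : ℕ => (1 + ρ₀ n) * Real.log n) atTop atTop := by
  have hlt : lam ^ 2 < lam ^ 2 + 1 :=
    ENNReal.lt_add_right (ENNReal.pow_ne_top hfin) one_ne_zero
  have hev := hlam.eventually_lt_const hlt
  have hc : Tendsto (fun n : ℕ => 2 * Real.log n - (lam ^ 2 + 1).toReal) atTop atTop :=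
    tendsto_atTop_add_const_right _ _ (tendsto_log_natCast.const_mul_atTop (by norm_num))
  refine tendsto_atTop_mono' _ ?_ hc
  filter_upwards [hev] with n hn
  have h1 : (1 - ρ₀ n) * Real.log n ≤ (lam ^ 2 + 1).toReal :=
    (ENNReal.ofReal_le_iff_le_toReal (by finiteness)).1 hn.le
  linarith

end Array

end HuslerReiss

end

theorem theorem2p2 {Ω : Type*} [MeasurableSpace Ω] (P : Measure Ω) [IsProbabilityMeasure P]
    (X : ℕ → ℕ → Fin 2 → Ω → ℝ) (ρ₀ : ℕ → ℝ) (ρ : Fin 2 → Fin 2 → ℕ → ℕ → ℝ)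
    (γ : Fin 2 → Fin 2 → ℕ → ℕ → ℕ → ℝ)
    (hX : HuslerReiss.IsStationaryGaussianArray P X ρ₀ ρ)
    (σ α : ℝ) (hσ : HuslerReiss.IsRowSup ρ σ) (hσ1 : σ < 1)
    (hα0 : 0 < α) (hα : α < (1 - σ) / (1 + σ))
    (hBerman : HuslerReiss.BermanCondition ρ α)
    (lam : ℝ≥0∞)
    (hlam : Tendsto (fun n : ℕ => ENNReal.ofReal ((1 - ρ₀ n) * Real.log n)) atTop (𝓝 (lam ^ 2)))
    (hγ : HuslerReiss.HasCrossRowCorr P X γ)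
    (θ β : ℝ) (hθ : HuslerReiss.IsCrossSup γ θ) (hθ1 : θ < 1)
    (hβ0 : 0 < β) (hβ : β < (1 - θ) / (1 + θ))
    (ε : ℝ) (hε : 0 < ε)
    (hρrate : HuslerReiss.RowRate ρ α ε) (hγrate : HuslerReiss.CrossRate γ β ε) :
    (∀ x y : ℝ, ∀ᵐ ω ∂P,
      Tendsto (fun n : ℕ => HuslerReiss.logAverage (fun k => HuslerReiss.maxEvent X k x y) n ω)
        atTop (𝓝 (HuslerReiss.hrCDF lam x y))) ∧
    ((lam = ⊤ → Tendsto (fun n : ℕ => (1 + ρ₀ n) * Real.log n) atTop atTop) →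
      ∀ x₁ x₂ y₁ y₂ : ℝ, ∀ᵐ ω ∂P,
        Tendsto
          (fun n : ℕ =>
            HuslerReiss.logAverage (fun k => HuslerReiss.maxMinEvent X k x₁ x₂ y₁ y₂) n ω)
          atTop (𝓝 (HuslerReiss.hrCDF lam x₁ x₂ * HuslerReiss.hrCDF lam y₁ y₂))) := by
  -- Every nonempty row makes `ρ₀ n` a genuine correlation, so `(1 - ρ₀ n) ln n` is nonnegative and
  -- `ENNReal.ofReal` in `hlam` truncates nothing.
  have hρ : ∀ᶠ n in atTop, |ρ₀ n| ≤ 1 := by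
    filter_upwards [eventually_ge_atTop 1] with n hn
    exact (hX.isStdPair (⟨0, hn⟩ : Fin n)).abs_le_one
  refine ⟨fun x y => ?_, fun htop x₁ x₂ y₁ y₂ => ?_⟩
  · have hlim := HuslerReiss.tendsto_bivGaussian_quadrant_pow hρ hlam x y
    have hmeas : ∀ (n : ℕ) (i : Fin 2), MeasurableSet ((![Set.Iic (HuslerReiss.level n x),
        Set.Iic (HuslerReiss.level n y)] : Fin 2 → Set ℝ) i) := fun n =>
      Fin.forall_fin_two.2 ⟨measurableSet_Iic, measurableSet_Iic⟩
    filter_upwards [HuslerReiss.ae_tendsto_logAverage_rowEvent hX hσ hσ1 hα0 hα hBerman hγ hθ hθ1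
      hβ0 hβ hε hγrate hmeas (HuslerReiss.eventually_isWindow_Iic x y) hlim] with ω hω
    exact hω.congr fun n => HuslerReiss.logAverage_congr
      (fun k hk => (HuslerReiss.maxEvent_eq_rowEvent hk x y).symm) n ω
  · have hadd : Tendsto (fun n : ℕ => (1 + ρ₀ n) * Real.log n) atTop atTop := by
      by_cases h : lam = ⊤
      · exact htop h
      · exact HuslerReiss.tendsto_one_add_mul_log_atTop hlam h
    have hlim := HuslerReiss.tendsto_bivGaussian_box_pow hρ hlam hadd x₁ x₂ y₁ y₂
    have hmeas : ∀ (n : ℕ) (i : Fin 2), MeasurableSet ((![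
        Set.Ioc (-HuslerReiss.level n y₁) (HuslerReiss.level n x₁),
        Set.Ioc (-HuslerReiss.level n y₂) (HuslerReiss.level n x₂)] : Fin 2 → Set ℝ) i) :=
      fun n => Fin.forall_fin_two.2 ⟨measurableSet_Ioc, measurableSet_Ioc⟩
    filter_upwards [HuslerReiss.ae_tendsto_logAverage_rowEvent hX hσ hσ1 hα0 hα hBerman hγ hθ hθ1
      hβ0 hβ hε hγrate hmeas (HuslerReiss.eventually_isWindow_Ioc x₁ x₂ y₁ y₂) hlim] with ω hω
    exact hω.congr fun n => HuslerReiss.logAverage_congr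
      (fun k hk => (HuslerReiss.maxMinEvent_eq_rowEvent hk x₁ x₂ y₁ y₂).symm) n ω
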